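/- **Conventions.** Let $(M,g)$ be a Riemannian manifold with Riemannian distance $d$. An *escaping geodesic* is a unit speed geodesic $\gamma:\mathbb R\to M$ such that for every compact $K\subset M$ there is $t_0>0$ with $\gamma(t)\notin K$ whenever $|t|\ge t_0$. For a continuous compactly supported $f:M\to\mathbb R$ put $Xf(\gamma)=\int_{-\infty}^{\infty}f(\gamma(t))\,dt$. The manifold $M$ *has a support theorem* if to every compact $K\subset M$ one can assign a compact set $\widehat K\subset M$ such that (a) for every $f\in C_c(M)$: if $Xf(\gamma)=0$ for all escaping geodesics $\gamma$ contained in $M\setminus K$, then $\operatorname{supp} f\subset\widehat K$; (b) if $K_1\supset K_2\supset\cdots$ are compact sets with $\operatorname{diam}K_n\to0$, then $\operatorname{diam}\widehat{K_n}\to0$. A *plane* in $M$ is a closed, totally geodesic, embedded 2-dimensional submanifold that is diffeomorphic to $\mathbb R^2$ and whose induced metric has constant non-positive curvature. A *plane cover* of $M$ is a collection of planes whose union is $M$; it is *Euclidean* if all of its planes are flat (curvature $0$). **Proposition.** Let $G$ be a simply connected $k$-step nilpotent Lie group (that is, its Lie algebra $\mathfrak g$ is $k$-step nilpotent) with a left-invariant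 Riemannian metric, and let $0=\mathfrak g_0\subset\mathfrak g_1\subset\cdots\subset\mathfrak g_k=\mathfrak g$ be the upper central series of $\mathfrak g$. Assume that for some $i\in\{1,\dots,k\}$ $$\dim \mathfrak g_i/\mathfrak g_{i-1}>1+\dim\mathfrak g_{i-1}.$$ Then 1. there are linearly independent $x,y\in\mathfrak g$ with $[x,y]=0$ such that the left translates of $F=\operatorname{Exp}(\operatorname{span}\{x,y\})$ form a Euclidean plane cover of $G$ (in particular, $F$ is a closed, flat, totally geodesic plane), and 2. $G$ has a support theorem. In particular, both conclusions hold if $\dim\mathfrak g_i\ge 2^i$ for some $i\in\{1,\dots,k\}$, or if $\dim G\ge 2^k$, or if the center of $\mathfrak g$ has dimension at least $2$. -/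

import Mathlib

open Set Filter Topology Bundle
open scoped Manifold ContDiff ENNReal Pointwise

noncomputable section

/-! ### Metrics, geodesics and curvature in coordinates -/

section Coordinates

variable {F : Type*} [NormedAddCommGroup F] [NormedSpace ℝ F]

/-- Christoffel symbols of the first kind of a metric `g` on (an open part of) the vector space
`F`, where `g x v w` is the scalar product at `x` of `v` and `w`:
`Γ(u, v; w) = 1/2 (∂_u g(v, w) + ∂_v g(u, w) - ∂_w g(u, v))`. -/
def christoffelFirst (g : F → F → F → ℝ) (x u v w : F) : ℝ :=
  (fderiv ℝ (fun y => g y v w) x u + fderiv ℝ (fun y => g y u w) x v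
    - fderiv ℝ (fun y => g y u v) x w) / 2

/-- The geodesic equation `c'' + Γ(c', c') = 0` at time `t`, with the index lowered by the
(nondegenerate) metric `g`. -/
def GeodesicEqAt (g : F → F → F → ℝ) (c : ℝ → F) (t : ℝ) : Prop :=
  ∀ w : F, g (c t) (deriv (deriv c) t) w
    + christoffelFirst g (c t) (deriv c t) (deriv c t) w = 0

/-- The Gauss curvature of a Riemannian metric on the plane with coordinates `(u, v)`,
given by the formula of Brioschi. -/
def gaussCurvature (g : ℝ × ℝ → ℝ × ℝ → ℝ × ℝ → ℝ) (x : ℝ × ℝ) : ℝ :=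
  let du : (ℝ × ℝ → ℝ) → ℝ × ℝ → ℝ := fun h y => fderiv ℝ h y (1, 0)
  let dv : (ℝ × ℝ → ℝ) → ℝ × ℝ → ℝ := fun h y => fderiv ℝ h y (0, 1)
  let E : ℝ × ℝ → ℝ := fun y => g y (1, 0) (1, 0)
  let F : ℝ × ℝ → ℝ := fun y => g y (1, 0) (0, 1)
  let G : ℝ × ℝ → ℝ := fun y => g y (0, 1) (0, 1)
  ((!![-(dv (dv E) x) / 2 + dv (du F) x - (du (du G) x) / 2, du E x / 2, du F x - dv E x / 2;
      dv F x - du G x / 2, E x, F x;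
      dv G x / 2, F x, G x] : Matrix (Fin 3) (Fin 3) ℝ).det
    - (!![0, dv E x / 2, du G x / 2;
      dv E x / 2, E x, F x;
      du G x / 2, F x, G x] : Matrix (Fin 3) (Fin 3) ℝ).det)
  / (E x * G x - F x ^ 2) ^ 2

end Coordinates

/-! ### Riemannian manifolds, X-ray transform, support theorem, planes -/

section Riemannian

variable {E : Type*} [NormedAddCommGroup E] [NormedSpace ℝ E]
  {M : Type*} [TopologicalSpace M] [ChartedSpace E M]
  [RiemannianBundle (fun p : M => TangentSpace 𝓘(ℝ, E) p)]

/-- The pullback to the vector space `F` of the metric of `M` by a map `φ : F → M`. -/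
def pullbackMetric {F : Type*} [NormedAddCommGroup F] [NormedSpace ℝ F] (φ : F → M)
    (x v w : F) : ℝ :=
  inner ℝ (mfderiv 𝓘(ℝ, F) 𝓘(ℝ, E) φ x v) (mfderiv 𝓘(ℝ, F) 𝓘(ℝ, E) φ x w)

/-- `γ` is a (smooth, not necessarily unit speed) geodesic of `M` on the open set `s` of times:
at every time, it solves the geodesic equation in the chart around its current position. -/
def IsGeodesicOn (γ : ℝ → M) (s : Set ℝ) : Prop :=
  ContMDiffOn 𝓘(ℝ, ℝ) 𝓘(ℝ, E) ∞ γ s ∧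
    ∀ t ∈ s, GeodesicEqAt (pullbackMetric (E := E) (extChartAt 𝓘(ℝ, E) (γ t)).symm)
      (extChartAt 𝓘(ℝ, E) (γ t) ∘ γ) t

/-- Escaping geodesics: unit speed geodesics `γ : ℝ → M` that eventually leave every compact set
in both directions. -/
def IsEscapingGeodesic (γ : ℝ → M) : Prop :=
  IsGeodesicOn (E := E) γ univ ∧
    (∀ t : ℝ, ‖mfderiv 𝓘(ℝ, ℝ) 𝓘(ℝ, E) γ t (1 : ℝ)‖ = 1) ∧
    ∀ K : Set M, IsCompact K → ∃ t₀ : ℝ, 0 < t₀ ∧ ∀ t : ℝ, t₀ ≤ |t| → γ t ∉ K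

/-- The X-ray transform. -/
def xrayTransform {M : Type*} (f : M → ℝ) (γ : ℝ → M) : ℝ := ∫ t : ℝ, f (γ t)

variable (E) in
/-- The diameter of a subset of `M` with respect to the Riemannian distance of `M`. -/
def riemannianDiam (S : Set M) : ℝ≥0∞ :=
  ⨆ (x ∈ S) (y ∈ S), Manifold.riemannianEDist 𝓘(ℝ, E) x y

variable (E M) in
/-- `M` has a support theorem, with `hat K` the compact set associated with the compact set `K`. -/
def HasSupportTheorem : Prop :=
  ∃ hat : Set M → Set M,
    (∀ K : Set M, IsCompact K → IsCompact (hat K) ∧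
      ∀ f : M → ℝ, Continuous f → HasCompactSupport f →
        (∀ γ : ℝ → M, IsEscapingGeodesic (E := E) γ → range γ ⊆ univ \ K →
          xrayTransform f γ = 0) →
        tsupport f ⊆ hat K) ∧
    (∀ K : ℕ → Set M, (∀ n, IsCompact (K n)) → (∀ n, K (n + 1) ⊆ K n) →
      Tendsto (fun n => riemannianDiam E (K n)) atTop (𝓝 0) →
      Tendsto (fun n => riemannianDiam E (hat (K n))) atTop (𝓝 0))

/-- The surface parametrized by `φ` is totally geodesic: every geodesic of the surface, for the
induced metric, is a geodesic of `M`. -/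
def IsTotallyGeodesicParam (φ : ℝ × ℝ → M) : Prop :=
  ∀ (c : ℝ → ℝ × ℝ) (a b : ℝ), a < b → ContDiffOn ℝ ∞ c (Ioo a b) →
    (∀ t ∈ Ioo a b, GeodesicEqAt (pullbackMetric (E := E) φ) c t) →
    IsGeodesicOn (E := E) (φ ∘ c) (Ioo a b)

variable (E) in
/-- `S` is a plane in `M` of constant curvature `κ`: a closed (embedded) totally geodesic
submanifold diffeomorphic to `ℝ²` (by `φ`), whose induced metric has constant curvature `κ`. -/
def IsPlaneOfCurvature (κ : ℝ) (S : Set M) : Prop :=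
  ∃ φ : ℝ × ℝ → M, range φ = S ∧
    ContMDiff 𝓘(ℝ, ℝ × ℝ) 𝓘(ℝ, E) ∞ φ ∧
    (∀ x, Function.Injective (mfderiv 𝓘(ℝ, ℝ × ℝ) 𝓘(ℝ, E) φ x)) ∧
    IsClosedEmbedding φ ∧
    IsTotallyGeodesicParam (E := E) φ ∧
    ∀ x, gaussCurvature (pullbackMetric (E := E) φ) x = κ

variable (E) in
/-- A plane in `M`: its induced metric has constant non-positive curvature. -/
def IsPlane (S : Set M) : Prop := ∃ κ : ℝ, κ ≤ 0 ∧ IsPlaneOfCurvature E κ S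

variable (E) in
/-- A plane cover of `M`: a collection of planes whose union is `M`. -/
def IsPlaneCover (P : Set (Set M)) : Prop := (∀ S ∈ P, IsPlane E S) ∧ ⋃₀ P = univ

variable (E) in
/-- A Euclidean plane cover of `M`: a plane cover all of whose planes are flat. -/
def IsEuclideanPlaneCover (P : Set (Set M)) : Prop :=
  IsPlaneCover E P ∧ ∀ S ∈ P, IsPlaneOfCurvature E 0 S

end Riemannian

/-! ### Lie groups -/

instance minSmoothness_real_three_leInfty : ENat.LEInfty (minSmoothness ℝ 3) :=
  ⟨by rw [minSmoothness_of_isRCLikeNormedField]; exact ENat.LEInfty.out⟩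

section LieGroups

variable {E : Type*} [NormedAddCommGroup E] [NormedSpace ℝ E]
  {G : Type*} [TopologicalSpace G] [ChartedSpace E G] [Group G]

variable (E G) in
/-- The Riemannian metric of the Lie group `G` is left invariant. -/
def IsLeftInvariantMetric [RiemannianBundle (fun p : G => TangentSpace 𝓘(ℝ, E) p)] : Prop :=
  ∀ (g h : G) (v w : TangentSpace 𝓘(ℝ, E) h),
    inner ℝ (mfderiv 𝓘(ℝ, E) 𝓘(ℝ, E) (g * ·) h v) (mfderiv 𝓘(ℝ, E) 𝓘(ℝ, E) (g * ·) h w)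
      = inner ℝ v w

/-- `g = Exp v`: the integral curve through `1` of the left invariant vector field given by `v`
is at `g` at time `1`. -/
def IsLieExp (v : GroupLieAlgebra 𝓘(ℝ, E) G) (g : G) : Prop :=
  ∃ γ : ℝ → G, γ 0 = 1 ∧
    IsMIntegralCurve (I := 𝓘(ℝ, E)) γ (mulInvariantVectorField v) ∧ γ 1 = g

/-- `Exp V` for a linear subspace `V` of the Lie algebra. -/
def lieExpImage (V : Submodule ℝ (GroupLieAlgebra 𝓘(ℝ, E) G)) : Set G :=
  {g | ∃ v ∈ V, IsLieExp v g}

variable (E G) in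
/-- The term `𝔤_i` of the upper central series `0 = 𝔤_0 ≤ 𝔤_1 ≤ ⋯` of the Lie algebra of `G`. -/
def upperCentral [CompleteSpace E] [LieGroup 𝓘(ℝ, E) ∞ G] (i : ℕ) :
    Submodule ℝ (GroupLieAlgebra 𝓘(ℝ, E) G) :=
  ((⊥ : LieSubmodule ℝ (GroupLieAlgebra 𝓘(ℝ, E) G) (GroupLieAlgebra 𝓘(ℝ, E) G)).ucs i).toSubmodule

variable (E G) in
/-- The translates of the subset `Exp(span{x, y})`, for some linearly independent commuting
elements `x, y` of the Lie algebra, form a Euclidean plane cover of `G`. -/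
def HasTranslatedEuclideanPlaneCover [CompleteSpace E] [LieGroup 𝓘(ℝ, E) ∞ G]
    [RiemannianBundle (fun p : G => TangentSpace 𝓘(ℝ, E) p)] : Prop :=
  ∃ x y : GroupLieAlgebra 𝓘(ℝ, E) G, LinearIndependent ℝ ![x, y] ∧ ⁅x, y⁆ = 0 ∧
    IsEuclideanPlaneCover E
      (range fun g : G => g • lieExpImage (Submodule.span ℝ {x, y}))

end LieGroups

end

/-!
The left translates of a commutative two-dimensional subgroup do all the work. Suppose that the Lie
algebra contains commuting orthonormal vectors `a`, `b` such that every `v` in their span is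
orthogonal to `[v, E]` (`IsFlatPair`). By the Koszul formula (`geodesicEqAt_of_leftTriv`) the
one-parameter groups of these vectors are geodesics, and so are their left translates. Hence
`(s, t) ↦ g * exp (s a) * exp (t b)` (`planeMap`) is an isometric, totally geodesic immersion of the
Euclidean plane for every `g`.

The immersion is a closed embedding because `G` has a logarithm. For unipotent `A = Ad g`, the
operator `A log A / (A - 1)` (`unipLogDeriv`) is the differential of the logarithm in the left
trivialization. It is a polynomial in `A - 1`, and that the `1`-form it defines is closed is an
algebraic identity (`integral_unipResolvent_bracket_eq_zero`), which avoids the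
Baker-Campbell-Hausdorff formula and the surjectivity of the exponential map. As `G` is simply
connected, the form has a primitive `G → E` (`exists_log`); on the plane it is affine and injective
(`log_planeMap`), so it yields a continuous left inverse of `planeMap`. In particular the lines in
the planes are escaping geodesics.

For the support theorem, let `r` be the largest length of a vector `v` of the plane with
`exp v ∈ K⁻¹ K`, and let the hull of a compact set `K` be `K * exp (disc of radius r)`
(`planeHull`). In the translate of the plane through a point `p` outside the hull, `K` is contained
in a disc of radius `r` which does not contain `p`; hence the support theorem of the Euclidean plane
(`plane_support_theorem`) gives `f p = 0`. That theorem follows by differentiating the integral over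
a line with respect to the slope, which shows that all moments of `f` on a line outside the disc
vanish. When `K` shrinks to a point, so does `K⁻¹ K` to the identity, and therefore the hull shrinks
as well.

Finally, flat pairs exist for reasons of dimension. The vectors of `𝔤_{j+1}` orthogonal to `𝔤_j` form
a space `P` with `[P, E] ⊆ 𝔤_j ⊆ P^⊥`, of dimension at least `dim 𝔤_{j+1} - dim 𝔤_j`. If this exceeds
`1 + dim 𝔤_j`, then for each nonzero `x ∈ P` the map `[x, ·] : P → 𝔤_j` has a kernel of dimension at
least two, which contains a vector independent of `x` (`exists_isFlatPair`). If
`dim 𝔤_i ≥ 2 ^ i` for some `i`, the inequality holds for some `j < i`, as otherwise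
`dim 𝔤_i ≤ 2 ^ i - 1` by induction.
-/

set_option linter.unusedSectionVars false

noncomputable section

/-! ### The support theorem in the Euclidean plane -/

/-- A function of compact support all of whose moments vanish is zero. -/
lemma eq_zero_of_forall_integral_pow_mul_eq_zero {f : ℝ → ℝ} (hf : Continuous f) {R : ℝ}
    (hR : 0 < R) (hsupp : ∀ x, R < |x| → f x = 0)
    (hmom : ∀ m : ℕ, ∫ x in (-R)..R, x ^ m * f x = 0) (x : ℝ) : f x = 0 := by
  have hpoly : ∀ p : Polynomial ℝ, ∫ x in (-R)..R, p.eval x * f x = 0 := by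
    intro p
    induction p using Polynomial.induction_on' with
    | add p q hp hq =>
      simp only [Polynomial.eval_add, add_mul]
      rw [intervalIntegral.integral_add, hp, hq, add_zero]
      · exact (p.continuous.mul hf).intervalIntegrable _ _
      · exact (q.continuous.mul hf).intervalIntegrable _ _
    | monomial n a =>
      simp only [Polynomial.eval_monomial, mul_assoc]
      rw [intervalIntegral.integral_const_mul, hmom, mul_zero]
  obtain ⟨C, hC⟩ : ∃ C, ∀ x ∈ Icc (-R) R, ‖f x‖ ≤ C :=
    isCompact_Icc.exists_bound_of_continuousOn hf.continuousOn
  have hC0 : 0 ≤ C := (norm_nonneg _).trans (hC 0 ⟨by linarith, hR.le⟩)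
  have hle : -R ≤ R := by linarith
  have hsq : ∫ x in (-R)..R, f x * f x = 0 := by
    by_contra hne
    set J := ∫ x in (-R)..R, f x * f x with hJ
    have hJ0 : 0 < |J| := abs_pos.2 hne
    obtain ⟨ε, hε, hεJ⟩ : ∃ ε > 0, ε * C * (2 * R) < |J| := by
      refine ⟨|J| / (2 * (C * (2 * R) + 1)), by positivity, ?_⟩
      have : 0 ≤ C * (2 * R) := by positivity
      rw [div_mul_eq_mul_div, div_mul_eq_mul_div, div_lt_iff₀ (by positivity)]
      nlinarith
    obtain ⟨p, hp⟩ := exists_polynomial_near_of_continuousOn (-R) R f hf.continuousOn ε hε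
    have h1 : J = ∫ x in (-R)..R, (f x - p.eval x) * f x := by
      simp only [sub_mul]
      rw [intervalIntegral.integral_sub, hpoly p, sub_zero]
      · exact (hf.mul hf).intervalIntegrable _ _
      · exact (p.continuous.mul hf).intervalIntegrable _ _
    have h2 : ‖∫ x in (-R)..R, (f x - p.eval x) * f x‖ ≤ ε * C * |R - -R| := by
      apply intervalIntegral.norm_integral_le_of_norm_le_const
      intro x hx
      rw [uIoc_of_le hle] at hx
      have hx' : x ∈ Icc (-R) R := ⟨hx.1.le, hx.2⟩
      rw [norm_mul]
      refine mul_le_mul ?_ (hC x hx') (norm_nonneg _) hε.le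
      rw [Real.norm_eq_abs, abs_sub_comm]
      exact (hp x hx').le
    rw [← h1, Real.norm_eq_abs, abs_of_pos (by linarith : (0 : ℝ) < R - -R)] at h2
    linarith [h2, show ε * C * (R - -R) = ε * C * (2 * R) by ring]
  have hz : ∀ y ∈ Icc (-R) R, f y = 0 := by
    intro y hy
    by_contra hne
    have := intervalIntegral.integral_pos (f := fun x => f x * f x) (by linarith : -R < R)
      (hf.mul hf).continuousOn (fun x _ => mul_self_nonneg _)
      ⟨y, hy, mul_self_pos.2 hne⟩
    linarith
  by_cases hx : R < |x|
  · exact hsupp x hx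
  · exact hz x (abs_le.1 (not_lt.1 hx))

/-- If the integrals of `f` over the graphs of all affine functions of slope less than `a₀` and
intercept larger than `b₀` vanish, then so do those of `x f(x, y)`. The integral of `f` over the
half plane above such a graph vanishes, and its derivative with respect to the slope is the
integral of `-x f(x, y)` over the graph. -/
lemma integral_graph_mul_eq_zero {f : ℝ → ℝ → ℝ} (hf : Continuous fun p : ℝ × ℝ => f p.1 p.2)
    {R : ℝ} (hR : 0 < R) (hsupp : ∀ x y, R < |x| ∨ R < |y| → f x y = 0) {a₀ b₀ : ℝ}
    (h0 : ∀ a s, |a| < a₀ → b₀ < s → ∫ x in (-R)..R, f x (a * x + s) = 0)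
    {a b : ℝ} (ha : |a| < a₀) (hb : b₀ < b) :
    ∫ x in (-R)..R, x * f x (a * x + b) = 0 := by
  set L : ℝ := R + a₀ * R + 1 with hL
  have ha0 : 0 < a₀ := (abs_nonneg a).trans_lt ha
  have hRL : R < L := by nlinarith
  let P : ℝ → ℝ → ℝ := fun x s => ∫ y in s..L, f x y
  have hfx : ∀ x, Continuous (f x) := fun x => hf.comp (by fun_prop : Continuous fun y => (x, y))
  have hP : Continuous fun p : ℝ × ℝ => P p.1 p.2 := by
    have : Continuous fun p : ℝ × ℝ => ∫ y in L..p.2, f p.1 y :=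
      intervalIntegral.continuous_parametric_intervalIntegral_of_continuous
        (f := fun p : ℝ × ℝ => f p.1) (by
          exact hf.comp (by fun_prop : Continuous fun q : (ℝ × ℝ) × ℝ => (q.1.1, q.2)))
        continuous_snd
    refine this.neg.congr fun p => ?_
    simp only [P]
    rw [intervalIntegral.integral_symm]
    simp
  have hPd : ∀ x s, HasDerivAt (P x) (-f x s) s := fun x s =>
    intervalIntegral.integral_hasDerivAt_left ((hfx x).intervalIntegrable _ _)
      ((hfx x).stronglyMeasurableAtFilter _ _) (hfx x).continuousAt
  -- the half plane integrals vanish, by integrating over parallel lines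
  have hH : ∀ c, |c| < a₀ → ∫ x in (-R)..R, P x (c * x + b) = 0 := by
    intro c hc
    have h1 : ∀ x ∈ uIcc (-R) R, P x (c * x + b) = ∫ s in b..L, f x (c * x + s) := by
      intro x hx
      rw [uIcc_of_le (by linarith)] at hx
      have hcx : |c * x| ≤ a₀ * R := by
        rw [abs_mul]
        exact mul_le_mul hc.le (abs_le.2 hx) (abs_nonneg _) ha0.le
      have hcx' := abs_le.1 hcx
      rw [intervalIntegral.integral_comp_add_left (fun y => f x y)]
      have h2 : ∫ y in L..(c * x + L), f x y = 0 := by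
        rw [intervalIntegral.integral_congr (g := fun _ => 0)]
        · simp
        · intro y hy
          refine hsupp x y (Or.inr ?_)
          have : R < y := by
            rcases le_total L (c * x + L) with h | h
            · rw [uIcc_of_le h] at hy; linarith [hy.1]
            · rw [uIcc_of_ge h] at hy; linarith [hy.1]
          exact this.trans_le (le_abs_self y)
      have h3 := intervalIntegral.integral_add_adjacent_intervals
        (μ := MeasureTheory.volume) (((hfx x).intervalIntegrable (c * x + b) L))
        ((hfx x).intervalIntegrable L (c * x + L))
      rw [h2, add_zero] at h3
      exact h3
    rw [intervalIntegral.integral_congr h1]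
    have hcont : Continuous fun p : ℝ × ℝ => f p.1 (c * p.1 + p.2) :=
      hf.comp (by fun_prop : Continuous fun p : ℝ × ℝ => (p.1, c * p.1 + p.2))
    rw [MeasureTheory.intervalIntegral_intervalIntegral_swap
      (F := fun x s => f x (c * x + s)) ((hcont.continuousOn.integrableOn_compact
        (isCompact_uIcc.prod isCompact_uIcc)).mono_set
        (Set.prod_mono uIoc_subset_uIcc uIoc_subset_uIcc))]
    by_cases hbL : b ≤ L
    · rw [intervalIntegral.integral_congr (g := fun _ => 0)]
      · simp
      · intro s hs
        rw [uIcc_of_le hbL] at hs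
        exact h0 c s hc (hb.trans_le hs.1)
    · rw [intervalIntegral.integral_congr (g := fun _ => 0)]
      · simp
      · intro s hs
        rw [uIcc_of_ge (not_le.1 hbL).le] at hs
        show ∫ x in (-R)..R, f x (c * x + s) = 0
        rw [intervalIntegral.integral_congr (g := fun _ => 0)]
        · simp
        · intro x hx
          rw [uIcc_of_le (by linarith)] at hx
          have hcx : |c * x| ≤ a₀ * R := by
            rw [abs_mul]
            exact mul_le_mul hc.le (abs_le.2 hx) (abs_nonneg _) ha0.le
          have hcx' := abs_le.1 hcx
          refine hsupp x _ (Or.inr ?_)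
          exact (by linarith [hs.1] : R < c * x + s).trans_le (le_abs_self _)
  have hder : HasDerivAt (fun c => ∫ x in (-R)..R, P x (c * x + b))
      (∫ x in (-R)..R, -(x * f x (a * x + b))) a := by
    have hF'c : Continuous fun p : ℝ × ℝ => -(p.2 * f p.2 (p.1 * p.2 + b)) :=
      (continuous_snd.mul
        (hf.comp (by fun_prop : Continuous fun p : ℝ × ℝ => (p.2, p.1 * p.2 + b)))).neg
    obtain ⟨C, hC⟩ : ∃ C, ∀ p ∈ Icc (a - 1) (a + 1) ×ˢ Icc (-R) R,
        ‖-(p.2 * f p.2 (p.1 * p.2 + b))‖ ≤ C :=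
      (isCompact_Icc.prod isCompact_Icc).exists_bound_of_continuousOn hF'c.continuousOn
    have hPc : ∀ c : ℝ, Continuous fun x : ℝ => P x (c * x + b) := fun c =>
      hP.comp (by fun_prop : Continuous fun x : ℝ => (x, c * x + b))
    refine (intervalIntegral.hasDerivAt_integral_of_dominated_loc_of_deriv_le
      (F := fun c x => P x (c * x + b)) (F' := fun c x => -(x * f x (c * x + b)))
      (bound := fun _ => C) (s := Icc (a - 1) (a + 1)) (Icc_mem_nhds (by linarith) (by linarith))
      (Eventually.of_forall fun c => (hPc c).aestronglyMeasurable)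
      ((hPc a).intervalIntegrable _ _)
      (hF'c.comp (by fun_prop : Continuous fun x : ℝ => (a, x))).aestronglyMeasurable
      ?_ intervalIntegrable_const ?_).2
    · refine Eventually.of_forall fun x hx c hc => ?_
      rw [uIoc_of_le (by linarith)] at hx
      exact hC (c, x) ⟨hc, ⟨hx.1.le, hx.2⟩⟩
    · refine Eventually.of_forall fun x hx c hc => ?_
      have h1 : HasDerivAt (fun c : ℝ => c * x + b) x c := by
        simpa using ((hasDerivAt_id c).mul_const x).add_const b
      have := (hPd x (c * x + b)).comp c h1
      rwa [neg_mul, mul_comm] at this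
  have hzero : HasDerivAt (fun c => ∫ x in (-R)..R, P x (c * x + b)) 0 a := by
    refine (hasDerivAt_const a (0 : ℝ)).congr_of_eventuallyEq ?_
    have : ∀ᶠ c in 𝓝 a, |c| < a₀ := (continuous_abs.tendsto a).eventually (gt_mem_nhds ha)
    filter_upwards [this] with c hc using hH c hc
  have := hder.unique hzero
  rwa [intervalIntegral.integral_neg, neg_eq_zero] at this

/-- If the integrals of `f` over the graphs of all affine functions of small slope and large
intercept vanish, then `f` vanishes on the horizontal lines among them: iterating the previous lemma,
all moments of `f` on such a line are zero. -/
lemma eq_zero_of_integral_graph_eq_zero {f : ℝ → ℝ → ℝ}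
    (hf : Continuous fun p : ℝ × ℝ => f p.1 p.2)
    {R : ℝ} (hR : 0 < R) (hsupp : ∀ x y, R < |x| ∨ R < |y| → f x y = 0) {a₀ b₀ : ℝ}
    (ha₀ : 0 < a₀)
    (h0 : ∀ a s, |a| < a₀ → b₀ < s → ∫ x in (-R)..R, f x (a * x + s) = 0)
    {b : ℝ} (hb : b₀ < b) (x : ℝ) : f x b = 0 := by
  have key : ∀ m : ℕ, ∀ a s, |a| < a₀ → b₀ < s →
      ∫ x in (-R)..R, x ^ m * f x (a * x + s) = 0 := by
    intro m
    induction m with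
    | zero => simpa using h0
    | succ m ih =>
      intro a s ha hs
      have := integral_graph_mul_eq_zero (f := fun x y => x ^ m * f x y)
        ((continuous_fst.pow m).mul hf) hR (fun x y h => by simp [hsupp x y h]) ih ha hs
      simpa only [pow_succ', mul_assoc] using this
  refine eq_zero_of_forall_integral_pow_mul_eq_zero (f := fun x => f x b)
    (hf.comp (by fun_prop : Continuous fun x : ℝ => (x, b))) hR
    (fun x hx => hsupp x b (Or.inl hx)) (fun m => ?_) x
  simpa using key m 0 b (by simpa using ha₀) hb

/-- Bounds for the coordinates `x`, `y` of a bounded point in the orthonormal frame `(-q, p)`, `(p, q)`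
with origin `u`. -/
lemma abs_le_of_norm_rotate_le {p q x y B : ℝ} {u : ℝ × ℝ} (hpq : p ^ 2 + q ^ 2 = 1)
    (h : ‖(u.1 + y * p - x * q, u.2 + y * q + x * p)‖ ≤ B) :
    |x| ≤ 2 * (B + |u.1| + |u.2|) + 1 ∧ |y| ≤ 2 * (B + |u.1| + |u.2|) + 1 := by
  have hB := (norm_nonneg _).trans h
  rw [Prod.norm_def, max_le_iff, Real.norm_eq_abs, Real.norm_eq_abs] at h
  obtain ⟨h2, h3⟩ := h
  have e1 : |y * p - x * q| ≤ B + |u.1| := by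
    calc |y * p - x * q| = |(u.1 + y * p - x * q) - u.1| := by ring_nf
      _ ≤ |u.1 + y * p - x * q| + |u.1| := abs_sub _ _
      _ ≤ _ := by gcongr
  have e2 : |y * q + x * p| ≤ B + |u.2| := by
    calc |y * q + x * p| = |(u.2 + y * q + x * p) - u.2| := by ring_nf
      _ ≤ |u.2 + y * q + x * p| + |u.2| := abs_sub _ _
      _ ≤ _ := by gcongr
  have hp : |p| ≤ 1 := abs_le_one_iff_mul_self_le_one.2 (by nlinarith [sq_nonneg q])
  have hq : |q| ≤ 1 := abs_le_one_iff_mul_self_le_one.2 (by nlinarith [sq_nonneg p])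
  have b1 := abs_nonneg u.1
  have b2 := abs_nonneg u.2
  have hle : ∀ c d : ℝ, |c| ≤ 1 → |d| ≤ 1 →
      |d * (y * p - x * q) + c * (y * q + x * p)| ≤ 2 * (B + |u.1| + |u.2|) + 1 := by
    intro c d hc hd
    calc |d * (y * p - x * q) + c * (y * q + x * p)|
        ≤ |d * (y * p - x * q)| + |c * (y * q + x * p)| := abs_add_le _ _
      _ = |d| * |y * p - x * q| + |c| * |y * q + x * p| := by rw [abs_mul, abs_mul]
      _ ≤ 1 * (B + |u.1|) + 1 * (B + |u.2|) := by gcongr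
      _ ≤ _ := by linarith
  constructor
  · have := hle p (-q) hp (by rwa [abs_neg])
    rwa [show -q * (y * p - x * q) + p * (y * q + x * p) = x by linear_combination x * hpq] at this
  · have := hle q p hq hp
    rwa [show p * (y * p - x * q) + q * (y * q + x * p) = y by linear_combination y * hpq] at this

/-- The support theorem in the Euclidean plane: if the integrals of `h` over all lines which do
not meet the disk with centre `u₀` and radius `r` vanish, then `h` vanishes outside that disk. -/
theorem plane_support_theorem {h : ℝ × ℝ → ℝ} (hc : Continuous h) (hs : HasCompactSupport h)
    {u₀ : ℝ × ℝ} {r : ℝ} (hr : 0 ≤ r)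
    (H : ∀ u w : ℝ × ℝ, w.1 ^ 2 + w.2 ^ 2 = 1 →
      (∀ t : ℝ, r ^ 2 < (u.1 + t * w.1 - u₀.1) ^ 2 + (u.2 + t * w.2 - u₀.2) ^ 2) →
      ∫ t : ℝ, h (u + t • w) = 0)
    {u : ℝ × ℝ} (hu : r ^ 2 < (u.1 - u₀.1) ^ 2 + (u.2 - u₀.2) ^ 2) : h u = 0 := by
  set ρ : ℝ := Real.sqrt ((u.1 - u₀.1) ^ 2 + (u.2 - u₀.2) ^ 2) with hρ
  have hρ2 : ρ ^ 2 = (u.1 - u₀.1) ^ 2 + (u.2 - u₀.2) ^ 2 := Real.sq_sqrt (by positivity)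
  have hrρ : r < ρ := by
    apply lt_of_pow_lt_pow_left₀ 2 (Real.sqrt_nonneg _)
    rw [← hρ, hρ2]; exact hu
  have hρ0 : 0 < ρ := hr.trans_lt hrρ
  obtain ⟨p, hp⟩ : ∃ p, p * ρ = u.1 - u₀.1 := ⟨(u.1 - u₀.1) / ρ, div_mul_cancel₀ _ hρ0.ne'⟩
  obtain ⟨q, hq⟩ : ∃ q, q * ρ = u.2 - u₀.2 := ⟨(u.2 - u₀.2) / ρ, div_mul_cancel₀ _ hρ0.ne'⟩
  have hpq : p ^ 2 + q ^ 2 = 1 := by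
    rw [← hp, ← hq] at hρ2
    have : ρ ^ 2 * (p ^ 2 + q ^ 2 - 1) = 0 := by linear_combination -hρ2
    rcases mul_eq_zero.1 this with h | h
    · exact absurd h (by positivity)
    · linarith
  -- coordinates in which the direction from `u₀` to `u` is vertical
  let f : ℝ → ℝ → ℝ := fun x y => h (u₀.1 + y * p - x * q, u₀.2 + y * q + x * p)
  have hf : Continuous fun z : ℝ × ℝ => f z.1 z.2 := hc.comp (by fun_prop)
  obtain ⟨B, hB⟩ := hs.isCompact.isBounded.exists_norm_le
  have hBs : ∀ v : ℝ × ℝ, B < ‖v‖ → h v = 0 := fun v hv => by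
    by_contra hne
    exact absurd (hB v (subset_tsupport _ hne)) (not_le.2 hv)
  set R : ℝ := 2 * (|B| + |u₀.1| + |u₀.2|) + 1 with hRdef
  have hR : 0 < R := by positivity
  have hsupp : ∀ x y, R < |x| ∨ R < |y| → f x y = 0 := by
    intro x y hxy
    by_contra hne
    have h1 : ‖(u₀.1 + y * p - x * q, u₀.2 + y * q + x * p)‖ ≤ B := by
      by_contra hlt
      exact hne (hBs _ (not_le.1 hlt))
    have h2 := abs_le_of_norm_rotate_le hpq (h1.trans (le_abs_self B))
    rcases hxy with hx | hy
    · exact absurd h2.1 (not_le.2 hx)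
    · exact absurd h2.2 (not_le.2 hy)
  obtain ⟨b₀, hb1, hb2⟩ := exists_between hrρ
  have hb0 : 0 < b₀ := hr.trans_lt hb1
  obtain ⟨a₀, ha0, ha1⟩ : ∃ a₀ > 0, r ^ 2 * (1 + a₀ ^ 2) < b₀ ^ 2 := by
    have hcont : ContinuousAt (fun a : ℝ => r ^ 2 * (1 + a ^ 2)) 0 := by fun_prop
    have hlt : r ^ 2 * (1 + (0 : ℝ) ^ 2) < b₀ ^ 2 := by nlinarith
    have hev := hcont.eventually (gt_mem_nhds hlt)
    obtain ⟨ε, hε, hball⟩ := Metric.eventually_nhds_iff.1 hev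
    exact ⟨ε / 2, by positivity, hball (by simp [abs_of_pos hε, hε])⟩
  have hlines : ∀ a s, |a| < a₀ → b₀ < s → ∫ x in (-R)..R, f x (a * x + s) = 0 := by
    intro a s ha hs
    set c : ℝ := Real.sqrt (1 + a ^ 2) with hcdef
    have hc2 : c ^ 2 = 1 + a ^ 2 := Real.sq_sqrt (by positivity)
    have hc0 : 0 < c := Real.sqrt_pos.2 (by positivity)
    have hsa : r ^ 2 * (1 + a ^ 2) < s ^ 2 := by
      have h1 : a ^ 2 < a₀ ^ 2 := by rw [← sq_abs]; gcongr
      have h2 : b₀ ^ 2 < s ^ 2 := by gcongr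
      nlinarith [sq_nonneg r]
    have hfull : ∫ x in (-R)..R, f x (a * x + s) = ∫ x : ℝ, f x (a * x + s) := by
      apply intervalIntegral.integral_eq_integral_of_support_subset
      intro x hx
      by_contra hnot
      apply hx
      rw [mem_Ioc, not_and_or, not_lt, not_le] at hnot
      rcases hnot with h1 | h1
      · rcases h1.lt_or_eq with h2 | h2
        · exact hsupp _ _ (Or.inl (by rw [abs_of_neg (by linarith)]; linarith))
        · -- by continuity, `f` vanishes on the boundary as well
          have hcl : IsClosed {z | f z (a * z + s) = 0} :=
            isClosed_eq (hf.comp (by fun_prop : Continuous fun z : ℝ => (z, a * z + s)))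
              continuous_const
          have hmem : x ∈ closure (Iio (-R)) := by rw [closure_Iio, h2]; exact self_mem_Iic
          refine hcl.closure_subset_iff.2 (fun z hz => ?_) hmem
          refine hsupp _ _ (Or.inl ?_)
          have hz' : z < -R := hz
          rw [abs_of_neg (by linarith)]; linarith
      · exact hsupp _ _ (Or.inl (h1.trans_le (le_abs_self x)))
    rw [hfull]
    have := H (u₀.1 + s * p, u₀.2 + s * q) ((a * p - q) / c, (a * q + p) / c)
      (by
        simp only [div_pow]
        rw [← add_div, div_eq_one_iff_eq (by positivity), hc2]
        linear_combination (1 + a ^ 2) * hpq)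
      (fun t => by
        have e : (u₀.1 + s * p + t * ((a * p - q) / c) - u₀.1) ^ 2
            + (u₀.2 + s * q + t * ((a * q + p) / c) - u₀.2) ^ 2
            = (s + t / c * a) ^ 2 + (t / c) ^ 2 := by
          have : ∀ z : ℝ, t * (z / c) = t / c * z := fun z => by ring
          rw [this, this]
          linear_combination ((s + t / c * a) ^ 2 + (t / c) ^ 2) * hpq
        simp only at e ⊢
        rw [e]
        by_contra hcon
        rw [not_lt] at hcon
        have e1 : (1 + a ^ 2) * ((s + t / c * a) ^ 2 + (t / c) ^ 2)
            = s ^ 2 + (a * s + (1 + a ^ 2) * (t / c)) ^ 2 := by ring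
        have e2 := mul_le_mul_of_nonneg_left hcon (by positivity : 0 ≤ 1 + a ^ 2)
        linarith [sq_nonneg (a * s + (1 + a ^ 2) * (t / c))])
    have hsub := MeasureTheory.Measure.integral_comp_mul_left
      (fun x => f x (a * x + s)) c⁻¹
    have hcongr : (fun t : ℝ => h ((u₀.1 + s * p, u₀.2 + s * q)
        + t • ((a * p - q) / c, (a * q + p) / c)))
        = fun t : ℝ => f (c⁻¹ * t) (a * (c⁻¹ * t) + s) := by
      funext t
      simp only [f]
      congr 1
      ext
      · simp; ring
      · simp; ring
    rw [hcongr, hsub, inv_inv, smul_eq_mul] at this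
    rcases mul_eq_zero.1 this with h1 | h1
    · exact absurd h1 (abs_pos.2 hc0.ne').ne'
    · exact h1
  have := eq_zero_of_integral_graph_eq_zero hf hR hsupp ha0 hlines hb2 0
  simp only [f] at this
  rw [show u = (u₀.1 + ρ * p - 0 * q, u₀.2 + ρ * q + 0 * p) by
    ext
    · simp; linarith
    · simp; linarith]
  exact this

/-! ### The logarithm of a unipotent automorphism -/

section UnipotentLog

lemma integral_neg_pow (n : ℕ) : ∫ s in (0 : ℝ)..1, (-s) ^ n = (-1) ^ n / (n + 1) := by
  rw [intervalIntegral.integral_congr (g := fun s => (-1) ^ n * s ^ n) (fun s _ => neg_pow s n),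
    intervalIntegral.integral_const_mul, integral_pow]
  simp [div_eq_mul_inv]

variable {E : Type*} [NormedAddCommGroup E] [NormedSpace ℝ E]

/-- The operator `(1 + s (A - 1))⁻¹`, as a truncated geometric series; this is the inverse as soon
as `(A - 1) ^ m = 0`. -/
def unipResolvent (m : ℕ) (A : E →L[ℝ] E) (s : ℝ) : E →L[ℝ] E :=
  ∑ n ∈ Finset.range m, (-s) ^ n • (A - 1) ^ n

/-- The operator `A log A / (A - 1)`, as a truncated power series in `A - 1`. If `A = exp (ad u)`
with nilpotent `ad u`, it is `ad u / (1 - exp (- ad u))`, the differential of the logarithm of a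
Lie group in a left invariant frame. -/
def unipLogDeriv (m : ℕ) (A : E →L[ℝ] E) : E →L[ℝ] E :=
  ∑ n ∈ Finset.range m, ((-1) ^ n / (n + 1) : ℝ) • (A * (A - 1) ^ n)

lemma unipResolvent_mul (m : ℕ) {A : E →L[ℝ] E} (hA : (A - 1) ^ m = 0) (s : ℝ) :
    unipResolvent m A s * (1 + s • (A - 1)) = 1 := by
  have h := geom_sum_mul_neg ((-s) • (A - 1)) m
  have h2 : unipResolvent m A s = ∑ i ∈ Finset.range m, ((-s) • (A - 1)) ^ i := by
    simp only [unipResolvent, smul_pow]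
  rw [h2, show (1 : E →L[ℝ] E) + s • (A - 1) = 1 - (-s) • (A - 1) by rw [neg_smul, sub_neg_eq_add],
    h, smul_pow, hA, smul_zero, sub_zero]

lemma mul_unipResolvent (m : ℕ) {A : E →L[ℝ] E} (hA : (A - 1) ^ m = 0) (s : ℝ) :
    (1 + s • (A - 1)) * unipResolvent m A s = 1 := by
  have h := mul_neg_geom_sum ((-s) • (A - 1)) m
  have h2 : unipResolvent m A s = ∑ i ∈ Finset.range m, ((-s) • (A - 1)) ^ i := by
    simp only [unipResolvent, smul_pow]
  rw [h2, show (1 : E →L[ℝ] E) + s • (A - 1) = 1 - (-s) • (A - 1) by rw [neg_smul, sub_neg_eq_add],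
    h, smul_pow, hA, smul_zero, sub_zero]

lemma commute_unipResolvent (m : ℕ) (A : E →L[ℝ] E) (s : ℝ) :
    Commute (A - 1) (unipResolvent m A s) := by
  unfold unipResolvent
  refine Commute.sum_right _ _ _ fun n _ => ?_
  exact ((Commute.refl _).pow_right n).smul_right _

lemma continuous_unipResolvent (m : ℕ) (A : E →L[ℝ] E) : Continuous (unipResolvent m A) := by
  unfold unipResolvent
  fun_prop

lemma hasDerivAt_unipResolvent (m : ℕ) {A : E →L[ℝ] E} (hA : (A - 1) ^ m = 0) (s : ℝ) :
    HasDerivAt (unipResolvent m A)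
      (-((A - 1) * unipResolvent m A s * unipResolvent m A s)) s := by
  have hd : DifferentiableAt ℝ (unipResolvent m A) s := by
    unfold unipResolvent
    fun_prop
  have h1 : HasDerivAt (fun s : ℝ => (1 : E →L[ℝ] E) + s • (A - 1)) (A - 1) s := by
    simpa using ((hasDerivAt_id s).smul_const (A - 1)).const_add (1 : E →L[ℝ] E)
  have h2 := hd.hasDerivAt.mul h1
  have h3 : deriv (unipResolvent m A) s * (1 + s • (A - 1)) + unipResolvent m A s * (A - 1) = 0 := by
    refine h2.unique ((hasDerivAt_const s (1 : E →L[ℝ] E)).congr_of_eventuallyEq ?_)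
    exact Eventually.of_forall fun t => unipResolvent_mul m hA t
  have h4 : deriv (unipResolvent m A) s
      = -((A - 1) * unipResolvent m A s * unipResolvent m A s) := by
    have h5 := congrArg (· * unipResolvent m A s) h3
    simp only [add_mul, zero_mul, mul_assoc, mul_unipResolvent m hA, mul_one] at h5
    rw [eq_neg_of_add_eq_zero_left h5, ← mul_assoc, ← (commute_unipResolvent m A s).eq]
  rw [← h4]
  exact hd.hasDerivAt

/-- The identity of unipotent automorphisms `A` of an algebra with product `B` which expresses that
the form defined by `unipLogDeriv` is closed. With `B` written as a bracket, the integrand is the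
derivative of
`∑ k, (-1) ^ k / (k + 1) * (s (1 - s)) ^ (k + 1) * A [Tᵏ M a, Tᵏ M b]`, where
`M = (1 + s (A - 1))⁻¹` and `T = (A - 1) M`, which vanishes for `s = 0` and for `s = 1`. -/
theorem integral_unipResolvent_bracket_eq_zero [CompleteSpace E] (B : E →L[ℝ] E →L[ℝ] E)
    {A : E →L[ℝ] E} (hAB : ∀ a b, A (B a b) = B (A a) (A b)) {m : ℕ} (hA : (A - 1) ^ m = 0)
    (a b : E) :
    ∫ s in (0 : ℝ)..1, ((1 - s) • unipResolvent m A s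
        (B (A a) (A (unipResolvent m A s b)) + B (A (unipResolvent m A s a)) (A b))
      - A (unipResolvent m A s (B a b))) = 0 := by
  set N : E →L[ℝ] E := A - 1 with hN
  set M : ℝ → E →L[ℝ] E := unipResolvent m A with hM
  have hNa : ∀ x, A x = x + N x := fun x => by simp [hN]
  have hMl : ∀ s x, M s x + s • M s (N x) = x := fun s x => by
    have := DFunLike.congr_fun (unipResolvent_mul m hA s) x
    rwa [mul_add, mul_one, mul_smul_comm] at this
  have hMr : ∀ s x, M s x + s • N (M s x) = x := fun s x => by
    have := DFunLike.congr_fun (mul_unipResolvent m hA s) x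
    rwa [add_mul, one_mul, smul_mul_assoc] at this
  have hMd : ∀ s, HasDerivAt M (-(N * M s * M s)) s := hasDerivAt_unipResolvent m hA
  have hNM : ∀ s, Commute N (M s) := commute_unipResolvent m A
  let T : ℝ → E →L[ℝ] E := fun s => N * M s
  have hTM : ∀ s, Commute (T s) (M s) := fun s => (hNM s).mul_left (Commute.refl _)
  have hTm : ∀ s, (T s) ^ m = 0 := fun s => by
    simp only [T]
    rw [(hNM s).mul_pow, hA, zero_mul]
  -- the derivative of `Tᵏ M`
  have hPd : ∀ (k : ℕ) s, HasDerivAt (fun s => (T s) ^ k * M s)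
      (-((k + 1 : ℝ) • ((T s) ^ (k + 1) * M s))) s := by
    intro k s
    have hTd : HasDerivAt T (-(T s * T s)) s := by
      have := (hMd s).const_mul N
      refine this.congr_deriv ?_
      show N * -(N * M s * M s) = -(N * M s * (N * M s))
      rw [mul_neg, neg_inj, mul_assoc N (M s), mul_assoc N (M s), ← mul_assoc (M s) N,
        ← (hNM s).eq, mul_assoc N (M s)]
    induction k with
    | zero =>
      simp only [pow_zero, one_mul, zero_add, pow_one, Nat.cast_zero, one_smul]
      exact hMd s
    | succ k ih =>
      have := hTd.mul ih
      have e : (fun s => T s ^ (k + 1) * M s) = fun s => T s * (T s ^ k * M s) := by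
        funext s
        rw [pow_succ', mul_assoc]
      rw [e]
      refine this.congr_deriv ?_
      rw [neg_mul, mul_neg, ← neg_add, neg_inj, mul_smul_comm, mul_assoc, ← mul_assoc (T s) (T s ^ k),
        ← pow_succ', ← mul_assoc, ← pow_succ', Nat.cast_add, Nat.cast_one]
      module
  let u : ℕ → ℝ → E → E := fun k s x => ((T s) ^ k * M s) x
  have hud : ∀ (k : ℕ) s x, HasDerivAt (fun s => u k s x) (-((k + 1 : ℝ) • u (k + 1) s x)) s := by
    intro k s x
    have := (hPd k s).clm_apply (hasDerivAt_const s x)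
    simpa [u] using this
  let H : ℝ → E := fun s => ∑ k ∈ Finset.range m,
    ((-1) ^ k / (k + 1) * (s * (1 - s)) ^ (k + 1) : ℝ) • A (B (u k s a) (u k s b))
  let q : ℕ → ℝ → E := fun k s => (1 - 2 * s) • B (u k s a) (u k s b)
    - (s * (1 - s)) • (B (u (k + 1) s a) (u k s b) + B (u k s a) (u (k + 1) s b))
  have hHd : ∀ s, HasDerivAt H
      (∑ k ∈ Finset.range m, (-(s * (1 - s))) ^ k • A (q k s)) s := by
    intro s
    apply HasDerivAt.fun_sum
    intro k _
    have hw : HasDerivAt (fun s : ℝ => (s * (1 - s)) ^ (k + 1))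
        ((k + 1) * (s * (1 - s)) ^ k * (1 - 2 * s)) s := by
      have h1 : HasDerivAt (fun s : ℝ => s * (1 - s)) (1 - 2 * s) s := by
        have := (hasDerivAt_id s).mul ((hasDerivAt_id s).const_sub 1)
        refine this.congr_deriv ?_
        simp only [id]; ring
      refine (h1.pow (k + 1)).congr_deriv ?_
      simp
    have hB : HasDerivAt (fun s => B (u k s a) (u k s b))
        (-((k + 1 : ℝ) • (B (u (k + 1) s a) (u k s b) + B (u k s a) (u (k + 1) s b)))) s := by
      have := (B.hasFDerivAt.comp_hasDerivAt s (hud k s a)).clm_apply (hud k s b)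
      refine this.congr_deriv ?_
      simp only [map_neg, map_smul, neg_apply, smul_apply, smul_add, neg_add, Function.comp]
    have hAB' := A.hasFDerivAt.comp_hasDerivAt s hB
    have := (hw.const_mul ((-1) ^ k / (k + 1) : ℝ)).smul hAB'
    refine this.congr_deriv ?_
    simp only [q, map_sub, map_smul, map_neg, smul_sub, smul_neg, smul_smul, Function.comp]
    rw [sub_eq_neg_add _ (((-(s * (1 - s))) ^ k * (s * (1 - s))) • _)]
    have hk : (k + 1 : ℝ) ≠ 0 := by positivity
    rw [neg_pow (s * (1 - s))]
    generalize s * (1 - s) = w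
    congr 1
    · rw [neg_inj]
      congr 1
      field_simp
      rw [pow_succ]
    · congr 1
      field_simp
  -- the derivative of `H` is the integrand; this is checked after applying `1 + s N`, when the sum
  -- telescopes
  have key : ∀ s, ∑ k ∈ Finset.range m, (-(s * (1 - s))) ^ k • A (q k s)
      = (1 - s) • M s (B (A a) (A (M s b)) + B (A (M s a)) (A b)) - A (M s (B a b)) := by
    intro s
    let q' : ℕ → E := fun k => (1 - 2 * s) • B ((T s ^ k) a) ((T s ^ k) b)
      - (s * (1 - s)) • (B ((T s ^ (k + 1)) a) ((T s ^ k) b) + B ((T s ^ k) a) ((T s ^ (k + 1)) b))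
    have hAM : ∀ x, A (M s x) = M s (A x) := fun x => by
      rw [hNa, hNa, map_add]
      congr 1
      exact DFunLike.congr_fun (hNM s).eq x
    have hBM : ∀ x y, B (M s x) (M s y) + s • N (B (M s x) (M s y))
        = B x y + (s * (1 - s)) • B (T s x) (T s y) := by
      intro x y
      have hN1 : ∀ x y, N (B x y) = B (N x) y + B x (N y) + B (N x) (N y) := by
        intro x y
        have h1 := hAB x y
        rw [hNa, hNa x, hNa y, map_add, map_add, add_apply, add_apply] at h1
        linear_combination (norm := module) h1
      have hx := hMr s x
      have hy := hMr s y
      have hTx : ∀ x, T s x = N (M s x) := fun _ => rfl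
      rw [hN1, hTx, hTx]
      nth_rewrite 5 [← hx]
      nth_rewrite 5 [← hy]
      simp only [map_add, add_apply, map_smul, smul_apply]
      module
    have huT : ∀ k x, u k s x = M s ((T s ^ k) x) := fun k x => by
      simp only [u, mul_apply_eq_comp]
      exact DFunLike.congr_fun ((hTM s).pow_left k).eq x
    have hq : ∀ k, q k s + s • N (q k s) = q' k + (s * (1 - s)) • q' (k + 1) := by
      intro k
      simp only [q, q', huT, map_sub, map_add, map_smul]
      have e : ∀ (j : ℕ) x, (T s ^ (j + 1)) x = T s ((T s ^ j) x) := fun j x => by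
        rw [pow_succ']; rfl
      have h1 := hBM ((T s ^ k) a) ((T s ^ k) b)
      have h2 := hBM ((T s ^ (k + 1)) a) ((T s ^ k) b)
      have h3 := hBM ((T s ^ k) a) ((T s ^ (k + 1)) b)
      rw [← e, ← e] at h1 h2 h3
      have h1' := eq_sub_of_add_eq' h1
      have h2' := eq_sub_of_add_eq' h2
      have h3' := eq_sub_of_add_eq' h3
      linear_combination (norm := module) (1 - 2 * s) • h1 - (s * (1 - s)) • (h2 + h3)
    have hsum : ∑ k ∈ Finset.range m, (-(s * (1 - s))) ^ k • (q k s + s • N (q k s)) = q' 0 := by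
      have e1 : ∀ k ∈ Finset.range m, (-(s * (1 - s))) ^ k • (q k s + s • N (q k s))
          = (-(s * (1 - s))) ^ k • q' k - (-(s * (1 - s))) ^ (k + 1) • q' (k + 1) := by
        intro k _
        rw [hq, pow_succ]
        module
      rw [Finset.sum_congr rfl e1, Finset.sum_range_sub' (fun k => (-(s * (1 - s))) ^ k • q' k)]
      have e2 : q' m = 0 := by
        simp only [q', pow_succ, hTm s]
        simp
      rw [e2]
      simp
    have hsum2 : ∑ k ∈ Finset.range m, (-(s * (1 - s))) ^ k • q k s = M s (q' 0) := by
      rw [← hsum, map_sum]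
      refine Finset.sum_congr rfl fun k _ => ?_
      rw [map_smul, map_add, map_smul, hMl]
    have hq0 : q' 0 = (1 - s) • (B a (M s b) + B (M s a) b) - B a b := by
      simp only [q', pow_zero, zero_add, pow_one, one_apply_eq_self]
      have hT : ∀ x, s • T s x = x - M s x := fun x => by
        rw [eq_sub_iff_add_eq']
        exact hMr s x
      have h1 : s • B (T s a) b = B a b - B (M s a) b := by
        rw [← smul_apply, ← map_smul, hT, map_sub,
          sub_apply]
      have h2 : s • B a (T s b) = B a b - B a (M s b) := by
        rw [← map_smul, hT, map_sub]
      linear_combination (norm := module) -(1 - s) • (h1 + h2)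
    calc ∑ k ∈ Finset.range m, (-(s * (1 - s))) ^ k • A (q k s)
        = A (∑ k ∈ Finset.range m, (-(s * (1 - s))) ^ k • q k s) := by
          rw [map_sum]
          exact Finset.sum_congr rfl fun k _ => (map_smul A _ _).symm
      _ = _ := by
        rw [hsum2, hq0, hAM, map_sub, map_sub, map_smul, map_smul, map_add, hAB, hAB, ← hAM (B a b)]
  have hcont : Continuous fun s : ℝ => (1 - s) • M s (B (A a) (A (M s b)) + B (A (M s a)) (A b))
      - A (M s (B a b)) := by
    have hMc : Continuous M := continuous_unipResolvent m A
    fun_prop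
  rw [intervalIntegral.integral_eq_sub_of_hasDerivAt (f := H)
    (fun s _ => by rw [← key s]; exact hHd s) (hcont.intervalIntegrable _ _)]
  simp [H]

/-- The derivative of `A log A / (A - 1)` along a curve of unipotent operators. -/
theorem hasDerivAt_unipLogDeriv [CompleteSpace E] {m : ℕ} {A : ℝ → E →L[ℝ] E} {Y : E →L[ℝ] E}
    {t : ℝ} (hAd : HasDerivAt A Y t) (hA : ∀ t, (A t - 1) ^ m = 0) :
    HasDerivAt (fun t => unipLogDeriv m (A t))
      (∫ s in (0 : ℝ)..1, (1 - s) • (unipResolvent m (A t) s * Y * unipResolvent m (A t) s)) t := by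
  let D : ℕ → E →L[ℝ] E := fun n => deriv (fun t => A t * (A t - 1) ^ n) t
  have hD : ∀ n, HasDerivAt (fun t => A t * (A t - 1) ^ n) (D n) t := fun n => by
    have h1 : DifferentiableAt ℝ A t := hAd.differentiableAt
    have : DifferentiableAt ℝ (fun t => A t * (A t - 1) ^ n) t := by fun_prop
    exact this.hasDerivAt
  have hs : ∀ s : ℝ, (1 - s) • (unipResolvent m (A t) s * Y * unipResolvent m (A t) s)
      = ∑ n ∈ Finset.range m, (-s) ^ n • D n := by
    intro s
    have h1 : HasDerivAt (fun t => A t * unipResolvent m (A t) s)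
        (∑ n ∈ Finset.range m, (-s) ^ n • D n) t := by
      have := HasDerivAt.fun_sum (u := Finset.range m) fun n _ => (hD n).const_smul ((-s) ^ n)
      refine this.congr_of_eventuallyEq (Eventually.of_forall fun t => ?_)
      simp only [unipResolvent, Finset.mul_sum, mul_smul_comm, Pi.smul_apply]
    have hRd : DifferentiableAt ℝ (fun t => unipResolvent m (A t) s) t := by
      have h1 : DifferentiableAt ℝ A t := hAd.differentiableAt
      unfold unipResolvent
      fun_prop
    set M := unipResolvent m (A t) s with hM
    set M' := deriv (fun t => unipResolvent m (A t) s) t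
    have h2 : M' * (1 + s • (A t - 1)) + M * (s • Y) = 0 := by
      have h3 : HasDerivAt (fun t => 1 + s • (A t - 1)) (s • Y) t :=
        ((hAd.sub_const 1).const_smul s).const_add 1
      refine (hRd.hasDerivAt.mul h3).unique
        ((hasDerivAt_const t (1 : E →L[ℝ] E)).congr_of_eventuallyEq ?_)
      exact Eventually.of_forall fun t => unipResolvent_mul m (hA t) s
    have h4 : M' = -(s • (M * Y * M)) := by
      have h5 := congrArg (· * M) h2
      simp only [add_mul, zero_mul] at h5
      rw [mul_assoc M', mul_unipResolvent m (hA t), mul_one] at h5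
      rw [eq_neg_of_add_eq_zero_left h5, mul_smul_comm, smul_mul_assoc]
    rw [← (hAd.mul hRd.hasDerivAt).unique h1]
    show _ = Y * M + A t * M'
    have h6 : s • (A t * M) = 1 - (1 - s) • M := by
      have := mul_unipResolvent m (hA t) s
      rw [← hM, add_mul, one_mul, smul_mul_assoc, sub_mul, one_mul] at this
      rw [← this]
      module
    have h7 : A t * (s • (M * Y * M)) = (s • (A t * M)) * (Y * M) := by
      simp only [mul_smul_comm, smul_mul_assoc, mul_assoc]
    rw [h4, mul_neg, h7, h6, sub_mul, one_mul, smul_mul_assoc, mul_assoc]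
    abel
  have hint : ∫ s in (0 : ℝ)..1, (1 - s) • (unipResolvent m (A t) s * Y * unipResolvent m (A t) s)
      = ∑ n ∈ Finset.range m, ((-1) ^ n / (n + 1) : ℝ) • D n := by
    simp only [hs]
    rw [intervalIntegral.integral_finsetSum]
    · refine Finset.sum_congr rfl fun n _ => ?_
      rw [intervalIntegral.integral_smul_const]
      congr 1
      exact integral_neg_pow n
    · intro n _
      exact (by fun_prop : Continuous fun s : ℝ => (-s) ^ n • D n).intervalIntegrable _ _
  rw [hint]
  exact HasDerivAt.fun_sum fun n _ => (hD n).fun_const_smul _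

lemma unipLogDeriv_apply_of_apply_eq {m : ℕ} (hm : m ≠ 0) {A : E →L[ℝ] E} {v : E} (hv : A v = v) :
    unipLogDeriv m A v = v := by
  obtain ⟨m, rfl⟩ := Nat.exists_eq_succ_of_ne_zero hm
  unfold unipLogDeriv
  rw [Finset.sum_range_succ']
  have h0 : (A - 1) v = 0 := by simp [hv]
  simp only [add_apply, sum_apply,
    smul_apply, mul_apply_eq_comp, pow_succ, h0, map_zero,
    smul_zero, Finset.sum_const_zero]
  simp [hv]

lemma differentiable_unipLogDeriv (m : ℕ) :
    Differentiable ℝ (unipLogDeriv m : (E →L[ℝ] E) → E →L[ℝ] E) := by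
  unfold unipLogDeriv
  fun_prop

/-- The left invariant `1`-form `a ↦ (A log A / (A - 1)) a` is closed: here `A` and `A'` are curves
of unipotent automorphisms through the same point, with derivatives `A ∘ ad a` and `A ∘ ad b`. -/
theorem deriv_unipLogDeriv_sub_eq [CompleteSpace E] (B : E →L[ℝ] E →L[ℝ] E)
    (hskew : ∀ a b, B a b = - B b a) {A₀ : E →L[ℝ] E} (hAB : ∀ a b, A₀ (B a b) = B (A₀ a) (A₀ b))
    {m : ℕ} {A A' : ℝ → E →L[ℝ] E} {t t' : ℝ} (hA₀ : A t = A₀) (hA₀' : A' t' = A₀)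
    (hA : ∀ t, (A t - 1) ^ m = 0) (hA' : ∀ t, (A' t - 1) ^ m = 0) {a b : E}
    (hd : HasDerivAt A (A₀ * B a) t) (hd' : HasDerivAt A' (A₀ * B b) t')
    {p q : E} (hp : HasDerivAt (fun t => unipLogDeriv m (A t) b) p t)
    (hq : HasDerivAt (fun t => unipLogDeriv m (A' t) a) q t') :
    p - q = unipLogDeriv m A₀ (B a b) := by
  have hA0 : (A₀ - 1) ^ m = 0 := hA₀ ▸ hA t
  have hMc : Continuous (unipResolvent m A₀) := continuous_unipResolvent m A₀
  have hp' := (hasDerivAt_unipLogDeriv hd hA).clm_apply (hasDerivAt_const t b)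
  have hq' := (hasDerivAt_unipLogDeriv hd' hA').clm_apply (hasDerivAt_const t' a)
  rw [map_zero, add_zero, hA₀] at hp'
  rw [map_zero, add_zero, hA₀'] at hq'
  rw [hp.unique hp', hq.unique hq', ContinuousLinearMap.intervalIntegral_apply,
    ContinuousLinearMap.intervalIntegral_apply]
  · have hR : unipLogDeriv m A₀ (B a b) = ∫ s in (0 : ℝ)..1, A₀ (unipResolvent m A₀ s (B a b)) := by
      simp only [unipLogDeriv, unipResolvent, sum_apply, map_sum]
      rw [intervalIntegral.integral_finsetSum]
      · refine Finset.sum_congr rfl fun n _ => ?_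
        simp only [smul_apply, map_smul, mul_apply_eq_comp]
        rw [intervalIntegral.integral_smul_const]
        congr 1
        exact (integral_neg_pow n).symm
      · intro n _
        apply Continuous.intervalIntegrable
        fun_prop
    rw [hR, ← sub_eq_zero, ← intervalIntegral.integral_sub, ← intervalIntegral.integral_sub,
      ← integral_unipResolvent_bracket_eq_zero B hAB hA0 a b]
    · refine intervalIntegral.integral_congr fun s _ => ?_
      simp only [smul_apply, mul_apply_eq_comp, hAB]
      rw [hskew (A₀ b), map_neg, map_add]
      module
    all_goals
      apply Continuous.intervalIntegrable
      fun_prop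
  all_goals
    apply Continuous.intervalIntegrable
    fun_prop

end UnipotentLog

/-! ### Derivatives and left invariant fields in charts -/

section ModelDeriv

variable {E : Type*} [NormedAddCommGroup E] [NormedSpace ℝ E]
  {E' : Type*} [NormedAddCommGroup E'] [NormedSpace ℝ E']
  {E'' : Type*} [NormedAddCommGroup E''] [NormedSpace ℝ E'']
  {M : Type*} [TopologicalSpace M] [ChartedSpace E M]
  {M' : Type*} [TopologicalSpace M'] [ChartedSpace E' M']
  {M'' : Type*} [TopologicalSpace M''] [ChartedSpace E'' M'']

variable (E E') in
/-- The derivative of a map between manifolds, as a linear map between the model vector spaces,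
to which all tangent spaces are identified by the preferred charts. -/
def modelDeriv (f : M → M') (x : M) : E →L[ℝ] E' := mfderiv 𝓘(ℝ, E) 𝓘(ℝ, E') f x

lemma modelDeriv_comp {g : M' → M''} {f : M → M'} {x : M}
    (hg : MDifferentiableAt 𝓘(ℝ, E') 𝓘(ℝ, E'') g (f x))
    (hf : MDifferentiableAt 𝓘(ℝ, E) 𝓘(ℝ, E') f x) :
    modelDeriv E E'' (g ∘ f) x = (modelDeriv E' E'' g (f x)).comp (modelDeriv E E' f x) :=
  mfderiv_comp x hg hf

lemma modelDeriv_comp_apply {g : M' → M''} {f : M → M'} {x : M}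
    (hg : MDifferentiableAt 𝓘(ℝ, E') 𝓘(ℝ, E'') g (f x))
    (hf : MDifferentiableAt 𝓘(ℝ, E) 𝓘(ℝ, E') f x) (v : E) :
    modelDeriv E E'' (g ∘ f) x v = modelDeriv E' E'' g (f x) (modelDeriv E E' f x v) := by
  rw [modelDeriv_comp hg hf]; rfl

lemma modelDeriv_eq_fderiv (f : E → E') (x : E) : modelDeriv E E' f x = fderiv ℝ f x :=
  mfderiv_eq_fderiv

lemma modelDeriv_id (x : M) : modelDeriv E E (id : M → M) x = ContinuousLinearMap.id ℝ E :=
  mfderiv_id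

lemma modelDeriv_congr {f g : M → M'} {x : M} (h : f =ᶠ[𝓝 x] g) :
    modelDeriv E E' f x = modelDeriv E E' g x := Filter.EventuallyEq.mfderiv_eq h

lemma modelDeriv_extChartAt_self [IsManifold 𝓘(ℝ, E) 1 M] (p : M) :
    modelDeriv E E (extChartAt 𝓘(ℝ, E) p) p = ContinuousLinearMap.id ℝ E := by
  ext v
  have h := mfderiv_chartAt_eq_tangentCoordChange (I := 𝓘(ℝ, E)) (mem_chart_source E p)
  have h2 : modelDeriv E E (extChartAt 𝓘(ℝ, E) p) p = tangentCoordChange 𝓘(ℝ, E) p p p := by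
    rw [← h]
    unfold modelDeriv
    congr 1
  rw [h2]
  exact tangentCoordChange_self (mem_extChartAt_source p)

variable [IsManifold 𝓘(ℝ, E) ∞ M]

lemma contMDiffAt_extChartAt_of_mem {p y : M} (hy : y ∈ (extChartAt 𝓘(ℝ, E) p).source) :
    ContMDiffAt 𝓘(ℝ, E) 𝓘(ℝ, E) ∞ (extChartAt 𝓘(ℝ, E) p) y :=
  contMDiffAt_extChartAt' (by rwa [extChartAt_source] at hy)

lemma contMDiffAt_extChartAt_symm_of_mem {p : M} {x : E} (hx : x ∈ (extChartAt 𝓘(ℝ, E) p).target) :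
    ContMDiffAt 𝓘(ℝ, E) 𝓘(ℝ, E) ∞ (extChartAt 𝓘(ℝ, E) p).symm x :=
  ((contMDiffOn_extChartAt_symm p) x hx).contMDiffAt ((isOpen_extChartAt_target p).mem_nhds hx)

lemma modelDeriv_extChartAt_comp_symm {p : M} {x : E} (hx : x ∈ (extChartAt 𝓘(ℝ, E) p).target) :
    (modelDeriv E E (extChartAt 𝓘(ℝ, E) p) ((extChartAt 𝓘(ℝ, E) p).symm x)).comp
      (modelDeriv E E (extChartAt 𝓘(ℝ, E) p).symm x) = ContinuousLinearMap.id ℝ E := by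
  have hy := (extChartAt 𝓘(ℝ, E) p).map_target hx
  rw [← modelDeriv_comp (E' := E) ((contMDiffAt_extChartAt_of_mem hy).mdifferentiableAt (by simp))
    ((contMDiffAt_extChartAt_symm_of_mem hx).mdifferentiableAt (by simp)), ← modelDeriv_id (E := E) (M := E)]
  apply modelDeriv_congr
  filter_upwards [(isOpen_extChartAt_target p).mem_nhds hx] with z hz
  exact (extChartAt 𝓘(ℝ, E) p).right_inv hz

lemma modelDeriv_symm_comp_extChartAt {p : M} {x : E} (hx : x ∈ (extChartAt 𝓘(ℝ, E) p).target) :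
    (modelDeriv E E (extChartAt 𝓘(ℝ, E) p).symm x).comp
      (modelDeriv E E (extChartAt 𝓘(ℝ, E) p) ((extChartAt 𝓘(ℝ, E) p).symm x))
      = ContinuousLinearMap.id ℝ E := by
  have hy := (extChartAt 𝓘(ℝ, E) p).map_target hx
  have hr := (extChartAt 𝓘(ℝ, E) p).right_inv hx
  have h := modelDeriv_comp (E := E) (E' := E) (E'' := E) (x := (extChartAt 𝓘(ℝ, E) p).symm x)
    (g := (extChartAt 𝓘(ℝ, E) p).symm) (f := extChartAt 𝓘(ℝ, E) p)
    (by rw [hr]; exact (contMDiffAt_extChartAt_symm_of_mem hx).mdifferentiableAt (by simp))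
    ((contMDiffAt_extChartAt_of_mem hy).mdifferentiableAt (by simp))
  rw [hr] at h
  rw [← h, ← modelDeriv_id (E := E) (M := M)]
  apply modelDeriv_congr
  filter_upwards [(isOpen_extChartAt_source (I := 𝓘(ℝ, E)) p).mem_nhds hy] with z hz
  exact (extChartAt 𝓘(ℝ, E) p).left_inv hz

lemma modelDeriv_extChartAt_symm_self (p : M) :
    modelDeriv E E (extChartAt 𝓘(ℝ, E) p).symm (extChartAt 𝓘(ℝ, E) p p)
      = ContinuousLinearMap.id ℝ E := by
  have : IsManifold 𝓘(ℝ, E) 1 M := .of_le (n := ∞) (by simp)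
  have h := modelDeriv_symm_comp_extChartAt (mem_extChartAt_target (I := 𝓘(ℝ, E)) p)
  rwa [extChartAt_to_inv, modelDeriv_extChartAt_self, ContinuousLinearMap.comp_id] at h

/-- A function is differentiated along a tangent vector by differentiating its expression in a
chart. -/
lemma modelDeriv_eq_fderiv_chart {F : M → E'} {p : M} {x : E}
    (hx : x ∈ (extChartAt 𝓘(ℝ, E) p).target)
    (hF : MDifferentiableAt 𝓘(ℝ, E) 𝓘(ℝ, E') F ((extChartAt 𝓘(ℝ, E) p).symm x)) (v : E) :
    modelDeriv E E' F ((extChartAt 𝓘(ℝ, E) p).symm x) v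
      = fderiv ℝ (F ∘ (extChartAt 𝓘(ℝ, E) p).symm) x
        (modelDeriv E E (extChartAt 𝓘(ℝ, E) p) ((extChartAt 𝓘(ℝ, E) p).symm x) v) := by
  rw [← modelDeriv_eq_fderiv, modelDeriv_comp_apply (E' := E) hF
    ((contMDiffAt_extChartAt_symm_of_mem hx).mdifferentiableAt (by simp))]
  congr 1
  exact (DFunLike.congr_fun (modelDeriv_symm_comp_extChartAt hx) v).symm

end ModelDeriv

/-! ### The left trivialization of the tangent bundle -/

section LeftTrivialization

variable {E : Type*} [NormedAddCommGroup E] [NormedSpace ℝ E]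
  {G : Type*} [TopologicalSpace G] [ChartedSpace E G] [Group G]

/-- The derivative of the left multiplication by `g` at the identity: the left invariant field given
by `a` takes at `g` the value `leftTriv g a`. -/
def leftTriv (g : G) : E →L[ℝ] E := modelDeriv E E (g * ·) (1 : G)

/-- The left trivialization in the chart around `p`. -/
def chartTriv (p : G) (x : E) : E →L[ℝ] E :=
  (modelDeriv E E (extChartAt 𝓘(ℝ, E) p) ((extChartAt 𝓘(ℝ, E) p).symm x)).comp
    (leftTriv ((extChartAt 𝓘(ℝ, E) p).symm x))

/-- The multiplication in charts around `p` and `1`. -/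
def chartMul (p : G) (z : E × E) : E :=
  extChartAt 𝓘(ℝ, E) p ((extChartAt 𝓘(ℝ, E) p).symm z.1 * (extChartAt 𝓘(ℝ, E) (1 : G)).symm z.2)

lemma leftTriv_one : leftTriv (E := E) (1 : G) = ContinuousLinearMap.id ℝ E := by
  unfold leftTriv
  rw [← modelDeriv_id (E := E) (1 : G)]
  congr 1
  ext x
  simp

variable [LieGroup 𝓘(ℝ, E) ∞ G]

lemma mdifferentiableAt_leftMul (g h : G) :
    MDifferentiableAt 𝓘(ℝ, E) 𝓘(ℝ, E) (g * ·) h :=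
  (contMDiff_mul_left (I := 𝓘(ℝ, E)) (n := ∞)).contMDiffAt.mdifferentiableAt (by simp)

lemma modelDeriv_mul_left_leftTriv (g h : G) (a : E) :
    modelDeriv E E (g * ·) h (leftTriv h a) = leftTriv (g * h) a := by
  unfold leftTriv
  have h1 : (g * h * · : G → G) = (g * ·) ∘ (h * ·) := by
    ext x; simp [mul_assoc]
  rw [h1, modelDeriv_comp_apply (E' := E) (mdifferentiableAt_leftMul _ _)
    (mdifferentiableAt_leftMul _ _), mul_one]

lemma modelDeriv_comp_mul_left {E' : Type*} [NormedAddCommGroup E'] [NormedSpace ℝ E']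
    {M' : Type*} [TopologicalSpace M'] [ChartedSpace E' M'] {F : G → M'} {g : G}
    (hF : MDifferentiableAt 𝓘(ℝ, E) 𝓘(ℝ, E') F g) (a : E) :
    modelDeriv E E' (fun h => F (g * h)) 1 a = modelDeriv E E' F g (leftTriv g a) := by
  have := modelDeriv_comp_apply (E := E) (E' := E) (E'' := E') (f := (g * ·)) (g := F) (x := (1 : G))
    (by rwa [mul_one]) (mdifferentiableAt_leftMul _ _) a
  rw [mul_one] at this
  exact this

lemma leftTriv_inv_comp (g : G) :
    (modelDeriv E E (g⁻¹ * ·) g).comp (leftTriv g) = ContinuousLinearMap.id ℝ E := by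
  ext a
  have := modelDeriv_mul_left_leftTriv (E := E) g⁻¹ g a
  rw [inv_mul_cancel, leftTriv_one] at this
  exact this

lemma leftTriv_comp_inv (g : G) :
    (leftTriv g).comp (modelDeriv E E (g⁻¹ * ·) g) = ContinuousLinearMap.id ℝ E := by
  have h := modelDeriv_comp (E := E) (E' := E) (E'' := E) (f := (g⁻¹ * ·)) (g := (g * ·)) (x := g)
    (mdifferentiableAt_leftMul _ _) (mdifferentiableAt_leftMul _ _)
  rw [inv_mul_cancel] at h
  show (modelDeriv E E (g * ·) 1).comp (modelDeriv E E (g⁻¹ * ·) g) = _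
  rw [← h, ← modelDeriv_id (E := E) g]
  congr 1
  ext x
  simp

lemma chartTriv_bijective {p : G} {x : E} (hx : x ∈ (extChartAt 𝓘(ℝ, E) p).target) :
    Function.Bijective (chartTriv p x) := by
  have : IsManifold 𝓘(ℝ, E) ∞ G := inferInstance
  set y := (extChartAt 𝓘(ℝ, E) p).symm x
  have h1 : Function.Bijective (leftTriv (E := E) y) :=
    Function.bijective_iff_has_inverse.2 ⟨modelDeriv E E (y⁻¹ * ·) y,
      fun a => DFunLike.congr_fun (leftTriv_inv_comp y) a,
      fun a => DFunLike.congr_fun (leftTriv_comp_inv y) a⟩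
  have h2 : Function.Bijective (modelDeriv E E (extChartAt 𝓘(ℝ, E) p) y) :=
    Function.bijective_iff_has_inverse.2 ⟨modelDeriv E E (extChartAt 𝓘(ℝ, E) p).symm x,
      fun a => DFunLike.congr_fun (modelDeriv_symm_comp_extChartAt hx) a,
      fun a => DFunLike.congr_fun (modelDeriv_extChartAt_comp_symm hx) a⟩
  exact h2.comp h1

/-- The derivative along a left invariant field in a chart. -/
lemma modelDeriv_leftTriv_eq_fderiv {E' : Type*} [NormedAddCommGroup E'] [NormedSpace ℝ E']
    {F : G → E'} {p : G} {x : E} (hx : x ∈ (extChartAt 𝓘(ℝ, E) p).target)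
    (hF : MDifferentiableAt 𝓘(ℝ, E) 𝓘(ℝ, E') F ((extChartAt 𝓘(ℝ, E) p).symm x)) (a : E) :
    modelDeriv E E' F ((extChartAt 𝓘(ℝ, E) p).symm x) (leftTriv ((extChartAt 𝓘(ℝ, E) p).symm x) a)
      = fderiv ℝ (F ∘ (extChartAt 𝓘(ℝ, E) p).symm) x (chartTriv p x a) :=
  modelDeriv_eq_fderiv_chart hx hF _

lemma contDiffAt_chartMul {p : G} {x : E} (hx : x ∈ (extChartAt 𝓘(ℝ, E) p).target) :
    ContDiffAt ℝ ∞ (chartMul p) (x, extChartAt 𝓘(ℝ, E) (1 : G) 1) := by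
  rw [← contMDiffAt_iff_contDiffAt]
  have h1 : ContMDiffAt 𝓘(ℝ, E × E) 𝓘(ℝ, E) ∞
      (fun z : E × E => (extChartAt 𝓘(ℝ, E) p).symm z.1)
      (x, extChartAt 𝓘(ℝ, E) (1 : G) 1) :=
    ContMDiffAt.comp (I' := 𝓘(ℝ, E)) _ (contMDiffAt_extChartAt_symm_of_mem hx) contDiffAt_fst.contMDiffAt
  have h2 : ContMDiffAt 𝓘(ℝ, E × E) 𝓘(ℝ, E) ∞
      (fun z : E × E => (extChartAt 𝓘(ℝ, E) (1 : G)).symm z.2)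
      (x, extChartAt 𝓘(ℝ, E) (1 : G) 1) :=
    ContMDiffAt.comp (I' := 𝓘(ℝ, E)) _
      (contMDiffAt_extChartAt_symm_of_mem (mem_extChartAt_target (1 : G))) contDiffAt_snd.contMDiffAt
  refine ContMDiffAt.comp (I' := 𝓘(ℝ, E)) _ (contMDiffAt_extChartAt_of_mem ?_) (h1.mul h2)
  simp only [extChartAt_to_inv, mul_one]
  exact (extChartAt 𝓘(ℝ, E) p).map_target hx

lemma fderiv_chartMul_inr {p : G} {x : E} (hx : x ∈ (extChartAt 𝓘(ℝ, E) p).target) (a : E) :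
    fderiv ℝ (chartMul p) (x, extChartAt 𝓘(ℝ, E) (1 : G) 1) (0, a) = chartTriv p x a := by
  set e0 := extChartAt 𝓘(ℝ, E) (1 : G) 1 with he0
  set y := (extChartAt 𝓘(ℝ, E) p).symm x with hy
  have h1 : HasFDerivAt (fun w : E => (x, w)) (ContinuousLinearMap.inr ℝ E E) e0 :=
    hasFDerivAt_prodMk_right x e0
  have h2 := ((contDiffAt_chartMul hx).differentiableAt (by simp)).hasFDerivAt.comp e0 h1
  have h3 : fderiv ℝ (chartMul p) (x, e0) (0, a) = fderiv ℝ (chartMul p ∘ fun w => (x, w)) e0 a := by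
    rw [h2.fderiv, he0]; simp
  rw [h3, ← modelDeriv_eq_fderiv]
  have h4 : (chartMul p ∘ fun w => (x, w))
      = extChartAt 𝓘(ℝ, E) p ∘ ((y * ·) ∘ (extChartAt 𝓘(ℝ, E) (1 : G)).symm) := rfl
  have hs := (contMDiffAt_extChartAt_symm_of_mem
      (mem_extChartAt_target (I := 𝓘(ℝ, E)) (1 : G))).mdifferentiableAt (by simp)
  have hm := mdifferentiableAt_leftMul (E := E) y ((extChartAt 𝓘(ℝ, E) (1 : G)).symm e0)
  rw [h4, modelDeriv_comp_apply (E' := E) ?_ (hm.comp _ hs),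
    modelDeriv_comp_apply (E' := E) hm hs, modelDeriv_extChartAt_symm_self]
  · simp only [Function.comp_apply, he0, extChartAt_to_inv, mul_one]
    rfl
  · simp only [Function.comp_apply, he0, extChartAt_to_inv, mul_one]
    exact (contMDiffAt_extChartAt_of_mem
      ((extChartAt 𝓘(ℝ, E) p).map_target hx)).mdifferentiableAt (by simp)

lemma contDiffOn_chartTriv (p : G) :
    ContDiffOn ℝ ∞ (chartTriv (E := E) p) (extChartAt 𝓘(ℝ, E) p).target := by
  intro x hx
  have h1 : ContDiffAt ℝ ∞ (fderiv ℝ (chartMul p)) (x, extChartAt 𝓘(ℝ, E) (1 : G) 1) :=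
    (contDiffAt_chartMul hx).fderiv_right (by simp)
  have h2 : ContDiffAt ℝ ∞ (fun x => (fderiv ℝ (chartMul p)
      (x, extChartAt 𝓘(ℝ, E) (1 : G) 1)).comp (ContinuousLinearMap.inr ℝ E E)) x :=
    (h1.comp x (contDiffAt_id.prodMk contDiffAt_const)).clm_comp contDiffAt_const
  refine (h2.congr_of_eventuallyEq ?_).contDiffWithinAt
  filter_upwards [(isOpen_extChartAt_target p).mem_nhds hx] with z hz
  ext a
  exact (fderiv_chartMul_inr hz a).symm

variable (G) in
/-- The bracket of the Lie algebra of `G`, as a continuous bilinear map on the model space `E`. -/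
def leftBracket [FiniteDimensional ℝ E] [CompleteSpace E] : E →L[ℝ] E →L[ℝ] E :=
  let B : GroupLieAlgebra 𝓘(ℝ, E) G →ₗ[ℝ] GroupLieAlgebra 𝓘(ℝ, E) G →ₗ[ℝ] GroupLieAlgebra 𝓘(ℝ, E) G :=
    LinearMap.mk₂ ℝ (fun a b => ⁅a, b⁆) add_lie smul_lie lie_add lie_smul
  LinearMap.toContinuousLinearMap
    ((LinearMap.toContinuousLinearMap : (E →ₗ[ℝ] E) ≃ₗ[ℝ] (E →L[ℝ] E)).toLinearMap.comp
      (show E →ₗ[ℝ] E →ₗ[ℝ] E from B))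

open VectorField in
/-- The Lie bracket of left invariant fields, in a chart. -/
lemma lieBracket_chartTriv [FiniteDimensional ℝ E] [CompleteSpace E] {p : G} {x : E}
    (hx : x ∈ (extChartAt 𝓘(ℝ, E) p).target) (a b : E) :
    lieBracket ℝ (fun z => chartTriv p z a) (fun z => chartTriv p z b) x
      = chartTriv p x (leftBracket G a b) := by
  suffices H : ∀ a b : GroupLieAlgebra 𝓘(ℝ, E) G,
      lieBracket ℝ (E := E) (fun z => chartTriv p z a) (fun z => chartTriv p z b) x
        = chartTriv p x (leftBracket (E := E) G a b) from H a b
  intro a b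
  have hpull : ∀ z ∈ (extChartAt 𝓘(ℝ, E) p).target, ∀ c : GroupLieAlgebra 𝓘(ℝ, E) G,
      mpullback 𝓘(ℝ, E) 𝓘(ℝ, E) (extChartAt 𝓘(ℝ, E) p).symm (mulInvariantVectorField c) z
        = chartTriv p z c := by
    intro z hz c
    have : (modelDeriv E E (extChartAt 𝓘(ℝ, E) p).symm z).inverse
        = modelDeriv E E (extChartAt 𝓘(ℝ, E) p) ((extChartAt 𝓘(ℝ, E) p).symm z) :=
      ContinuousLinearMap.inverse_eq (modelDeriv_symm_comp_extChartAt hz)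
        (modelDeriv_extChartAt_comp_symm hz)
    show (modelDeriv E E (extChartAt 𝓘(ℝ, E) p).symm z).inverse
      (leftTriv ((extChartAt 𝓘(ℝ, E) p).symm z) c) = _
    rw [this]
    rfl
  have h := mpullback_mlieBracket (I := 𝓘(ℝ, E)) (I' := 𝓘(ℝ, E)) (n := ∞) (x₀ := x)
    (f := (extChartAt 𝓘(ℝ, E) p).symm) (V := mulInvariantVectorField a)
    (W := mulInvariantVectorField b) (mdifferentiableAt_mulInvariantVectorField a)
    (mdifferentiableAt_mulInvariantVectorField b) (contMDiffAt_extChartAt_symm_of_mem hx)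
    (by rw [minSmoothness_of_isRCLikeNormedField]; exact ENat.LEInfty.out)
  rw [← mulInvariantVector_mlieBracket, hpull x hx] at h
  have hl : ∀ V W : Π y : E, TangentSpace 𝓘(ℝ, E) y,
      mlieBracket 𝓘(ℝ, E) V W x = lieBracket ℝ (E := E) V W x := fun V W => by
    rw [← mlieBracketWithin_univ, mlieBracketWithin_eq_lieBracketWithin]
    exact congrFun (lieBracketWithin_univ (𝕜 := ℝ) (E := E)) x
  refine (hl _ _).symm.trans ?_
  have hev : ∀ c : E, (fun z => chartTriv p z c) =ᶠ[𝓝 x]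
      mpullback 𝓘(ℝ, E) 𝓘(ℝ, E) (extChartAt 𝓘(ℝ, E) p).symm
        (mulInvariantVectorField (c : GroupLieAlgebra 𝓘(ℝ, E) G)) := by
    intro c
    filter_upwards [(isOpen_extChartAt_target p).mem_nhds hx] with z hz
    exact (hpull z hz c).symm
  refine (Filter.EventuallyEq.mlieBracket_vectorField_eq (hev a) (hev b)).trans ?_
  exact h.symm

end LeftTrivialization

/-! ### The adjoint representation -/

section Adjoint

variable {E : Type*} [NormedAddCommGroup E] [NormedSpace ℝ E]
  {G : Type*} [TopologicalSpace G] [ChartedSpace E G] [Group G]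

/-- The adjoint representation of `G` on the model space `E` of its Lie algebra. -/
def adj (g : G) : E →L[ℝ] E := modelDeriv E E (fun h : G => g * h * g⁻¹) 1

lemma adj_one [LieGroup 𝓘(ℝ, E) ∞ G] : adj (E := E) (1 : G) = 1 := by
  have : adj (E := E) (1 : G) = modelDeriv E E (id : G → G) 1 := by
    unfold adj
    congr 1
    ext h
    simp
  rw [this, modelDeriv_id]
  rfl

variable [LieGroup 𝓘(ℝ, E) ∞ G]

lemma contMDiff_conj (g : G) :
    ContMDiff 𝓘(ℝ, E) 𝓘(ℝ, E) ∞ (fun h : G => g * h * g⁻¹) :=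
  (contMDiff_const.mul contMDiff_id).mul contMDiff_const

lemma mdifferentiableAt_conj (g h : G) :
    MDifferentiableAt 𝓘(ℝ, E) 𝓘(ℝ, E) (fun h : G => g * h * g⁻¹) h :=
  (contMDiff_conj g).contMDiffAt.mdifferentiableAt (by simp)

lemma adj_mul (g h : G) : adj (E := E) (g * h) = adj g * adj h := by
  have h1 : (fun z : G => g * h * z * (g * h)⁻¹)
      = (fun z => g * z * g⁻¹) ∘ (fun z => h * z * h⁻¹) := by
    ext z; simp [mul_assoc]
  unfold adj
  rw [h1, modelDeriv_comp (E' := E) (mdifferentiableAt_conj _ _) (mdifferentiableAt_conj _ _)]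
  simp only [mul_one, mul_inv_cancel]
  rfl

lemma adj_mul_inv (g : G) : adj (E := E) g * adj g⁻¹ = 1 := by
  rw [← adj_mul, mul_inv_cancel, adj_one]

/-- Conjugations map left invariant fields to left invariant fields. -/
lemma modelDeriv_conj_leftTriv (g h : G) (a : E) :
    modelDeriv E E (fun z : G => g * z * g⁻¹) h (leftTriv h a)
      = leftTriv (g * h * g⁻¹) (adj g a) := by
  unfold leftTriv adj
  have h1 : ((fun z : G => g * z * g⁻¹) ∘ (h * ·))
      = (g * h * g⁻¹ * ·) ∘ (fun z => g * z * g⁻¹) := by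
    ext z; simp [mul_assoc]
  have h2 := modelDeriv_comp_apply (E := E) (E' := E) (E'' := E) (x := (1 : G))
    (g := (fun z : G => g * z * g⁻¹)) (f := (h * ·))
    (mdifferentiableAt_conj _ _) (mdifferentiableAt_leftMul _ _) a
  have h3 := modelDeriv_comp_apply (E := E) (E' := E) (E'' := E) (x := (1 : G))
    (g := (g * h * g⁻¹ * ·)) (f := (fun z : G => g * z * g⁻¹))
    (mdifferentiableAt_leftMul _ _) (mdifferentiableAt_conj _ _) a
  simp only [mul_one, mul_inv_cancel] at h2 h3
  rw [← h2, ← h3, h1]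

/-- The conjugation in the chart around `1`. -/
def chartConj (G : Type*) [TopologicalSpace G] [ChartedSpace E G] [Group G] (z : E × E) : E :=
  extChartAt 𝓘(ℝ, E) (1 : G) ((extChartAt 𝓘(ℝ, E) (1 : G)).symm z.1
    * (extChartAt 𝓘(ℝ, E) (1 : G)).symm z.2 * ((extChartAt 𝓘(ℝ, E) (1 : G)).symm z.1)⁻¹)

lemma contDiffAt_chartConj {x : E} (hx : x ∈ (extChartAt 𝓘(ℝ, E) (1 : G)).target) :
    ContDiffAt ℝ ∞ (chartConj G) (x, extChartAt 𝓘(ℝ, E) (1 : G) 1) := by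
  rw [← contMDiffAt_iff_contDiffAt]
  have h1 : ContMDiffAt 𝓘(ℝ, E × E) 𝓘(ℝ, E) ∞
      (fun z : E × E => (extChartAt 𝓘(ℝ, E) (1 : G)).symm z.1)
      (x, extChartAt 𝓘(ℝ, E) (1 : G) 1) :=
    ContMDiffAt.comp (I' := 𝓘(ℝ, E)) _ (contMDiffAt_extChartAt_symm_of_mem hx)
      contDiffAt_fst.contMDiffAt
  have h2 : ContMDiffAt 𝓘(ℝ, E × E) 𝓘(ℝ, E) ∞
      (fun z : E × E => (extChartAt 𝓘(ℝ, E) (1 : G)).symm z.2)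
      (x, extChartAt 𝓘(ℝ, E) (1 : G) 1) :=
    ContMDiffAt.comp (I' := 𝓘(ℝ, E)) _
      (contMDiffAt_extChartAt_symm_of_mem (mem_extChartAt_target (1 : G)))
      contDiffAt_snd.contMDiffAt
  refine ContMDiffAt.comp (I' := 𝓘(ℝ, E)) _ (contMDiffAt_extChartAt_of_mem ?_)
    ((h1.mul h2).mul h1.inv)
  simp only [extChartAt_to_inv, mul_one, mul_inv_cancel]
  exact mem_extChartAt_source (1 : G)

/-- The slice of `chartConj` differentiates to the adjoint representation. -/
lemma fderiv_chartConj_inr {x : E} (hx : x ∈ (extChartAt 𝓘(ℝ, E) (1 : G)).target) :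
    (fderiv ℝ (chartConj G) (x, extChartAt 𝓘(ℝ, E) (1 : G) 1)).comp
      (ContinuousLinearMap.inr ℝ E E) = adj ((extChartAt 𝓘(ℝ, E) (1 : G)).symm x) := by
  ext a
  set e0 := extChartAt 𝓘(ℝ, E) (1 : G) 1 with he0
  set y := (extChartAt 𝓘(ℝ, E) (1 : G)).symm x with hy
  have h1 : HasFDerivAt (fun w : E => (x, w)) (ContinuousLinearMap.inr ℝ E E) e0 :=
    hasFDerivAt_prodMk_right x e0
  have h2 := ((contDiffAt_chartConj hx).differentiableAt (by simp)).hasFDerivAt.comp e0 h1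
  rw [← he0] at h2
  rw [← h2.fderiv, ← modelDeriv_eq_fderiv]
  have h4 : (chartConj G ∘ fun w => (x, w))
      = extChartAt 𝓘(ℝ, E) (1 : G) ∘ ((fun z => y * z * y⁻¹) ∘ (extChartAt 𝓘(ℝ, E) (1 : G)).symm) :=
    rfl
  have hs := (contMDiffAt_extChartAt_symm_of_mem
      (mem_extChartAt_target (I := 𝓘(ℝ, E)) (1 : G))).mdifferentiableAt (by simp)
  have hm := mdifferentiableAt_conj (E := E) y ((extChartAt 𝓘(ℝ, E) (1 : G)).symm e0)
  have : IsManifold 𝓘(ℝ, E) 1 G := .of_le (n := ∞) (by simp)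
  rw [h4, modelDeriv_comp_apply (E' := E) ?_ (hm.comp _ hs),
    modelDeriv_comp_apply (E' := E) hm hs, modelDeriv_extChartAt_symm_self]
  · simp only [Function.comp_apply, he0, extChartAt_to_inv, mul_one, mul_inv_cancel]
    rw [modelDeriv_extChartAt_self]
    rfl
  · simp only [Function.comp_apply, he0, extChartAt_to_inv, mul_one, mul_inv_cancel]
    exact (contMDiffAt_extChartAt_of_mem (mem_extChartAt_source (1 : G))).mdifferentiableAt (by simp)

lemma contDiffAt_adj_chart :
    ContDiffAt ℝ ∞ (fun x => adj (E := E) ((extChartAt 𝓘(ℝ, E) (1 : G)).symm x))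
      (extChartAt 𝓘(ℝ, E) (1 : G) 1) := by
  have hx := mem_extChartAt_target (I := 𝓘(ℝ, E)) (1 : G)
  have h1 : ContDiffAt ℝ ∞ (fderiv ℝ (chartConj (E := E) G)) (extChartAt 𝓘(ℝ, E) (1 : G) 1, extChartAt 𝓘(ℝ, E) (1 : G) 1) :=
    (contDiffAt_chartConj hx).fderiv_right (by simp)
  have h2 : ContDiffAt ℝ ∞ (fun x => (fderiv ℝ (chartConj (E := E) G)
      (x, extChartAt 𝓘(ℝ, E) (1 : G) 1)).comp (ContinuousLinearMap.inr ℝ E E)) (extChartAt 𝓘(ℝ, E) (1 : G) 1) :=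
    (ContDiffAt.comp (f := fun x => (x, extChartAt 𝓘(ℝ, E) (1 : G) 1)) _ h1
      (contDiffAt_id.prodMk contDiffAt_const)).clm_comp contDiffAt_const
  refine (h2.congr_of_eventuallyEq ?_)
  filter_upwards [(isOpen_extChartAt_target (1 : G)).mem_nhds hx] with z hz
  exact (fderiv_chartConj_inr hz).symm

lemma contMDiffAt_adj_one : ContMDiffAt 𝓘(ℝ, E) 𝓘(ℝ, E →L[ℝ] E) ∞ (adj (E := E) : G → E →L[ℝ] E) 1 := by
  have h := (contDiffAt_adj_chart (E := E) (G := G)).contMDiffAt.comp (1 : G)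
    (contMDiffAt_extChartAt (I := 𝓘(ℝ, E)) (n := ∞) (x := (1 : G)))
  refine h.congr_of_eventuallyEq ?_
  filter_upwards [extChartAt_source_mem_nhds (I := 𝓘(ℝ, E)) (1 : G)] with z hz
  simp only [Function.comp_apply]
  rw [(extChartAt 𝓘(ℝ, E) (1 : G)).left_inv hz]

lemma contMDiff_adj : ContMDiff 𝓘(ℝ, E) 𝓘(ℝ, E →L[ℝ] E) ∞ (adj (E := E) : G → E →L[ℝ] E) := by
  intro g
  have h1 : ContMDiffAt 𝓘(ℝ, E) 𝓘(ℝ, E →L[ℝ] E) ∞ (fun h => adj (E := E) (g⁻¹ * h)) g := by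
    refine ContMDiffAt.comp (I' := 𝓘(ℝ, E)) (g := (adj : G → E →L[ℝ] E)) (f := (g⁻¹ * ·)) g ?_
      (contMDiff_mul_left (I := 𝓘(ℝ, E)) (n := ∞)).contMDiffAt
    rw [inv_mul_cancel]
    exact contMDiffAt_adj_one
  have h2 : ContMDiffAt 𝓘(ℝ, E) 𝓘(ℝ, E →L[ℝ] E) ∞
      (fun h => (adj g).comp (adj (E := E) (g⁻¹ * h))) g :=
    contMDiffAt_const.clm_comp h1
  refine h2.congr_of_eventuallyEq (Eventually.of_forall fun h => ?_)
  show adj h = adj g * adj (g⁻¹ * h)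
  rw [← adj_mul, mul_inv_cancel_left]

variable [FiniteDimensional ℝ E] [CompleteSpace E]

/-- The derivative of the adjoint representation at the identity is the bracket: with `m` the
multiplication in the chart, this is the symmetry of the second derivative of `m`. -/
lemma modelDeriv_adj_one (a : E) :
    modelDeriv E (E →L[ℝ] E) (adj (E := E) : G → E →L[ℝ] E) 1 a = leftBracket G a := by
  ext b
  set e0 := extChartAt 𝓘(ℝ, E) (1 : G) 1 with he0
  set s := (extChartAt 𝓘(ℝ, E) (1 : G)).symm with hs
  set m : E × E → E := chartMul (1 : G) with hm
  have ht : e0 ∈ (extChartAt 𝓘(ℝ, E) (1 : G)).target := mem_extChartAt_target (1 : G)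
  have hs0 : s e0 = 1 := extChartAt_to_inv (1 : G)
  have hnt := (isOpen_extChartAt_target (I := 𝓘(ℝ, E)) (1 : G)).mem_nhds ht
  have hm0 : ContDiffAt ℝ ∞ m (e0, e0) := contDiffAt_chartMul ht
  have hm1 : ContDiffAt ℝ ∞ (fderiv ℝ m) (e0, e0) := hm0.fderiv_right (by simp)
  have hT0 : chartTriv (1 : G) e0 = ContinuousLinearMap.id ℝ E := by
    have : IsManifold 𝓘(ℝ, E) 1 G := .of_le (n := ∞) (by simp)
    unfold chartTriv
    rw [extChartAt_to_inv, modelDeriv_extChartAt_self, leftTriv_one]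
    rfl
  -- the derivative of the identity `m (chartConj (x, w), x) = m (x, w)` in the second variable
  have hid : ∀ᶠ x in 𝓝 e0, ∀ c : E, fderiv ℝ m (e0, x) (adj (s x) c, 0) = chartTriv (1 : G) x c := by
    have hc : ContinuousAt (fun x : E => (e0, x)) e0 := by fun_prop
    have hev := hc.eventually
      ((hm0.of_le (m := 1) (by simp)).eventually (by simp))
    filter_upwards [hnt, hev] with x hx hmx c
    have hF := ((contDiffAt_chartConj hx).differentiableAt (by simp)).hasFDerivAt.comp e0
      (hasFDerivAt_prodMk_right (𝕜 := ℝ) x e0)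
    rw [fderiv_chartConj_inr hx] at hF
    have hF0 : (chartConj G ∘ Prod.mk x) e0 = e0 := by
      simp only [chartConj, Function.comp_apply, he0, extChartAt_to_inv, mul_one, mul_inv_cancel]
    have hG : HasFDerivAt (fun w => m ((chartConj G ∘ Prod.mk x) w, x))
        ((fderiv ℝ m (e0, x)).comp ((ContinuousLinearMap.inl ℝ E E).comp (adj (s x)))) e0 := by
      have h1 := (hasFDerivAt_prodMk_left (𝕜 := ℝ) e0 x)
      rw [← hF0] at h1
      have h2 := h1.comp e0 hF
      have h3 : HasFDerivAt m (fderiv ℝ m (e0, x)) ((chartConj G ∘ Prod.mk x) e0, x) := by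
        rw [hF0]
        exact (hmx.differentiableAt (by simp)).hasFDerivAt
      exact HasFDerivAt.comp e0 h3 h2
    have hR := ((contDiffAt_chartMul hx).differentiableAt (by simp)).hasFDerivAt.comp e0
      (hasFDerivAt_prodMk_right (𝕜 := ℝ) x e0)
    have heq : (fun w => m ((chartConj G ∘ Prod.mk x) w, x)) =ᶠ[𝓝 e0] (chartMul (1 : G) ∘ Prod.mk x) := by
      have hcont : ContinuousAt (fun w => s x * s w * (s x)⁻¹) e0 := by
        have : ContinuousAt s e0 := continuousAt_extChartAt_symm (1 : G)
        have := topologicalGroup_of_lieGroup 𝓘(ℝ, E) ∞ (G := G)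
        fun_prop
      have hmem : (extChartAt 𝓘(ℝ, E) (1 : G)).source ∈ 𝓝 (s x * s e0 * (s x)⁻¹) := by
        rw [hs0, mul_one, mul_inv_cancel]
        exact extChartAt_source_mem_nhds (1 : G)
      filter_upwards [hcont hmem] with w hw
      simp only [hm, chartMul, Function.comp_apply, chartConj]
      rw [(extChartAt 𝓘(ℝ, E) (1 : G)).left_inv hw, inv_mul_cancel_right]
    have := (hG.congr_of_eventuallyEq heq.symm).unique hR
    have h5 := DFunLike.congr_fun this c
    rw [← fderiv_chartMul_inr hx]
    simpa using h5
  have hid0 : ∀ c : E, fderiv ℝ m (e0, e0) (c, 0) = c := by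
    intro c
    have := hid.self_of_nhds c
    rwa [hs0, adj_one, hT0] at this
  set D := fderiv ℝ (fderiv ℝ m) (e0, e0) with hD
  have hsymm : ∀ u v, D u v = D v u := (hm0.isSymmSndFDerivAt
    (by rw [minSmoothness_of_isRCLikeNormedField]; exact ENat.LEInfty.out)).eq
  have hV : ∀ c d : E, fderiv ℝ (fun x => chartTriv (1 : G) x c) e0 d = D (d, 0) (0, c) := by
    intro c d
    have h1 : (fun x => chartTriv (1 : G) x c) =ᶠ[𝓝 e0] fun x => fderiv ℝ m (x, e0) (0, c) := by
      filter_upwards [hnt] with x hx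
      exact (fderiv_chartMul_inr hx c).symm
    have h2 : HasFDerivAt (fun x => fderiv ℝ m (x, e0)) (D.comp (ContinuousLinearMap.inl ℝ E E)) e0 :=
      HasFDerivAt.comp e0 (hm1.differentiableAt (by simp)).hasFDerivAt
        (hasFDerivAt_prodMk_left (𝕜 := ℝ) e0 e0)
    rw [h1.fderiv_eq, (h2.clm_apply (hasFDerivAt_const (0, c) e0)).fderiv]
    simp
  have hbr := lieBracket_chartTriv (G := G) ht a b
  rw [VectorField.lieBracket, hT0, hV, hV] at hbr
  simp only [ContinuousLinearMap.id_apply] at hbr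
  have hA : HasFDerivAt (fun x => adj (E := E) (s x)) (fderiv ℝ (fun x => adj (E := E) (s x)) e0) e0 :=
    (contDiffAt_adj_chart.differentiableAt (by simp)).hasFDerivAt
  set A' := fderiv ℝ (fun x => adj (E := E) (s x)) e0 with hA'
  have hL : HasFDerivAt (fun x => fderiv ℝ m (e0, x)) (D.comp (ContinuousLinearMap.inr ℝ E E)) e0 :=
    HasFDerivAt.comp e0 (hm1.differentiableAt (by simp)).hasFDerivAt
      (hasFDerivAt_prodMk_right (𝕜 := ℝ) e0 e0)
  have hL2 := hL.clm_apply ((hasFDerivAt_prodMk_left (𝕜 := ℝ) _ (0 : E)).comp e0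
    (hA.clm_apply (hasFDerivAt_const b e0)))
  have hL3 := (hL2.congr_of_eventuallyEq (hid.mono fun x hx => (hx b).symm)).fderiv
  have hL4 := DFunLike.congr_fun hL3 a
  rw [hV] at hL4
  have hmd : modelDeriv E (E →L[ℝ] E) (adj (E := E) : G → E →L[ℝ] E) 1 a = A' a := by
    have := modelDeriv_leftTriv_eq_fderiv (F := (adj (E := E) : G → E →L[ℝ] E)) ht
      (by rw [← hs, hs0]; exact contMDiffAt_adj_one.mdifferentiableAt (by simp)) a
    rw [← hs, hs0, leftTriv_one, hT0] at this
    exact this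
  rw [hmd]
  simp [hs0, adj_one, hid0] at hL4
  rw [← hbr, hL4, hsymm (b, 0)]
  abel

lemma modelDeriv_adj (g : G) (a : E) :
    modelDeriv E (E →L[ℝ] E) (adj (E := E) : G → E →L[ℝ] E) g (leftTriv g a)
      = adj g * leftBracket G a := by
  have hd : MDifferentiableAt 𝓘(ℝ, E) 𝓘(ℝ, E →L[ℝ] E) (adj (E := E) : G → E →L[ℝ] E) g :=
    contMDiff_adj.contMDiffAt.mdifferentiableAt (by simp)
  rw [← modelDeriv_comp_mul_left hd]
  have h1 : (fun h : G => adj (E := E) (g * h))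
      = (ContinuousLinearMap.mul ℝ (E →L[ℝ] E) (adj g)) ∘ adj := by
    ext1 h
    exact adj_mul g h
  rw [h1, modelDeriv_comp_apply (E' := E →L[ℝ] E), modelDeriv_eq_fderiv,
    ContinuousLinearMap.fderiv, modelDeriv_adj_one]
  · rfl
  · exact (ContinuousLinearMap.mul ℝ (E →L[ℝ] E) (adj g)).differentiableAt.mdifferentiableAt
  · exact contMDiff_adj.contMDiffAt.mdifferentiableAt (by simp)

open VectorField in
lemma adj_leftBracket (g : G) (a b : E) :
    adj g (leftBracket G a b) = leftBracket G (adj g a) (adj g b) := by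
  set c : G → G := fun h => g * h * g⁻¹ with hc
  have hpull : ∀ z (d : GroupLieAlgebra 𝓘(ℝ, E) G), mpullback 𝓘(ℝ, E) 𝓘(ℝ, E) c
      (mulInvariantVectorField (G := G) (I := 𝓘(ℝ, E)) (adj (E := E) g d)) z
      = mulInvariantVectorField (G := G) (I := 𝓘(ℝ, E)) d z := by
    intro z d
    have hm : ∀ (h z : G), h⁻¹ * (h * z * h⁻¹) * h⁻¹⁻¹ = z := fun h z => by group
    have hcomp : ∀ h z : G, (modelDeriv E E (fun y : G => h⁻¹ * y * h⁻¹⁻¹) (h * z * h⁻¹)).comp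
        (modelDeriv E E (fun y : G => h * y * h⁻¹) z) = ContinuousLinearMap.id ℝ E := by
      intro h z
      have := modelDeriv_comp (E := E) (E' := E) (E'' := E) (x := z)
        (mdifferentiableAt_conj h⁻¹ (h * z * h⁻¹)) (mdifferentiableAt_conj h z)
      rw [← this, ← modelDeriv_id (E := E) z]
      congr 1
      ext y
      exact hm h y
    have h1 := hcomp g z
    have h2 := hcomp g⁻¹ (c z)
    simp only [hc, inv_inv] at h1 h2
    have h3 : g⁻¹ * (g * z * g⁻¹) * g = z := by group
    rw [h3] at h2
    have : (modelDeriv E E c z).inverse = modelDeriv E E (fun y : G => g⁻¹ * y * g) (c z) :=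
      ContinuousLinearMap.inverse_eq h2 h1
    show (modelDeriv E E c z).inverse (leftTriv (c z) (adj (E := E) g d)) = leftTriv (E := E) z d
    refine (congrArg _ (modelDeriv_conj_leftTriv (E := E) g z d).symm).trans ?_
    rw [this]
    exact DFunLike.congr_fun h1 _
  have h := mpullback_mlieBracket (I := 𝓘(ℝ, E)) (I' := 𝓘(ℝ, E)) (n := ∞) (x₀ := (1 : G))
    (f := c) (V := mulInvariantVectorField (adj (E := E) g a))
    (W := mulInvariantVectorField (adj (E := E) g b)) (mdifferentiableAt_mulInvariantVectorField _)
    (mdifferentiableAt_mulInvariantVectorField _) (contMDiff_conj g).contMDiffAt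
    (by rw [minSmoothness_of_isRCLikeNormedField]; exact ENat.LEInfty.out)
  have h0 : mpullback 𝓘(ℝ, E) 𝓘(ℝ, E) c (mulInvariantVectorField (G := G) (I := 𝓘(ℝ, E))
      (leftBracket G (adj g a) (adj g b))) 1 = leftBracket G a b := by
    refine Eq.trans ?_ (h.trans ?_)
    · refine congrArg (fun V => mpullback 𝓘(ℝ, E) 𝓘(ℝ, E) c V 1) ?_
      exact (mulInvariantVector_mlieBracket (I := 𝓘(ℝ, E)) (G := G) (adj (E := E) g a) (adj (E := E) g b))
    · rw [funext fun z => hpull z a, funext fun z => hpull z b]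
      rfl
  have h1 : adj g (adj g⁻¹ (leftBracket G (adj g a) (adj g b))) = leftBracket G (adj g a) (adj g b) :=
    DFunLike.congr_fun (adj_mul_inv (E := E) g) _
  have h2 := hpull 1 (adj (E := E) g⁻¹ (leftBracket G (adj g a) (adj g b)))
  have h3 := congrArg (fun V : E => mpullback 𝓘(ℝ, E) 𝓘(ℝ, E) c
    (mulInvariantVectorField (G := G) (I := 𝓘(ℝ, E)) V) 1) h1
  have h4 := DFunLike.congr_fun (leftTriv_one (E := E) (G := G))
    (adj g⁻¹ (leftBracket G (adj g a) (adj g b)))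
  rw [h0.symm.trans (h3.symm.trans (h2.trans h4))]
  exact h1

end Adjoint

/-! ### Nilpotency of the adjoint representation -/

section AdjointNilpotent

variable {E : Type*} [NormedAddCommGroup E] [NormedSpace ℝ E]
  {G : Type*} [TopologicalSpace G] [ChartedSpace E G] [Group G] [LieGroup 𝓘(ℝ, E) ∞ G]

lemma eventually_eq_of_modelDeriv_leftTriv_eq_zero
    {E' : Type*} [NormedAddCommGroup E'] [NormedSpace ℝ E'] {F : G → E'} {p : G}
    (h : ∀ᶠ g in 𝓝 p, MDifferentiableAt 𝓘(ℝ, E) 𝓘(ℝ, E') F g ∧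
      ∀ a : E, modelDeriv E E' F g (leftTriv g a) = 0) : ∀ᶠ g in 𝓝 p, F g = F p := by
  set e := extChartAt 𝓘(ℝ, E) p with he
  have h1 : ∀ᶠ x in 𝓝 (e p), MDifferentiableAt 𝓘(ℝ, E) 𝓘(ℝ, E') F (e.symm x) ∧
      ∀ a : E, modelDeriv E E' F (e.symm x) (leftTriv (e.symm x) a) = 0 := by
    have : Tendsto e.symm (𝓝 (e p)) (𝓝 p) := by
      have := continuousAt_extChartAt_symm (I := 𝓘(ℝ, E)) p
      rwa [ContinuousAt, extChartAt_to_inv] at this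
    exact this.eventually h
  obtain ⟨r, hr, hball⟩ := Metric.eventually_nhds_iff_ball.1
    (h1.and ((isOpen_extChartAt_target (I := 𝓘(ℝ, E)) p).mem_nhds (mem_extChartAt_target p)))
  have hd : ∀ x ∈ Metric.ball (e p) r, HasFDerivWithinAt (F ∘ e.symm) (0 : E →L[ℝ] E')
      (Metric.ball (e p) r) x := by
    intro x hx
    obtain ⟨⟨hF, hz⟩, hx'⟩ := hball x hx
    have hdiff : DifferentiableAt ℝ (F ∘ e.symm) x :=
      mdifferentiableAt_iff_differentiableAt.1
        (hF.comp x ((contMDiffAt_extChartAt_symm_of_mem hx').mdifferentiableAt (by simp)))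
    have h0 : fderiv ℝ (F ∘ e.symm) x = 0 := by
      ext v
      obtain ⟨a, rfl⟩ := (chartTriv_bijective hx').2 v
      rw [← modelDeriv_leftTriv_eq_fderiv hx' hF, hz]
      rfl
    rw [← h0]
    exact hdiff.hasFDerivAt.hasFDerivWithinAt
  have hopen : IsOpen (e.source ∩ e ⁻¹' Metric.ball (e p) r) :=
    (continuousOn_extChartAt p).isOpen_inter_preimage (isOpen_extChartAt_source p) Metric.isOpen_ball
  filter_upwards [hopen.mem_nhds ⟨mem_extChartAt_source p, Metric.mem_ball_self hr⟩] with q hq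
  have := (convex_ball (e p) r).is_const_of_fderivWithin_eq_zero (𝕜 := ℝ)
    (fun x hx => (hd x hx).differentiableWithinAt)
    (fun x hx => (hd x hx).fderivWithin (Metric.isOpen_ball.uniqueDiffWithinAt hx)) hq.2
    (Metric.mem_ball_self hr)
  simpa [e.left_inv hq.1, e.left_inv (mem_extChartAt_source (I := 𝓘(ℝ, E)) p)] using this

lemma eq_of_forall_modelDeriv_leftTriv_eq_zero [PreconnectedSpace G]
    {E' : Type*} [NormedAddCommGroup E'] [NormedSpace ℝ E'] {F : G → E'}
    (hF : MDifferentiable 𝓘(ℝ, E) 𝓘(ℝ, E') F)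
    (h : ∀ g (a : E), modelDeriv E E' F g (leftTriv g a) = 0) (g g' : G) : F g = F g' := by
  have hl : IsLocallyConstant F := (IsLocallyConstant.iff_eventually_eq F).2 fun p =>
    eventually_eq_of_modelDeriv_leftTriv_eq_zero (E := E) (Eventually.of_forall fun g => ⟨hF g, h g⟩)
  exact hl.apply_eq_of_isPreconnected isPreconnected_univ (mem_univ _) (mem_univ _)

lemma mdifferentiable_adj_apply (b : E) :
    MDifferentiable 𝓘(ℝ, E) 𝓘(ℝ, E) (fun g : G => adj (E := E) g b) :=
  fun g => ((contMDiff_adj.contMDiffAt (x := g)).clm_apply contMDiffAt_const).mdifferentiableAt (by simp)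

variable [FiniteDimensional ℝ E] [CompleteSpace E]

lemma modelDeriv_adj_apply (b : E) (g : G) (a : E) :
    modelDeriv E E (fun g : G => adj g b) g (leftTriv g a) = adj g (leftBracket G a b) := by
  have h1 : (fun g : G => adj (E := E) g b) = (ContinuousLinearMap.apply ℝ E b) ∘ adj := rfl
  rw [h1, modelDeriv_comp_apply (E' := E →L[ℝ] E), modelDeriv_eq_fderiv,
    ContinuousLinearMap.fderiv, modelDeriv_adj]
  · rfl
  · exact (ContinuousLinearMap.apply ℝ E b).differentiableAt.mdifferentiableAt
  · exact contMDiff_adj.contMDiffAt.mdifferentiableAt (by simp)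

variable (E G) in
/-- The upper central series, as subspaces of the model space. -/
def modelUcs (i : ℕ) : Submodule ℝ E := upperCentral E G i

lemma mem_modelUcs_succ {i : ℕ} {b : E} :
    b ∈ modelUcs E G (i + 1) ↔ ∀ a, leftBracket G a b ∈ modelUcs E G i := by
  have h : ∀ b : GroupLieAlgebra 𝓘(ℝ, E) G,
      b ∈ (⊥ : LieSubmodule ℝ (GroupLieAlgebra 𝓘(ℝ, E) G) (GroupLieAlgebra 𝓘(ℝ, E) G)).ucs (i + 1)
      ↔ ∀ a : GroupLieAlgebra 𝓘(ℝ, E) G, ⁅a, b⁆ ∈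
        (⊥ : LieSubmodule ℝ (GroupLieAlgebra 𝓘(ℝ, E) G) (GroupLieAlgebra 𝓘(ℝ, E) G)).ucs i := by
    intro b
    rw [LieSubmodule.ucs_succ]
    exact LieSubmodule.mem_normalizer _ _
  exact h b

lemma modelUcs_zero : modelUcs E G 0 = ⊥ := by
  ext b
  exact Iff.rfl

lemma modelUcs_le_succ (i : ℕ) : modelUcs E G i ≤ modelUcs E G (i + 1) := by
  intro b hb
  have h := LieSubmodule.le_normalizer
    ((⊥ : LieSubmodule ℝ (GroupLieAlgebra 𝓘(ℝ, E) G) (GroupLieAlgebra 𝓘(ℝ, E) G)).ucs i) hb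
  rw [← LieSubmodule.ucs_succ] at h
  exact h

/-- A vector whose orbit under `adj` moves only in the directions of the subspace `W` is fixed
modulo `W`, as `G` is connected. -/
lemma adj_sub_mem_of_forall [PreconnectedSpace G] {W : Submodule ℝ E} {b : E}
    (h : ∀ (g : G) a, adj g (leftBracket G a b) ∈ W) (g : G) : adj g b - b ∈ W := by
  obtain ⟨W', hW⟩ := W.exists_isCompl
  set P : E →L[ℝ] W' := LinearMap.toContinuousLinearMap (W'.projectionOnto W hW.symm)
  have hP : ∀ c, P c = 0 ↔ c ∈ W := fun c => Submodule.projectionOnto_apply_eq_zero_iff hW.symm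
  have h2 := eq_of_forall_modelDeriv_leftTriv_eq_zero (E := E) (G := G) (F := fun g => P (adj g b))
    (fun g => (P.differentiableAt.mdifferentiableAt).comp g (mdifferentiable_adj_apply b g))
    (fun g a => by
      have := modelDeriv_comp_apply (E := E) (E' := E) (E'' := W')
        (g := P) (f := fun g : G => adj g b) P.differentiableAt.mdifferentiableAt
        (mdifferentiable_adj_apply b g) (leftTriv g a)
      refine this.trans ?_
      rw [modelDeriv_adj_apply, modelDeriv_eq_fderiv, ContinuousLinearMap.fderiv, hP]
      exact h g a) g 1
  rw [← hP, map_sub, h2, adj_one]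
  simp

lemma adj_sub_mem_modelUcs [PreconnectedSpace G] (i : ℕ) :
    ∀ b ∈ modelUcs E G (i + 1), ∀ g : G, adj g b - b ∈ modelUcs E G i := by
  induction i with
  | zero =>
    intro b hb
    refine adj_sub_mem_of_forall fun g a => ?_
    have := mem_modelUcs_succ.1 hb a
    rw [modelUcs_zero, Submodule.mem_bot] at this ⊢
    rw [this, map_zero]
  | succ i ih =>
    intro b hb
    refine adj_sub_mem_of_forall fun g a => ?_
    have h := mem_modelUcs_succ.1 hb a
    have := (modelUcs E G (i + 1)).add_mem (modelUcs_le_succ i (ih _ h g)) h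
    rwa [sub_add_cancel] at this

lemma adj_sub_one_pow_eq_zero [PreconnectedSpace G] {k : ℕ} (hk : modelUcs E G k = ⊤) (g : G) :
    (adj (E := E) g - 1) ^ k = 0 := by
  have h : ∀ i, ∀ b ∈ modelUcs E G i, ((adj (E := E) g - 1) ^ i) b = 0 := by
    intro i
    induction i with
    | zero => intro b hb; rw [modelUcs_zero] at hb; simpa using hb
    | succ i ih =>
      intro b hb
      rw [pow_succ]
      exact ih _ (adj_sub_mem_modelUcs i b hb g)
  ext b
  exact h k b (by rw [hk]; trivial)

end AdjointNilpotent

/-! ### Primitives of closed forms on simply connected groups -/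

/-- Functions defined on open sets covering a simply connected space, with locally constant
differences, come from a global function: the affine line bundle with discrete fibre that they
define is a covering of the space, and has a section. -/
lemma exists_eventually_sub_eq {X V : Type*} [TopologicalSpace X] [SimplyConnectedSpace X]
    [LocallyPathConnectedSpace X] [AddCommGroup V] {U : X → Set X} (hU : ∀ p, IsOpen (U p))
    (hmem : ∀ p, p ∈ U p) {f : X → X → V}
    (hf : ∀ p q, ∀ x ∈ U p ∩ U q, ∀ᶠ y in 𝓝 x, f p y - f q y = f p x - f q x) :
    ∃ F : X → V, ∀ p, ∀ x ∈ U p, ∀ᶠ y in 𝓝 x, F y - f p y = F x - f p x := by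
  let _ : TopologicalSpace V := ⊥
  have : DiscreteTopology V := ⟨rfl⟩
  let Z : FiberBundleCore X X V :=
    { baseSet := U
      isOpen_baseSet := hU
      indexAt := id
      mem_baseSet_at := hmem
      coordChange := fun p q x v => v + (f p x - f q x)
      coordChange_self := fun p x _ v => by simp
      continuousOn_coordChange := by
        rintro p q ⟨x, v⟩ ⟨hx, -⟩
        refine ContinuousAt.continuousWithinAt ?_
        have h : (fun z : X × V => z.2 + (f p x - f q x)) =ᶠ[𝓝 (x, v)]
            fun z : X × V => z.2 + (f p z.1 - f q z.1) := by
          filter_upwards [continuousAt_fst.eventually (hf p q x hx)] with z hz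
          rw [hz]
        exact ((continuous_of_discreteTopology (f := fun w : V => w + (f p x - f q x))).comp
          continuous_snd).continuousAt.congr h
      coordChange_comp := fun p q r x _ v => by abel }
  have hcov := FiberBundle.isCoveringMap (F := V) (E := Z.Fiber)
  obtain ⟨x₀⟩ : Nonempty X := inferInstance
  obtain ⟨s, ⟨-, hs⟩, -⟩ := hcov.existsUnique_continuousMap_lifts (ContinuousMap.id X) x₀
    (⟨x₀, (0 : V)⟩ : TotalSpace V Z.Fiber) rfl
  have hs' : ∀ x, (s x).proj = x := fun x => congrFun hs x
  refine ⟨fun x => (show V from (s x).2) + f x x, fun p x hx => ?_⟩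
  have hkey : ∀ y, (Z.localTriv p (s y)).2 = (show V from (s y).2) + f y y - f p y := by
    intro y
    have : (Z.localTriv p (s y)).2 = (show V from (s y).2) + (f (s y).proj (s y).proj - f p (s y).proj) := rfl
    rw [this, hs']
    abel
  have hc : ContinuousAt (fun y => (Z.localTriv p (s y)).2) x := by
    refine ContinuousAt.snd ?_
    refine ContinuousAt.comp (g := Z.localTriv p) ?_ s.continuous.continuousAt
    refine (Z.localTriv p).continuousAt ?_
    rw [(Z.localTriv p).mem_source]
    show (s x).proj ∈ U p
    rwa [hs']
  have h2 := hc.eventually (show {(Z.localTriv p (s x)).2} ∈ 𝓝 _ from (isOpen_discrete _).mem_nhds rfl)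
  filter_upwards [h2] with y hy
  rw [← hkey, ← hkey]
  exact hy

section Primitive

lemma hasDerivAt_chart_line {E : Type*} [NormedAddCommGroup E] [NormedSpace ℝ E]
    {E' : Type*} [NormedAddCommGroup E'] [NormedSpace ℝ E']
    {G : Type*} [TopologicalSpace G] [ChartedSpace E G] [Group G] [LieGroup 𝓘(ℝ, E) ∞ G]
    {F : G → E'} {g : G} (hF : MDifferentiableAt 𝓘(ℝ, E) 𝓘(ℝ, E') F g)
    (a : E) :
    HasDerivAt (fun t : ℝ => F ((extChartAt 𝓘(ℝ, E) g).symm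
      (extChartAt 𝓘(ℝ, E) g g + t • chartTriv g (extChartAt 𝓘(ℝ, E) g g) a)))
      (modelDeriv E E' F g (leftTriv g a)) 0 := by
  have hx := mem_extChartAt_target (I := 𝓘(ℝ, E)) g
  have hg := extChartAt_to_inv (I := 𝓘(ℝ, E)) g
  have hF' : MDifferentiableAt 𝓘(ℝ, E) 𝓘(ℝ, E') F
      ((extChartAt 𝓘(ℝ, E) g).symm (extChartAt 𝓘(ℝ, E) g g)) := by rwa [hg]
  have h1 := modelDeriv_leftTriv_eq_fderiv hx hF' a
  rw [hg] at h1
  have hd : DifferentiableAt ℝ (F ∘ (extChartAt 𝓘(ℝ, E) g).symm) (extChartAt 𝓘(ℝ, E) g g) :=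
    mdifferentiableAt_iff_differentiableAt.1
      (hF'.comp _ ((contMDiffAt_extChartAt_symm_of_mem hx).mdifferentiableAt (by simp)))
  set v := chartTriv g (extChartAt 𝓘(ℝ, E) g g) a
  have h2 : HasDerivAt (fun t : ℝ => extChartAt 𝓘(ℝ, E) g g + t • v) v 0 := by
    simpa using ((hasDerivAt_id (0 : ℝ)).smul_const v).const_add (extChartAt 𝓘(ℝ, E) g g)
  rw [h1]
  have h3 := hd.hasFDerivAt
  refine HasFDerivAt.comp_hasDerivAt (𝕜 := ℝ) (l := F ∘ (extChartAt 𝓘(ℝ, E) g).symm) 0 ?_ h2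
  simpa using h3

variable {E : Type*} [NormedAddCommGroup E] [NormedSpace ℝ E] [FiniteDimensional ℝ E]
  [CompleteSpace E] {E' : Type*} [NormedAddCommGroup E'] [NormedSpace ℝ E'] [CompleteSpace E']
  {G : Type*} [TopologicalSpace G] [ChartedSpace E G] [Group G] [LieGroup 𝓘(ℝ, E) ∞ G]

/-- The Poincaré lemma, for a form that takes on the left invariant field given by `a` the values
`α g a`. -/
lemma exists_ball_primitive {α : G → E →L[ℝ] E'}
    (hα : MDifferentiable 𝓘(ℝ, E) 𝓘(ℝ, E →L[ℝ] E') α)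
    (hclosed : ∀ g a b, modelDeriv E E' (fun h => α h b) g (leftTriv g a)
      - modelDeriv E E' (fun h => α h a) g (leftTriv g b) = α g (leftBracket G a b)) (p : G) :
    ∃ U : Set G, IsOpen U ∧ p ∈ U ∧ ∃ f : G → E', ∀ g ∈ U,
      MDifferentiableAt 𝓘(ℝ, E) 𝓘(ℝ, E') f g ∧ ∀ a, modelDeriv E E' f g (leftTriv g a) = α g a := by
  set e := extChartAt 𝓘(ℝ, E) p with he
  obtain ⟨r, hr, hball⟩ := Metric.isOpen_iff.1 (isOpen_extChartAt_target (I := 𝓘(ℝ, E)) p) (e p)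
    (mem_extChartAt_target p)
  set T : E → E →L[ℝ] E := chartTriv p with hT
  have hTd : ∀ x ∈ e.target, DifferentiableAt ℝ T x := fun x hx =>
    ((contDiffOn_chartTriv p).contDiffAt ((isOpen_extChartAt_target p).mem_nhds hx)).differentiableAt
      (by simp)
  have hTu : ∀ x ∈ e.target, IsUnit (T x) := fun x hx =>
    ContinuousLinearMap.isUnit_iff_bijective.2 (chartTriv_bijective hx)
  have hs : ∀ x ∈ e.target, MDifferentiableAt 𝓘(ℝ, E) 𝓘(ℝ, E) e.symm x := fun x hx =>
    (contMDiffAt_extChartAt_symm_of_mem hx).mdifferentiableAt (by simp)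
  have hαd : ∀ x ∈ e.target, DifferentiableAt ℝ (fun x => α (e.symm x)) x := fun x hx =>
    mdifferentiableAt_iff_differentiableAt.1 ((hα _).comp x (hs x hx))
  set θ : E → E →L[ℝ] E' := fun x => (α (e.symm x)).comp (Ring.inverse (T x)) with hθ
  have hθd : ∀ x ∈ e.target, DifferentiableAt ℝ θ x := fun x hx => by
    obtain ⟨u, hu⟩ := hTu x hx
    have h1 : DifferentiableAt ℝ (fun x => Ring.inverse (T x)) x :=
      DifferentiableAt.comp (g := Ring.inverse) x (by rw [← hu]; exact (contDiffAt_ringInverse ℝ u (n := 1)).differentiableAt (by simp)) (hTd x hx)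
    exact (hαd x hx).clm_comp h1
  have hθT : ∀ x ∈ e.target, ∀ a, θ x (T x a) = α (e.symm x) a := fun x hx a => by
    have h1 : Ring.inverse (T x) (T x a) = a :=
      DFunLike.congr_fun (Ring.inverse_mul_cancel _ (hTu x hx)) a
    simp only [hθ, ContinuousLinearMap.comp_apply, h1]
  have hdθ : ∀ x ∈ e.target, ∀ a u, fderiv ℝ θ x u (T x a) + θ x (fderiv ℝ (fun z => T z a) x u)
      = fderiv ℝ (fun x => α (e.symm x) a) x u := by
    intro x hx a u
    have h1 : (fun x => θ x (T x a)) =ᶠ[𝓝 x] fun x => α (e.symm x) a := by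
      filter_upwards [(isOpen_extChartAt_target p).mem_nhds hx] with z hz
      exact hθT z hz a
    have h2 : HasFDerivAt (fun z => T z a) (fderiv ℝ (fun z => T z a) x) x :=
      ((hTd x hx).clm_apply (differentiableAt_const a)).hasFDerivAt
    rw [← h1.fderiv_eq, ((hθd x hx).hasFDerivAt.clm_apply h2).fderiv]
    simp [add_comm]
  have hD : ∀ x ∈ e.target, ∀ a b, modelDeriv E E' (fun h => α h b) (e.symm x) (leftTriv (e.symm x) a)
      = fderiv ℝ (fun x => α (e.symm x) b) x (T x a) := by
    intro x hx a b
    have hb : MDifferentiableAt 𝓘(ℝ, E) 𝓘(ℝ, E') (fun h => α h b) (e.symm x) :=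
      (((ContinuousLinearMap.apply ℝ E' b).differentiableAt.mdifferentiableAt)).comp _ (hα _)
    exact modelDeriv_leftTriv_eq_fderiv hx hb a
  have hsymm : ∀ x ∈ Metric.ball (e p) r, ∀ u v, fderiv ℝ θ x u v = fderiv ℝ θ x v u := by
    intro x hx u v
    have hx' := hball hx
    obtain ⟨a, rfl⟩ := (chartTriv_bijective hx').2 u
    obtain ⟨b, rfl⟩ := (chartTriv_bijective hx').2 v
    have h1 := hclosed (e.symm x) a b
    rw [hD x hx', hD x hx', ← hθT x hx', hT, ← lieBracket_chartTriv hx', VectorField.lieBracket,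
      map_sub, ← hT, ← hdθ x hx', ← hdθ x hx'] at h1
    rw [← hT, ← sub_eq_zero]
    rw [← sub_eq_zero] at h1
    rw [← h1]
    abel
  obtain ⟨f, hf⟩ := (convex_ball (e p) r).exists_forall_hasFDerivAt_of_fderiv_symmetric
    Metric.isOpen_ball (fun x hx => (hθd x (hball hx)).differentiableWithinAt) hsymm
  refine ⟨e.source ∩ e ⁻¹' Metric.ball (e p) r,
    (continuousOn_extChartAt p).isOpen_inter_preimage (isOpen_extChartAt_source p) Metric.isOpen_ball,
    ⟨mem_extChartAt_source p, Metric.mem_ball_self hr⟩, f ∘ e, fun g ⟨hg, hgb⟩ => ?_⟩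
  have hfd := hf (e g) hgb
  have hed : MDifferentiableAt 𝓘(ℝ, E) 𝓘(ℝ, E) e g :=
    (contMDiffAt_extChartAt_of_mem hg).mdifferentiableAt (by simp)
  refine ⟨hfd.differentiableAt.mdifferentiableAt.comp g hed, fun a => ?_⟩
  rw [modelDeriv_comp_apply (E' := E) hfd.differentiableAt.mdifferentiableAt hed,
    modelDeriv_eq_fderiv, hfd.fderiv]
  have := hθT (e g) (e.map_source hg) a
  rw [e.left_inv hg] at this
  rw [← this]
  simp only [hT, chartTriv, ← he, e.left_inv hg]
  rfl

/-- A closed form on a simply connected group has a primitive. -/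
lemma exists_primitive_of_closed [SimplyConnectedSpace G] {α : G → E →L[ℝ] E'}
    (hα : MDifferentiable 𝓘(ℝ, E) 𝓘(ℝ, E →L[ℝ] E') α)
    (hclosed : ∀ g a b, modelDeriv E E' (fun h => α h b) g (leftTriv g a)
      - modelDeriv E E' (fun h => α h a) g (leftTriv g b) = α g (leftBracket G a b)) :
    ∃ F : G → E', MDifferentiable 𝓘(ℝ, E) 𝓘(ℝ, E') F ∧
      ∀ g a, modelDeriv E E' F g (leftTriv g a) = α g a := by
  have : LocallyPathConnectedSpace G := ChartedSpace.locallyPathConnectedSpace E G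
  choose U hU hmem f hf using exists_ball_primitive hα hclosed
  obtain ⟨F, hF⟩ := exists_eventually_sub_eq hU hmem (f := f) (fun p q x hx => by
    refine eventually_eq_of_modelDeriv_leftTriv_eq_zero (E := E) (F := fun y => f p y - f q y) ?_
    filter_upwards [((hU p).inter (hU q)).mem_nhds hx] with g hg
    have h1 := hf p g hg.1
    have h2 := hf q g hg.2
    refine ⟨h1.1.sub h2.1, fun a => ?_⟩
    have : modelDeriv E E' (fun y => f p y - f q y) g = modelDeriv E E' (f p) g - modelDeriv E E' (f q) g :=
      mfderiv_sub h1.1 h2.1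
    rw [this, sub_apply, h1.2, h2.2, sub_self])
  have hloc : ∀ g, F =ᶠ[𝓝 g] fun y => f g y + (F g - f g g) := fun g => by
    filter_upwards [hF g g (hmem g)] with y hy
    rw [← hy]; abel
  have hadd : ∀ g, HasMFDerivAt 𝓘(ℝ, E) 𝓘(ℝ, E') F g (mfderiv 𝓘(ℝ, E) 𝓘(ℝ, E') (f g) g) := fun g => by
    have h1 := ((hasFDerivAt_id (𝕜 := ℝ) (f g g)).add_const (F g - f g g)).hasMFDerivAt.comp g
      (hf g g (hmem g)).1.hasMFDerivAt
    exact h1.congr_of_eventuallyEq (hloc g)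
  exact ⟨F, fun g => (hadd g).mdifferentiableAt, fun g a => by
    rw [modelDeriv, (hadd g).mfderiv]
    exact (hf g g (hmem g)).2 a⟩

/-- The logarithm of a simply connected group with unipotent adjoint representation, determined
up to a constant by its logarithmic derivative. -/
lemma exists_log [SimplyConnectedSpace G] {m : ℕ} (hm : ∀ g : G, (adj (E := E) g - 1) ^ m = 0) :
    ∃ F : G → E, MDifferentiable 𝓘(ℝ, E) 𝓘(ℝ, E) F ∧
      ∀ g a, modelDeriv E E F g (leftTriv g a) = unipLogDeriv m (adj g) a := by
  have hadj : MDifferentiable 𝓘(ℝ, E) 𝓘(ℝ, E →L[ℝ] E) (adj (E := E) : G → E →L[ℝ] E) :=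
    fun g => contMDiff_adj.contMDiffAt.mdifferentiableAt (by simp)
  have hα : MDifferentiable 𝓘(ℝ, E) 𝓘(ℝ, E →L[ℝ] E) fun g : G => unipLogDeriv m (adj (E := E) g) :=
    fun g => MDifferentiableAt.comp (I' := 𝓘(ℝ, E →L[ℝ] E)) (g := unipLogDeriv m) g
      (differentiable_unipLogDeriv m _).mdifferentiableAt (hadj g)
  refine exists_primitive_of_closed hα fun g a b => ?_
  have hb : ∀ b : E, MDifferentiableAt 𝓘(ℝ, E) 𝓘(ℝ, E) (fun h : G => unipLogDeriv m (adj (E := E) h) b) g :=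
    fun b => ((ContinuousLinearMap.apply ℝ E b).differentiableAt.mdifferentiableAt).comp g (hα g)
  refine deriv_unipLogDeriv_sub_eq (leftBracket G) (fun a b => ?_) (A₀ := adj g)
    (adj_leftBracket g) (t := 0) (t' := 0) ?_ ?_ (fun t => hm _) (fun t => hm _) ?_ ?_
    (hasDerivAt_chart_line (hb b) a) (hasDerivAt_chart_line (hb a) b)
  · exact (lie_skew (L := GroupLieAlgebra 𝓘(ℝ, E) G) a b).symm
  · simp
  · simp
  · rw [← modelDeriv_adj]
    exact hasDerivAt_chart_line (hadj g) a
  · rw [← modelDeriv_adj]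
    exact hasDerivAt_chart_line (hadj g) b

end Primitive

/-! ### One-parameter groups -/

section OneParameter

variable {E : Type*} [NormedAddCommGroup E] [NormedSpace ℝ E]
  {G : Type*} [TopologicalSpace G] [ChartedSpace E G] [Group G]

/-- The integral curves of the left invariant field given by `a`. -/
def IsLeftCurve (a : E) (γ : ℝ → G) : Prop :=
  IsMIntegralCurve (I := 𝓘(ℝ, E)) γ (mulInvariantVectorField (I := 𝓘(ℝ, E)) (G := G) a)

lemma IsLeftCurve.mdifferentiableAt {a : E} {γ : ℝ → G} (h : IsLeftCurve a γ) (t : ℝ) :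
    MDifferentiableAt 𝓘(ℝ, ℝ) 𝓘(ℝ, E) γ t := (h t).mdifferentiableAt

lemma IsLeftCurve.modelDeriv_apply {a : E} {γ : ℝ → G} (h : IsLeftCurve a γ) (t s : ℝ) :
    modelDeriv ℝ E γ t s = s • leftTriv (γ t) a := by
  have := (h t).mfderiv
  unfold modelDeriv
  rw [this]
  rfl

lemma isLeftCurve_of_modelDeriv {a : E} {γ : ℝ → G}
    (hd : ∀ t, MDifferentiableAt 𝓘(ℝ, ℝ) 𝓘(ℝ, E) γ t)
    (h : ∀ t, modelDeriv ℝ E γ t 1 = leftTriv (γ t) a) : IsLeftCurve a γ := by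
  intro t
  have h1 := (hd t).hasMFDerivAt
  have h2 : mfderiv 𝓘(ℝ, ℝ) 𝓘(ℝ, E) γ t
      = (1 : ℝ →L[ℝ] ℝ).smulRight (mulInvariantVectorField (I := 𝓘(ℝ, E)) (G := G) a (γ t)) := by
    refine ContinuousLinearMap.ext_ring ?_
    refine (h t).trans ?_
    exact (one_smul ℝ _).symm
  rwa [h2] at h1

/-- The derivative of a function along an integral curve. -/
lemma IsLeftCurve.hasDerivAt_comp {E' : Type*} [NormedAddCommGroup E'] [NormedSpace ℝ E']
    {a : E} {γ : ℝ → G} (h : IsLeftCurve a γ) {F : G → E'} {t : ℝ}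
    (hF : MDifferentiableAt 𝓘(ℝ, E) 𝓘(ℝ, E') F (γ t)) :
    HasDerivAt (F ∘ γ) (modelDeriv E E' F (γ t) (leftTriv (γ t) a)) t := by
  have h1 : DifferentiableAt ℝ (F ∘ γ) t :=
    mdifferentiableAt_iff_differentiableAt.1 (hF.comp t (h.mdifferentiableAt t))
  have h2 := h1.hasDerivAt
  have h3 := modelDeriv_comp_apply (E := ℝ) (E' := E) (E'' := E') hF (h.mdifferentiableAt t) 1
  rw [modelDeriv_eq_fderiv, fderiv_apply_one_eq_deriv, h.modelDeriv_apply, one_smul] at h3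
  rwa [h3] at h2

lemma IsLeftCurve.map {a b : E} {γ : ℝ → G} (h : IsLeftCurve a γ) {F : G → G}
    (hF : ∀ g, MDifferentiableAt 𝓘(ℝ, E) 𝓘(ℝ, E) F g)
    (hb : ∀ g, modelDeriv E E F g (leftTriv g a) = leftTriv (F g) b) : IsLeftCurve b (F ∘ γ) := by
  refine isLeftCurve_of_modelDeriv (fun t => (hF _).comp t (h.mdifferentiableAt t)) fun t => ?_
  rw [modelDeriv_comp_apply (E' := E) (hF _) (h.mdifferentiableAt t), h.modelDeriv_apply, one_smul, hb]
  rfl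

lemma IsLeftCurve.comp_add {a : E} {γ : ℝ → G} (h : IsLeftCurve a γ) (s : ℝ) :
    IsLeftCurve a (fun t => γ (t + s)) := IsMIntegralCurve.comp_add h s

variable [LieGroup 𝓘(ℝ, E) ∞ G]

lemma contMDiff_leftField (a : GroupLieAlgebra 𝓘(ℝ, E) G) :
    ContMDiff 𝓘(ℝ, E) 𝓘(ℝ, E).tangent 1
      (fun g : G => (mulInvariantVectorField a g : TangentBundle 𝓘(ℝ, E) G)) :=
  (contMDiff_mulInvariantVectorField a).of_le
    (by rw [minSmoothness_of_isRCLikeNormedField]; exact one_le_two)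

lemma IsLeftCurve.mul_left {a : E} {γ : ℝ → G} (h : IsLeftCurve a γ) (g : G) :
    IsLeftCurve a (fun t => g * γ t) :=
  h.map (F := (g * ·)) (mdifferentiableAt_leftMul g) fun _ => modelDeriv_mul_left_leftTriv _ _ _

lemma IsLeftCurve.conj {a : E} {γ : ℝ → G} (h : IsLeftCurve a γ) (g : G) :
    IsLeftCurve (adj g a) (fun t => g * γ t * g⁻¹) :=
  h.map (F := fun z => g * z * g⁻¹) (mdifferentiableAt_conj g) fun _ => modelDeriv_conj_leftTriv _ _ _

/-- Integral curves of left invariant fields are smooth: in a chart, they solve an ordinary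
differential equation with smooth right hand side. -/
lemma IsLeftCurve.contMDiff {a : E} {γ : ℝ → G} (h : IsLeftCurve a γ) :
    ContMDiff 𝓘(ℝ, ℝ) 𝓘(ℝ, E) ∞ γ := by
  intro t₀
  set e := extChartAt 𝓘(ℝ, E) (γ t₀) with he
  have hγ : Continuous γ := continuous_iff_continuousAt.2 fun t => (h.mdifferentiableAt t).continuousAt
  have hopen : IsOpen (γ ⁻¹' e.source) := (isOpen_extChartAt_source (γ t₀)).preimage hγ
  have hd : ∀ t ∈ γ ⁻¹' e.source, HasDerivAt (e ∘ γ) (chartTriv (γ t₀) (e (γ t)) a) t := by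
    intro t ht
    have h1 := h.hasDerivAt_comp (t := t)
      ((contMDiffAt_extChartAt_of_mem ht).mdifferentiableAt (by simp))
    convert h1 using 1
    rw [chartTriv, ← he, e.left_inv ht]
    rfl
  have hsmooth : ∀ n : ℕ, ContDiffOn ℝ n (e ∘ γ) (γ ⁻¹' e.source) := by
    intro n
    induction n with
    | zero =>
      exact contDiffOn_zero.2 fun t ht => (hd t ht).continuousAt.continuousWithinAt
    | succ n ih =>
      push_cast
      refine (contDiffOn_succ_iff_deriv_of_isOpen hopen).2
        ⟨fun t ht => (hd t ht).differentiableAt.differentiableWithinAt, by simp, ?_⟩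
      have h2 : ContDiffOn ℝ n (fun t => chartTriv (γ t₀) ((e ∘ γ) t) a) (γ ⁻¹' e.source) :=
        (((contDiffOn_chartTriv (γ t₀)).of_le (by exact_mod_cast le_top)).comp ih
          fun t ht => e.map_source ht).clm_apply contDiffOn_const
      exact h2.congr fun t ht => (hd t ht).deriv
  have h3 : ContMDiffAt 𝓘(ℝ, ℝ) 𝓘(ℝ, E) ∞ (e ∘ γ) t₀ :=
    (((contDiffOn_infty.2 hsmooth).contDiffAt (hopen.mem_nhds (mem_extChartAt_source _)))).contMDiffAt
  have h4 : ContMDiffAt 𝓘(ℝ, ℝ) 𝓘(ℝ, E) ∞ (e.symm ∘ (e ∘ γ)) t₀ :=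
    (contMDiffAt_extChartAt_symm_of_mem (mem_extChartAt_target (γ t₀))).comp t₀ h3
  refine h4.congr_of_eventuallyEq ?_
  filter_upwards [hopen.mem_nhds (mem_extChartAt_source _)] with t ht
  exact (e.left_inv ht).symm

variable [T2Space G]

lemma IsLeftCurve.eq_of_apply_zero_eq {a : E} {γ γ' : ℝ → G} (h : IsLeftCurve a γ)
    (h' : IsLeftCurve a γ') (h0 : γ 0 = γ' 0) : γ = γ' := by
  have : IsManifold 𝓘(ℝ, E) 1 G := .of_le (n := ∞) (by simp)
  exact isMIntegralCurve_Ioo_eq_of_contMDiff_boundaryless (contMDiff_leftField _) h h' h0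

variable [CompleteSpace E]

lemma exists_isLeftCurve (a : E) : ∃ γ : ℝ → G, γ 0 = 1 ∧ IsLeftCurve a γ := by
  have : IsManifold 𝓘(ℝ, E) 1 G := .of_le (n := ∞) (by simp)
  obtain ⟨γ, h0, hγ⟩ := exists_isMIntegralCurveAt_of_contMDiffAt_boundaryless (I := 𝓘(ℝ, E)) (0 : ℝ)
    (contMDiff_leftField (E := E) (G := G) a).contMDiffAt (x₀ := (1 : G))
  obtain ⟨ε, hε, hγ⟩ := isMIntegralCurveAt_iff'.1 hγ
  refine exists_isMIntegralCurve_of_isMIntegralCurveOn (contMDiff_leftField (E := E) (G := G) a) hε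
    (fun g => ⟨fun t => g * γ t, by simp [h0], fun t ht => ?_⟩) 1
  rw [Real.ball_eq_Ioo, zero_sub, zero_add] at hγ
  have h1 := (mdifferentiableAt_leftMul (E := E) g (γ t)).hasMFDerivAt.comp_hasMFDerivWithinAt t (hγ t ht)
  have h2 : (modelDeriv E E (g * ·) (γ t)).comp ((1 : ℝ →L[ℝ] ℝ).smulRight (leftTriv (γ t) a))
      = (1 : ℝ →L[ℝ] ℝ).smulRight (leftTriv (E := E) (g * γ t) a) := by
    refine ContinuousLinearMap.ext_ring ?_
    simp [modelDeriv_mul_left_leftTriv]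
  exact h2 ▸ h1

/-- The one-parameter group with initial velocity `a`. -/
def oneParam (a : E) : ℝ → G := (exists_isLeftCurve a).choose

lemma oneParam_zero (a : E) : oneParam (G := G) a 0 = 1 := (exists_isLeftCurve a).choose_spec.1

lemma isLeftCurve_oneParam (a : E) : IsLeftCurve a (oneParam (G := G) a) :=
  (exists_isLeftCurve a).choose_spec.2

lemma oneParam_add (a : E) (s t : ℝ) : oneParam (G := G) a (s + t) = oneParam a s * oneParam a t := by
  have h1 := (isLeftCurve_oneParam (G := G) a).comp_add s
  have h2 := (isLeftCurve_oneParam (G := G) a).mul_left (oneParam a s)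
  have h3 := congrFun (h1.eq_of_apply_zero_eq h2 (by simp [oneParam_zero])) t
  rwa [add_comm t] at h3

lemma conj_oneParam (a : E) (g : G) (t : ℝ) :
    g * oneParam a t * g⁻¹ = oneParam (adj g a) t :=
  congrFun (((isLeftCurve_oneParam (G := G) a).conj g).eq_of_apply_zero_eq
    (isLeftCurve_oneParam (G := G) _) (by simp [oneParam_zero])) t

lemma isLieExp_iff (a : GroupLieAlgebra 𝓘(ℝ, E) G) (g : G) : IsLieExp a g ↔ oneParam (E := E) a 1 = g := by
  constructor
  · rintro ⟨γ, h0, hγ, rfl⟩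
    have hγ' : IsLeftCurve (E := E) a γ := hγ
    exact congrFun ((isLeftCurve_oneParam (G := G) (E := E) a).eq_of_apply_zero_eq hγ'
      ((oneParam_zero _).trans h0.symm)) 1
  · rintro rfl
    exact ⟨oneParam (E := E) a, oneParam_zero _, isLeftCurve_oneParam (E := E) a, rfl⟩

variable [FiniteDimensional ℝ E]

lemma adj_oneParam_of_leftBracket_eq_zero {a b : E} (h : leftBracket G a b = 0) (t : ℝ) :
    adj (oneParam (G := G) a t) b = b := by
  have hd : ∀ t, HasDerivAt ((fun g : G => adj g b) ∘ oneParam (G := G) a) 0 t := fun t => by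
    have := (isLeftCurve_oneParam (G := G) a).hasDerivAt_comp
      (mdifferentiable_adj_apply (E := E) b (oneParam (G := G) a t))
    rwa [modelDeriv_adj_apply, h, map_zero] at this
  have h1 := is_const_of_deriv_eq_zero (fun t => (hd t).differentiableAt) (fun t => (hd t).deriv) t 0
  simpa [oneParam_zero, adj_one] using h1

end OneParameter

/-! ### Planes generated by commuting one-parameter groups -/

section PlaneMap

variable {E : Type*} [NormedAddCommGroup E] [NormedSpace ℝ E] [FiniteDimensional ℝ E] [CompleteSpace E]
  {G : Type*} [TopologicalSpace G] [T2Space G] [ChartedSpace E G] [Group G] [LieGroup 𝓘(ℝ, E) ∞ G]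

/-- The linear parametrization of the span of `a` and `b`. -/
def planeVec (a b : E) : ℝ × ℝ →L[ℝ] E :=
  (ContinuousLinearMap.fst ℝ ℝ ℝ).smulRight a + (ContinuousLinearMap.snd ℝ ℝ ℝ).smulRight b

lemma planeVec_apply (a b : E) (v : ℝ × ℝ) : planeVec a b v = v.1 • a + v.2 • b := rfl

lemma planeVec_injective {a b : E} (h : LinearIndependent ℝ ![a, b]) :
    Function.Injective (planeVec a b) := by
  rw [injective_iff_map_eq_zero]
  intro v hv
  have := LinearIndependent.pair_iff.1 h v.1 v.2 hv
  exact Prod.ext this.1 this.2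

variable (G) in
/-- For commuting `a` and `b`, the exponential map on their span, in the coordinates of
`planeVec a b`. -/
def planeMap (a b : E) (v : ℝ × ℝ) : G := oneParam a v.1 * oneParam b v.2

lemma planeMap_zero (a b : E) : planeMap G a b 0 = 1 := by
  simp [planeMap, oneParam_zero]

lemma contMDiff_planeMap (a b : E) : ContMDiff 𝓘(ℝ, ℝ × ℝ) 𝓘(ℝ, E) ∞ (planeMap G a b) := by
  have h1 : ContMDiff 𝓘(ℝ, ℝ × ℝ) 𝓘(ℝ, E) ∞ (fun v : ℝ × ℝ => oneParam (G := G) a v.1) :=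
    (isLeftCurve_oneParam a).contMDiff.comp contDiff_fst.contMDiff
  have h2 : ContMDiff 𝓘(ℝ, ℝ × ℝ) 𝓘(ℝ, E) ∞ (fun v : ℝ × ℝ => oneParam (G := G) b v.2) :=
    (isLeftCurve_oneParam b).contMDiff.comp contDiff_snd.contMDiff
  exact h1.mul h2

variable {a b : E}

lemma leftBracket_self (a : E) : leftBracket G a a = 0 :=
  lie_self (L := GroupLieAlgebra 𝓘(ℝ, E) G) a

lemma leftBracket_skew (a b : E) : leftBracket G a b = - leftBracket G b a :=
  (lie_skew (L := GroupLieAlgebra 𝓘(ℝ, E) G) a b).symm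

lemma adj_planeMap (h : leftBracket G a b = 0) (v w : ℝ × ℝ) :
    adj (planeMap G a b v) (planeVec a b w) = planeVec a b w := by
  have h' : leftBracket G b a = 0 := by rw [leftBracket_skew, h, neg_zero]
  have ha : adj (planeMap G a b v) a = a := by
    rw [planeMap, adj_mul, mul_apply_eq_comp, adj_oneParam_of_leftBracket_eq_zero h',
      adj_oneParam_of_leftBracket_eq_zero (leftBracket_self a)]
  have hb : adj (planeMap G a b v) b = b := by
    rw [planeMap, adj_mul, mul_apply_eq_comp,
      adj_oneParam_of_leftBracket_eq_zero (leftBracket_self b), adj_oneParam_of_leftBracket_eq_zero h]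
  rw [planeVec_apply, map_add, map_smul, map_smul, ha, hb]

lemma planeMap_add (h : leftBracket G a b = 0) (v w : ℝ × ℝ) :
    planeMap G a b (v + w) = planeMap G a b v * planeMap G a b w := by
  have hc : oneParam (G := G) a w.1 * oneParam b v.2 = oneParam b v.2 * oneParam a w.1 := by
    have := conj_oneParam b (oneParam (G := G) a w.1) v.2
    rw [adj_oneParam_of_leftBracket_eq_zero h] at this
    exact mul_inv_eq_iff_eq_mul.1 this
  simp only [planeMap, Prod.fst_add, Prod.snd_add, oneParam_add]
  calc _ = oneParam (G := G) a v.1 * (oneParam a w.1 * oneParam b v.2) * oneParam b w.2 := by group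
    _ = _ := by rw [hc]; group

lemma planeMap_neg (h : leftBracket G a b = 0) (v : ℝ × ℝ) :
    planeMap G a b (-v) = (planeMap G a b v)⁻¹ := by
  rw [eq_inv_iff_mul_eq_one, ← planeMap_add h, neg_add_cancel, planeMap_zero]

lemma modelDeriv_mul_planeMap (h : leftBracket G a b = 0) (g : G) (v w : ℝ × ℝ) :
    modelDeriv (ℝ × ℝ) E (fun z => g * planeMap G a b z) v w
      = leftTriv (g * planeMap G a b v) (planeVec a b w) := by
  have hd : ∀ z, MDifferentiableAt 𝓘(ℝ, ℝ × ℝ) 𝓘(ℝ, E) (fun z => g * planeMap G a b z) z := fun z =>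
    ((contMDiff_const.mul (contMDiff_planeMap a b)).contMDiffAt (x := z)).mdifferentiableAt (by simp)
  have key : ∀ (u : ℝ × ℝ) (c : E) (γ : ℝ → G), IsLeftCurve c γ → γ 0 = 1 →
      (∀ t, planeMap G a b (t • u) = γ t) →
      modelDeriv (ℝ × ℝ) E (fun z => g * planeMap G a b z) v u = leftTriv (g * planeMap G a b v) c := by
    intro u c γ hγ h0 hu
    have h1 : (fun z => g * planeMap G a b z) ∘ (fun t : ℝ => v + t • u)
        = fun t => (g * planeMap G a b v) * γ t := by
      ext t
      rw [Function.comp_apply, planeMap_add h, hu, mul_assoc]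
    have hl : HasDerivAt (fun t : ℝ => v + t • u) u 0 := by
      simpa using ((hasDerivAt_id (0 : ℝ)).smul_const u).const_add v
    have h2 := modelDeriv_comp_apply (E := ℝ) (E' := ℝ × ℝ) (E'' := E) (x := (0 : ℝ))
      (f := fun t : ℝ => v + t • u) (hd _) hl.differentiableAt.mdifferentiableAt 1
    rw [h1, (hγ.mul_left _).modelDeriv_apply, one_smul, h0, mul_one, modelDeriv_eq_fderiv,
      fderiv_apply_one_eq_deriv, hl.deriv, zero_smul, add_zero] at h2
    exact h2.symm
  have ha := key (1, 0) a _ (isLeftCurve_oneParam a) (oneParam_zero a)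
    (fun t => by simp [planeMap, oneParam_zero])
  have hb := key (0, 1) b _ (isLeftCurve_oneParam b) (oneParam_zero b)
    (fun t => by simp [planeMap, oneParam_zero])
  have hw : w = w.1 • ((1, 0) : ℝ × ℝ) + w.2 • ((0, 1) : ℝ × ℝ) := by ext <;> simp
  conv_lhs => rw [hw]
  rw [map_add, map_smul, map_smul, ha, hb, planeVec_apply, map_add, map_smul, map_smul]

/-- Lines of the plane are integral curves. -/
lemma isLeftCurve_planeMap_line (h : leftBracket G a b = 0) (g : G) (v w : ℝ × ℝ) :
    IsLeftCurve (planeVec a b w) (fun t : ℝ => g * planeMap G a b (v + t • w)) := by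
  have hd : ∀ z, MDifferentiableAt 𝓘(ℝ, ℝ × ℝ) 𝓘(ℝ, E) (fun z => g * planeMap G a b z) z := fun z =>
    ((contMDiff_const.mul (contMDiff_planeMap a b)).contMDiffAt (x := z)).mdifferentiableAt (by simp)
  have hl : ∀ t, HasDerivAt (fun t : ℝ => v + t • w) w t := fun t => by
    simpa using ((hasDerivAt_id t).smul_const w).const_add v
  refine isLeftCurve_of_modelDeriv
    (fun t => (hd _).comp t (hl t).differentiableAt.mdifferentiableAt) fun t => ?_
  have h2 := modelDeriv_comp_apply (E := ℝ) (E' := ℝ × ℝ) (E'' := E) (x := t)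
      (f := fun t : ℝ => v + t • w) (hd _) (hl t).differentiableAt.mdifferentiableAt 1
  rw [modelDeriv_mul_planeMap h, modelDeriv_eq_fderiv, fderiv_apply_one_eq_deriv, (hl t).deriv] at h2
  exact h2

lemma oneParam_planeVec (h : leftBracket G a b = 0) (v : ℝ × ℝ) :
    oneParam (planeVec a b v) 1 = planeMap G a b v := by
  have h1 := isLeftCurve_planeMap_line h (1 : G) 0 v
  have h2 := congrFun ((isLeftCurve_oneParam (G := G) (planeVec a b v)).eq_of_apply_zero_eq h1
    (by simp [oneParam_zero, planeMap_zero])) 1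
  simpa using h2

lemma lieExpImage_span_pair (x y : GroupLieAlgebra 𝓘(ℝ, E) G) (h : leftBracket (E := E) G x y = 0) :
    lieExpImage (Submodule.span ℝ {x, y}) = range (planeMap (E := E) G x y) := by
  ext g
  constructor
  · rintro ⟨v, hv, hg⟩
    obtain ⟨s, t, rfl⟩ := Submodule.mem_span_pair.1 hv
    refine ⟨(s, t), ?_⟩
    rw [← oneParam_planeVec h]
    exact (isLieExp_iff _ _).1 hg
  · rintro ⟨v, rfl⟩
    refine ⟨v.1 • x + v.2 • y, Submodule.mem_span_pair.2 ⟨_, _, rfl⟩, (isLieExp_iff _ _).2 ?_⟩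
    exact oneParam_planeVec h v

/-- The logarithm is affine on the plane. -/
lemma log_planeMap (h : leftBracket G a b = 0) {m : ℕ} (hm : m ≠ 0) {F : G → E}
    (hF : MDifferentiable 𝓘(ℝ, E) 𝓘(ℝ, E) F)
    (hFd : ∀ g a, modelDeriv E E F g (leftTriv g a) = unipLogDeriv m (adj g) a) (v : ℝ × ℝ) :
    F (planeMap G a b v) = F 1 + planeVec a b v := by
  have hγ := isLeftCurve_planeMap_line h (1 : G) 0 v
  have hd : ∀ t : ℝ, HasDerivAt (fun t : ℝ => F (planeMap G a b (t • v)) - t • planeVec a b v) 0 t := by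
    intro t
    have h1 := hγ.hasDerivAt_comp (hF (1 * planeMap G a b (0 + t • v)))
    rw [hFd, one_mul, unipLogDeriv_apply_of_apply_eq hm (adj_planeMap h _ _)] at h1
    simp only [one_mul, zero_add] at h1
    have h2 := h1.sub ((hasDerivAt_id t).smul_const (planeVec a b v))
    rw [one_smul, sub_self] at h2
    exact h2
  have := is_const_of_deriv_eq_zero (fun t => (hd t).differentiableAt) (fun t => (hd t).deriv) 1 0
  simp only [one_smul, zero_smul, planeMap_zero, sub_zero] at this
  rw [← this]
  abel

/-- The plane is properly embedded, as the logarithm provides a continuous left inverse. -/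
lemma isClosedEmbedding_planeMap [SimplyConnectedSpace G] (h : leftBracket G a b = 0)
    (hab : LinearIndependent ℝ ![a, b]) {m : ℕ} (hm : ∀ g : G, (adj (E := E) g - 1) ^ m = 0) :
    IsClosedEmbedding (planeMap G a b) := by
  have hm' : ∀ g : G, (adj (E := E) g - 1) ^ (m + 1) = 0 := fun g => by rw [pow_succ, hm, zero_mul]
  obtain ⟨F, hF, hFd⟩ := exists_log hm'
  obtain ⟨L, hL⟩ := LinearMap.exists_leftInverse_of_injective (planeVec a b).toLinearMap
    (LinearMap.ker_eq_bot.2 (planeVec_injective hab))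
  have hLc : Continuous L := L.continuous_of_finiteDimensional
  refine Function.LeftInverse.isClosedEmbedding (f := fun g => L (F g - F 1)) (fun v => ?_)
    (hLc.comp (hF.continuous.sub continuous_const)) (contMDiff_planeMap a b).continuous
  show L (F (planeMap G a b v) - F 1) = v
  rw [log_planeMap h m.succ_ne_zero hF hFd, add_sub_cancel_left]
  exact LinearMap.congr_fun hL v

lemma isClosedEmbedding_mul_planeMap [SimplyConnectedSpace G] (h : leftBracket G a b = 0)
    (hab : LinearIndependent ℝ ![a, b]) {m : ℕ} (hm : ∀ g : G, (adj (E := E) g - 1) ^ m = 0) (g : G) :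
    IsClosedEmbedding fun v => g * planeMap G a b v := by
  have := topologicalGroup_of_lieGroup 𝓘(ℝ, E) ∞ (G := G)
  exact (Homeomorph.mulLeft g).isClosedEmbedding.comp (isClosedEmbedding_planeMap h hab hm)

end PlaneMap

/-! ### Geodesics of a left invariant metric -/

section Geodesics

variable {E : Type*} [NormedAddCommGroup E] [NormedSpace ℝ E]
  {G : Type*} [TopologicalSpace G] [ChartedSpace E G] [Group G]
  [RiemannianBundle (fun p : G => TangentSpace 𝓘(ℝ, E) p)]

variable (G) in
/-- The metric on the tangent space at the identity, as a bilinear form on the model space. -/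
def innerOne : E →ₗ[ℝ] E →ₗ[ℝ] ℝ :=
  show TangentSpace 𝓘(ℝ, E) (1 : G) →ₗ[ℝ] TangentSpace 𝓘(ℝ, E) (1 : G) →ₗ[ℝ] ℝ from
    innerₗ (TangentSpace 𝓘(ℝ, E) (1 : G))

lemma innerOne_comm (a b : E) : innerOne G a b = innerOne G b a :=
  real_inner_comm (F := TangentSpace 𝓘(ℝ, E) (1 : G)) b a

lemma innerOne_self_nonneg (a : E) : 0 ≤ innerOne G a a :=
  real_inner_self_nonneg (F := TangentSpace 𝓘(ℝ, E) (1 : G)) (x := a)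

lemma innerOne_self_eq_zero {a : E} : innerOne G a a = 0 ↔ a = 0 :=
  inner_self_eq_zero (𝕜 := ℝ) (E := TangentSpace 𝓘(ℝ, E) (1 : G)) (x := a)

lemma inner_leftTriv (hinv : IsLeftInvariantMetric E G) (g : G) (a b : E) :
    inner ℝ (E := TangentSpace 𝓘(ℝ, E) g) (leftTriv (E := E) g a) (leftTriv (E := E) g b)
      = innerOne G a b := by
  have h := hinv g 1 a b
  have : ∀ (g h : G), g = h → ∀ u v : E, inner ℝ (E := TangentSpace 𝓘(ℝ, E) g) u v
      = inner ℝ (E := TangentSpace 𝓘(ℝ, E) h) u v := by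
    rintro g _ rfl u v; rfl
  rw [this g (g * 1) (mul_one g).symm]
  exact h

/-- On vectors of left invariant fields, a pullback of a left invariant metric is the metric at the
identity. -/
lemma pullbackMetric_eq_innerOne (hinv : IsLeftInvariantMetric E G) {F : Type*}
    [NormedAddCommGroup F] [NormedSpace ℝ F] {φ : F → G} {x v w : F} {a b : E}
    (hv : modelDeriv F E φ x v = leftTriv (φ x) a) (hw : modelDeriv F E φ x w = leftTriv (φ x) b) :
    pullbackMetric (E := E) φ x v w = innerOne G a b := by
  rw [← inner_leftTriv hinv (φ x) a b, ← hv, ← hw]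
  rfl

lemma norm_eq_one_of_leftTriv (hinv : IsLeftInvariantMetric E G) {g : G} {a : E}
    (ha : innerOne G a a = 1) : ‖(show TangentSpace 𝓘(ℝ, E) g from leftTriv (E := E) g a)‖ = 1 := by
  have h := inner_leftTriv hinv g a a
  rw [ha] at h
  have h2 := real_inner_self_eq_norm_sq (F := TangentSpace 𝓘(ℝ, E) g) (leftTriv (E := E) g a)
  rw [h] at h2
  exact (pow_eq_one_iff_of_nonneg (norm_nonneg _) two_ne_zero).1 h2.symm

variable [FiniteDimensional ℝ E] [CompleteSpace E] [LieGroup 𝓘(ℝ, E) ∞ G]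

/-- The metric in the chart around `p`. -/
lemma pullbackMetric_extChartAt_symm (hinv : IsLeftInvariantMetric E G) {p : G} {y : E}
    (hy : y ∈ (extChartAt 𝓘(ℝ, E) p).target) (v w : E) :
    pullbackMetric (E := E) (extChartAt 𝓘(ℝ, E) p).symm y v w
      = innerOne G (Ring.inverse (chartTriv p y) v) (Ring.inverse (chartTriv p y) w) := by
  have hu : IsUnit (chartTriv (E := E) p y) :=
    ContinuousLinearMap.isUnit_iff_bijective.2 (chartTriv_bijective hy)
  have key : ∀ v : E, modelDeriv E E (extChartAt 𝓘(ℝ, E) p).symm y v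
      = leftTriv ((extChartAt 𝓘(ℝ, E) p).symm y) (Ring.inverse (chartTriv p y) v) := by
    intro v
    have h1 : chartTriv p y (Ring.inverse (chartTriv p y) v) = v :=
      DFunLike.congr_fun (Ring.mul_inverse_cancel _ hu) v
    conv_lhs => rw [← h1]
    exact DFunLike.congr_fun (modelDeriv_symm_comp_extChartAt hy) _
  exact pullbackMetric_eq_innerOne hinv (key v) (key w)

/-- The Koszul formula: a curve with constant velocity `u` in the left trivialization is a geodesic
if `[u, E]` is orthogonal to `u`. -/
lemma geodesicEqAt_of_leftTriv (hinv : IsLeftInvariantMetric E G) {γ : ℝ → G} {u : ℝ → E} {t : ℝ}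
    (hγ : ∀ᶠ s in 𝓝 t, MDifferentiableAt 𝓘(ℝ, ℝ) 𝓘(ℝ, E) γ s ∧
      modelDeriv ℝ E γ s 1 = leftTriv (γ s) (u s))
    (hu : HasDerivAt u 0 t) (hperp : ∀ w, innerOne G (u t) (leftBracket G (u t) w) = 0) :
    GeodesicEqAt (pullbackMetric (E := E) (extChartAt 𝓘(ℝ, E) (γ t)).symm)
      (extChartAt 𝓘(ℝ, E) (γ t) ∘ γ) t := by
  set e := extChartAt 𝓘(ℝ, E) (γ t) with he
  set T : E → E →L[ℝ] E := chartTriv (γ t) with hT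
  set S : E → E →L[ℝ] E := fun y => Ring.inverse (T y) with hS
  set x := e (γ t) with hx
  have hxt : x ∈ e.target := mem_extChartAt_target (γ t)
  have hnt : e.target ∈ 𝓝 x := (isOpen_extChartAt_target (γ t)).mem_nhds hxt
  have hTd : DifferentiableAt ℝ T x :=
    ((contDiffOn_chartTriv (γ t)).contDiffAt hnt).differentiableAt (by simp)
  have hTu : ∀ y ∈ e.target, IsUnit (T y) := fun y hy =>
    ContinuousLinearMap.isUnit_iff_bijective.2 (chartTriv_bijective hy)
  have hSd : DifferentiableAt ℝ S x :=
    DifferentiableAt.comp (g := Ring.inverse) x (differentiableAt_inverse (hTu x hxt)) hTd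
  have hST : ∀ y ∈ e.target, ∀ a, S y (T y a) = a := fun y hy a =>
    DFunLike.congr_fun (Ring.inverse_mul_cancel _ (hTu y hy)) a
  set D : E → E → E := fun a w => fderiv ℝ (fun y => T y a) x w with hD
  have hDd : ∀ a, HasFDerivAt (fun y => T y a) (fderiv ℝ (fun y => T y a) x) x := fun a =>
    (hTd.clm_apply (differentiableAt_const a)).hasFDerivAt
  have hdS : ∀ a w, fderiv ℝ S x w (T x a) = - S x (D a w) := by
    intro a w
    have h1 : (fun y => S y (T y a)) =ᶠ[𝓝 x] fun _ => a := by
      filter_upwards [hnt] with y hy using hST y hy a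
    have h2 := (hSd.hasFDerivAt.clm_apply (hDd a)).fderiv
    rw [h1.fderiv_eq, fderiv_const_apply] at h2
    have h3 := DFunLike.congr_fun h2 w
    simp only [zero_apply, add_apply, ContinuousLinearMap.comp_apply,
      ContinuousLinearMap.flip_apply] at h3
    rw [eq_neg_iff_add_eq_zero, add_comm]
    exact h3.symm
  -- the velocity and the acceleration in the chart
  have hγc : ContinuousAt γ t := hγ.self_of_nhds.1.continuousAt
  have hvel : ∀ᶠ s in 𝓝 t, HasDerivAt (e ∘ γ) (T (e (γ s)) (u s)) s := by
    filter_upwards [hγ, hγc (extChartAt_source_mem_nhds (I := 𝓘(ℝ, E)) (γ t))] with s hs hse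
    have hed := (contMDiffAt_extChartAt_of_mem (E := E) (p := γ t) hse).mdifferentiableAt (by simp)
    have h1 : DifferentiableAt ℝ (e ∘ γ) s := mdifferentiableAt_iff_differentiableAt.1 (hed.comp s hs.1)
    have h3 := modelDeriv_comp_apply (E := ℝ) (E' := E) (E'' := E) hed hs.1 1
    rw [modelDeriv_eq_fderiv, fderiv_apply_one_eq_deriv, hs.2] at h3
    have h4 := h1.hasDerivAt
    rw [h3] at h4
    convert h4 using 1
    rw [hT, chartTriv, ← he, e.left_inv hse]
    rfl
  have hv : deriv (e ∘ γ) t = T x (u t) := hvel.self_of_nhds.deriv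
  have hacc : deriv (deriv (e ∘ γ)) t = D (u t) (T x (u t)) := by
    have h1 : deriv (e ∘ γ) =ᶠ[𝓝 t] fun s => T ((e ∘ γ) s) (u s) := by
      filter_upwards [hvel] with s hs using hs.deriv
    rw [h1.deriv_eq]
    have h0 : HasDerivAt (e ∘ γ) (T x (u t)) t := hvel.self_of_nhds
    have h1 : HasDerivAt (T ∘ (e ∘ γ)) (fderiv ℝ T x (T x (u t))) t :=
      HasFDerivAt.comp_hasDerivAt (f := e ∘ γ) (l := T) t hTd.hasFDerivAt h0
    have h2 : HasDerivAt (fun s => T ((e ∘ γ) s) (u s))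
        (fderiv ℝ T x (T x (u t)) (u t) + T x 0) t := h1.clm_apply hu
    have h3 : HasFDerivAt (fun y => T y (u t)) ((fderiv ℝ T x).flip (u t)) x := by
      simpa using hTd.hasFDerivAt.clm_apply (hasFDerivAt_const (u t) x)
    rw [h2.deriv, map_zero, add_zero]
    simp only [hD, h3.fderiv, ContinuousLinearMap.flip_apply]
  -- the derivative of the metric in the chart
  have hdg : ∀ a b w, fderiv ℝ (fun y => pullbackMetric (E := E) e.symm y (T x a) (T x b)) x w
      = - innerOne G (S x (D a w)) b - innerOne G a (S x (D b w)) := by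
    intro a b w
    have h1 : (fun y => pullbackMetric (E := E) e.symm y (T x a) (T x b))
        =ᶠ[𝓝 x] fun y => innerOne G (S y (T x a)) (S y (T x b)) := by
      filter_upwards [hnt] with y hy using pullbackMetric_extChartAt_symm hinv hy _ _
    set B : E →L[ℝ] E →L[ℝ] ℝ := LinearMap.toContinuousLinearMap
      ((LinearMap.toContinuousLinearMap : (E →ₗ[ℝ] ℝ) ≃ₗ[ℝ] (E →L[ℝ] ℝ)).toLinearMap.comp (innerOne G))
      with hB
    have hBe : ∀ a b, innerOne G a b = B a b := fun _ _ => rfl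
    have h2 : ∀ a, HasFDerivAt (fun y => S y (T x a)) ((fderiv ℝ S x).flip (T x a)) x := fun a => by
      simpa using hSd.hasFDerivAt.clm_apply (hasFDerivAt_const (T x a) x)
    have h3 := ((B.hasFDerivAt.comp x (h2 a)).clm_apply (h2 b)).fderiv
    rw [h1.fderiv_eq]
    refine (DFunLike.congr_fun h3 w).trans ?_
    simp only [add_apply, ContinuousLinearMap.comp_apply,
      ContinuousLinearMap.flip_apply, Function.comp_apply, hdS, hST x hxt, hBe, map_neg, neg_apply]
    ring
  intro w
  obtain ⟨b, rfl⟩ := (chartTriv_bijective hxt).2 w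
  have hmet : ∀ v, pullbackMetric (E := E) e.symm x v (T x b) = innerOne G (S x v) b := fun v => by
    rw [pullbackMetric_extChartAt_symm hinv hxt]
    exact congrArg _ (hST x hxt b)
  have hbr := lieBracket_chartTriv (G := G) hxt (u t) b
  have hS0 := hST x hxt (leftBracket G (u t) b)
  rw [hT, ← hbr, VectorField.lieBracket, map_sub, ← hT] at hS0
  have hp := hperp b
  rw [← hS0, map_sub] at hp
  show pullbackMetric (E := E) e.symm x (deriv (deriv (e ∘ γ)) t) (T x b)
    + christoffelFirst _ x (deriv (e ∘ γ) t) (deriv (e ∘ γ) t) (T x b) = 0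
  rw [hv, hacc, christoffelFirst, hmet, hdg, hdg, innerOne_comm (S x _) (u t)]
  have hp' : innerOne G (u t) (S x (D b (T x (u t)))) - innerOne G (u t) (S x (D (u t) (T x b))) = 0 :=
    hp
  linarith

end Geodesics

/-! ### The Euclidean plane cover -/

section PlaneCover

variable {E : Type*} [NormedAddCommGroup E] [NormedSpace ℝ E] [FiniteDimensional ℝ E] [CompleteSpace E]
  {G : Type*} [TopologicalSpace G] [T2Space G] [ChartedSpace E G] [Group G] [LieGroup 𝓘(ℝ, E) ∞ G]
  [RiemannianBundle (fun p : G => TangentSpace 𝓘(ℝ, E) p)]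

variable (G) in
/-- Commuting orthonormal elements `a` and `b` of the Lie algebra such that the vectors `v` of
their span are orthogonal to `[v, E]`, so that their one-parameter groups are geodesics. -/
structure IsFlatPair (a b : E) : Prop where
  bracket_eq_zero : leftBracket G a b = 0
  inner_left : innerOne G a a = 1
  inner_right : innerOne G b b = 1
  inner_eq_zero : innerOne G a b = 0
  inner_bracket : ∀ v w, innerOne G (planeVec a b v) (leftBracket G (planeVec a b v) w) = 0

variable {a b : E}

lemma IsFlatPair.inner_planeVec (h : IsFlatPair G a b) (v w : ℝ × ℝ) :
    innerOne G (planeVec a b v) (planeVec a b w) = v.1 * w.1 + v.2 * w.2 := by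
  simp only [planeVec_apply, map_add, map_smul, LinearMap.add_apply, LinearMap.smul_apply,
    h.inner_left, h.inner_right, h.inner_eq_zero, innerOne_comm b a, smul_eq_mul]
  ring

lemma IsFlatPair.linearIndependent (h : IsFlatPair G a b) : LinearIndependent ℝ ![a, b] := by
  refine LinearIndependent.pair_iff.2 fun s t hst => ?_
  have h1 := h.inner_planeVec (s, t) (s, t)
  rw [planeVec_apply, hst, map_zero] at h1
  constructor <;> nlinarith

lemma IsFlatPair.pullbackMetric_eq (h : IsFlatPair G a b) (hinv : IsLeftInvariantMetric E G) (g : G) :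
    pullbackMetric (E := E) (fun z => g * planeMap G a b z) = fun _ v w => v.1 * w.1 + v.2 * w.2 := by
  ext x v w
  rw [← h.inner_planeVec]
  exact pullbackMetric_eq_innerOne hinv (modelDeriv_mul_planeMap h.bracket_eq_zero g x v)
    (modelDeriv_mul_planeMap h.bracket_eq_zero g x w)

lemma contMDiff_mul_planeMap (g : G) (a b : E) :
    ContMDiff 𝓘(ℝ, ℝ × ℝ) 𝓘(ℝ, E) ∞ (fun z => g * planeMap G a b z) :=
  contMDiff_const.mul (contMDiff_planeMap a b)

lemma IsFlatPair.isTotallyGeodesicParam (h : IsFlatPair G a b) (hinv : IsLeftInvariantMetric E G)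
    (g : G) : IsTotallyGeodesicParam (E := E) (fun z => g * planeMap G a b z) := by
  intro c s₁ s₂ _ hc hgeo
  refine ⟨(contMDiff_mul_planeMap g a b).comp_contMDiffOn hc.contMDiffOn, fun t ht => ?_⟩
  have hc0 : ∀ t ∈ Ioo s₁ s₂, deriv (deriv c) t = 0 := by
    intro t ht
    have h0 := hgeo t ht (deriv (deriv c) t)
    rw [h.pullbackMetric_eq hinv] at h0
    simp only [christoffelFirst, fderiv_fun_const, Pi.zero_apply, zero_apply] at h0
    ext <;> simp <;> nlinarith
  have hnt : Ioo s₁ s₂ ∈ 𝓝 t := isOpen_Ioo.mem_nhds ht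
  have hcd : ∀ s ∈ Ioo s₁ s₂, DifferentiableAt ℝ c s := fun s hs =>
    (hc.contDiffAt (isOpen_Ioo.mem_nhds hs)).differentiableAt (by simp)
  have hcd2 : HasDerivAt (deriv c) 0 t := by
    rw [← hc0 t ht]
    have h1 : ContDiffOn ℝ ∞ (deriv c) (Ioo s₁ s₂) := hc.deriv_of_isOpen isOpen_Ioo (by simp)
    exact ((h1.contDiffAt hnt).differentiableAt (by simp)).hasDerivAt
  have hφ : ∀ z, MDifferentiableAt 𝓘(ℝ, ℝ × ℝ) 𝓘(ℝ, E) (fun z => g * planeMap G a b z) z := fun z =>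
    (contMDiff_mul_planeMap g a b).contMDiffAt.mdifferentiableAt (by simp)
  refine geodesicEqAt_of_leftTriv (u := fun s => planeVec a b (deriv c s)) hinv ?_ ?_ ?_
  · filter_upwards [hnt] with s hs
    refine ⟨(hφ _).comp s (hcd s hs).mdifferentiableAt, ?_⟩
    rw [modelDeriv_comp_apply (E' := ℝ × ℝ) (hφ _) (hcd s hs).mdifferentiableAt,
      modelDeriv_mul_planeMap h.bracket_eq_zero, modelDeriv_eq_fderiv, fderiv_apply_one_eq_deriv]
    rfl
  · have h1 := (planeVec a b).hasFDerivAt.comp_hasDerivAt t hcd2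
    rw [map_zero] at h1
    exact h1
  · exact h.inner_bracket _

lemma IsFlatPair.isPlaneOfCurvature_zero [SimplyConnectedSpace G] (h : IsFlatPair G a b)
    (hinv : IsLeftInvariantMetric E G) {m : ℕ} (hm : ∀ g : G, (adj (E := E) g - 1) ^ m = 0) (g : G) :
    IsPlaneOfCurvature E 0 (range fun z => g * planeMap G a b z) := by
  refine ⟨_, rfl, contMDiff_mul_planeMap g a b, fun v => ?_,
    isClosedEmbedding_mul_planeMap h.bracket_eq_zero h.linearIndependent hm g,
    h.isTotallyGeodesicParam hinv g, fun v => ?_⟩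
  · have h1 : ∀ w, modelDeriv (ℝ × ℝ) E (fun z => g * planeMap G a b z) v w
        = leftTriv (g * planeMap G a b v) (planeVec a b w) :=
      modelDeriv_mul_planeMap h.bracket_eq_zero g v
    have h2 : Function.Injective (modelDeriv (ℝ × ℝ) E (fun z => g * planeMap G a b z) v) := by
      intro w w' hw
      rw [h1, h1] at hw
      refine planeVec_injective h.linearIndependent (Function.LeftInverse.injective
        (g := modelDeriv E E ((g * planeMap G a b v)⁻¹ * ·) (g * planeMap G a b v)) (fun c => ?_) hw)
      exact DFunLike.congr_fun (leftTriv_inv_comp (g * planeMap G a b v)) c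
    exact h2
  · rw [h.pullbackMetric_eq hinv]
    simp [gaussCurvature, Matrix.det_fin_three]

lemma IsFlatPair.hasTranslatedEuclideanPlaneCover [SimplyConnectedSpace G]
    {x y : GroupLieAlgebra 𝓘(ℝ, E) G} (h : IsFlatPair (E := E) G x y)
    (hinv : IsLeftInvariantMetric E G) {m : ℕ} (hm : ∀ g : G, (adj (E := E) g - 1) ^ m = 0) :
    HasTranslatedEuclideanPlaneCover E G := by
  have hr : ∀ g : G, g • lieExpImage (Submodule.span ℝ {x, y})
      = range fun z => g * planeMap (E := E) G x y z := fun g => by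
    rw [lieExpImage_span_pair x y h.bracket_eq_zero]
    ext p
    simp [mem_smul_set]
  have hp : ∀ S ∈ range (fun g : G => g • lieExpImage (Submodule.span ℝ {x, y})),
      IsPlaneOfCurvature E 0 S := by
    rintro _ ⟨g, rfl⟩
    simp only [hr]
    exact h.isPlaneOfCurvature_zero hinv hm g
  refine ⟨x, y, h.linearIndependent, h.bracket_eq_zero, ⟨fun S hS => ⟨0, le_rfl, hp S hS⟩, ?_⟩, hp⟩
  refine eq_univ_of_forall fun g => mem_sUnion.2 ⟨_, ⟨g, rfl⟩, ?_⟩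
  simp only [hr]
  exact ⟨0, (congrArg (g * ·) (planeMap_zero (E := E) (G := G) x y)).trans (mul_one g)⟩

/-- The lines of the planes are escaping geodesics. -/
lemma IsFlatPair.isEscapingGeodesic [SimplyConnectedSpace G] (h : IsFlatPair G a b)
    (hinv : IsLeftInvariantMetric E G) {m : ℕ} (hm : ∀ g : G, (adj (E := E) g - 1) ^ m = 0) (g : G)
    (v w : ℝ × ℝ) (hw : w.1 ^ 2 + w.2 ^ 2 = 1) :
    IsEscapingGeodesic (E := E) (fun t : ℝ => g * planeMap G a b (v + t • w)) := by
  have hγ := isLeftCurve_planeMap_line h.bracket_eq_zero g v w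
  refine ⟨⟨hγ.contMDiff.contMDiffOn, fun t _ => ?_⟩, fun t => ?_, fun K hK => ?_⟩
  · exact geodesicEqAt_of_leftTriv (γ := fun t : ℝ => g * planeMap G a b (v + t • w))
      (u := fun _ => planeVec a b w) (t := t) hinv
      (Eventually.of_forall fun s => ⟨hγ.mdifferentiableAt s, by rw [hγ.modelDeriv_apply, one_smul]⟩)
      (hasDerivAt_const _ _) (h.inner_bracket w)
  · have h1 := hγ.modelDeriv_apply t 1
    rw [one_smul] at h1
    have h2 := norm_eq_one_of_leftTriv hinv (g := g * planeMap G a b (v + t • w))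
      (a := planeVec a b w) (by rw [h.inner_planeVec, ← hw]; ring)
    rw [← h1] at h2
    exact h2
  · have hc := (isClosedEmbedding_mul_planeMap h.bracket_eq_zero h.linearIndependent hm g).isCompact_preimage hK
    have hw0 : w ≠ 0 := by
      rintro rfl
      simp at hw
    obtain ⟨R, hR⟩ := hc.isBounded.exists_norm_le
    have hwn : 0 < ‖w‖ := norm_pos_iff.2 hw0
    refine ⟨(|R| + ‖v‖ + 1) / ‖w‖, by positivity, fun t ht hK => ?_⟩
    rw [div_le_iff₀ hwn] at ht
    have h1 := hR (v + t • w) hK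
    have h2 : ‖t • w‖ ≤ ‖v + t • w‖ + ‖v‖ := by
      simpa using norm_sub_le (v + t • w) v
    rw [norm_smul, Real.norm_eq_abs] at h2
    linarith [le_abs_self R]

end PlaneCover

/-! ### The support theorem -/

section SupportTheorem

open Manifold in
lemma riemannianDiam_le_of_forall {E : Type*} [NormedAddCommGroup E] [NormedSpace ℝ E]
    {M : Type*} [TopologicalSpace M] [ChartedSpace E M] [IsManifold 𝓘(ℝ, E) 1 M]
    [RiemannianBundle (fun p : M => TangentSpace 𝓘(ℝ, E) p)] {S : Set M} {p : M} {ε : ℝ≥0∞}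
    (h : ∀ q ∈ S, riemannianEDist 𝓘(ℝ, E) p q ≤ ε) : riemannianDiam E S ≤ 2 * ε := by
  refine iSup₂_le fun x hx => iSup₂_le fun y hy => ?_
  refine riemannianEDist_triangle.trans ((add_le_add ?_ (h y hy)).trans (two_mul ε).ge)
  rw [riemannianEDist_comm]
  exact h x hx

variable {E : Type*} [NormedAddCommGroup E] [NormedSpace ℝ E] [FiniteDimensional ℝ E] [CompleteSpace E]
  {G : Type*} [TopologicalSpace G] [T2Space G] [ChartedSpace E G] [Group G] [LieGroup 𝓘(ℝ, E) ∞ G]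

/-- The closed Euclidean disc of radius `r` around the origin. -/
def planeDisc (r : ℝ) : Set (ℝ × ℝ) := {v | v.1 ^ 2 + v.2 ^ 2 ≤ r ^ 2}

lemma isCompact_planeDisc (r : ℝ) : IsCompact (planeDisc r) := by
  refine Metric.isCompact_of_isClosed_isBounded (isClosed_le (by fun_prop) continuous_const) ?_
  refine (Metric.isBounded_closedBall (x := (0 : ℝ × ℝ)) (r := |r|)).subset fun v hv => ?_
  have hv' : v.1 ^ 2 + v.2 ^ 2 ≤ r ^ 2 := hv
  rw [mem_closedBall_zero_iff, Prod.norm_def, max_le_iff]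
  exact ⟨sq_le_sq.1 (by nlinarith [sq_nonneg v.2]), sq_le_sq.1 (by nlinarith [sq_nonneg v.1])⟩

/-- The largest Euclidean length of a vector of the plane that translates some point of `K` into
`K`, where `planeMap` identifies vectors and translations; it is `0` for empty `K`. -/
def planeRadius (a b : E) (K : Set G) : ℝ :=
  sSup ((fun v : ℝ × ℝ => √(v.1 ^ 2 + v.2 ^ 2)) '' (planeMap G a b ⁻¹' (K⁻¹ * K)))

/-- The set of the points at distance at most `planeRadius a b K` from `K` within the translates of
the plane. -/
def planeHull (a b : E) (K : Set G) : Set G :=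
  K * planeMap G a b '' planeDisc (planeRadius a b K)

variable {a b : E}

lemma planeRadius_nonneg (K : Set G) : 0 ≤ planeRadius a b K :=
  Real.sSup_nonneg (by rintro _ ⟨v, _, rfl⟩; positivity)

lemma mem_planeDisc_planeRadius (hc : IsClosedEmbedding (planeMap G a b)) {K : Set G}
    (hK : IsCompact K) {v : ℝ × ℝ} (hv : planeMap G a b v ∈ K⁻¹ * K) :
    v ∈ planeDisc (planeRadius a b K) := by
  have := topologicalGroup_of_lieGroup 𝓘(ℝ, E) ∞ (G := G)
  have h1 : IsCompact (planeMap G a b ⁻¹' (K⁻¹ * K)) := hc.isCompact_preimage (hK.inv.mul hK)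
  have h2 := (h1.image (f := fun v : ℝ × ℝ => √(v.1 ^ 2 + v.2 ^ 2)) (by fun_prop)).bddAbove
  have h3 : √(v.1 ^ 2 + v.2 ^ 2) ≤ planeRadius a b K := le_csSup h2 ⟨v, hv, rfl⟩
  exact (Real.sqrt_le_left (planeRadius_nonneg K)).1 h3

lemma isCompact_planeHull {K : Set G} (hK : IsCompact K) : IsCompact (planeHull a b K) := by
  have := topologicalGroup_of_lieGroup 𝓘(ℝ, E) ∞ (G := G)
  exact hK.mul ((isCompact_planeDisc _).image (contMDiff_planeMap a b).continuous)

lemma mul_planeMap_mem_planeHull {K : Set G} {v : ℝ × ℝ} {k : G} (hk : k ∈ K)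
    (hv : v ∈ planeDisc (planeRadius a b K)) : k * planeMap G a b v ∈ planeHull a b K :=
  mul_mem_mul hk (mem_image_of_mem _ hv)

section Metric

variable [RiemannianBundle (fun p : G => TangentSpace 𝓘(ℝ, E) p)]

/-- The support theorem of the plane, applied to the restriction of `f` to the translate of the
plane through a point outside of the hull. -/
lemma IsFlatPair.tsupport_subset [SimplyConnectedSpace G] (h : IsFlatPair G a b)
    (hinv : IsLeftInvariantMetric E G) {m : ℕ} (hm : ∀ g : G, (adj (E := E) g - 1) ^ m = 0)
    {K : Set G} (hK : IsCompact K) {f : G → ℝ} (hf : Continuous f) (hfc : HasCompactSupport f)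
    (hX : ∀ γ : ℝ → G, IsEscapingGeodesic (E := E) γ → range γ ⊆ univ \ K → xrayTransform f γ = 0) :
    tsupport f ⊆ planeHull a b K := by
  have hc := isClosedEmbedding_planeMap h.bracket_eq_zero h.linearIndependent hm
  refine closure_minimal (fun p hp => ?_) (isCompact_planeHull hK).isClosed
  by_contra hpK
  refine hp ?_
  have hcp := isClosedEmbedding_mul_planeMap h.bracket_eq_zero h.linearIndependent hm p
  -- a disc that contains the part of `K` in the plane through `p`, but not the point `p`
  obtain ⟨u₀, r, hr, hu₀, hKr⟩ : ∃ (u₀ : ℝ × ℝ) (r : ℝ), 0 ≤ r ∧ r ^ 2 < u₀.1 ^ 2 + u₀.2 ^ 2 ∧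
      ∀ u : ℝ × ℝ, p * planeMap G a b u ∈ K → (u.1 - u₀.1) ^ 2 + (u.2 - u₀.2) ^ 2 ≤ r ^ 2 := by
    by_cases hemp : ∃ u₀, p * planeMap G a b u₀ ∈ K
    · obtain ⟨u₀, hu₀⟩ := hemp
      refine ⟨u₀, planeRadius a b K, planeRadius_nonneg K, ?_, fun u hu => ?_⟩
      · by_contra hle
        refine hpK ?_
        have h1 : -u₀ ∈ planeDisc (planeRadius a b K) := by
          simpa [planeDisc] using hle
        have := mul_planeMap_mem_planeHull hu₀ h1
        rwa [planeMap_neg h.bracket_eq_zero, mul_inv_cancel_right] at this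
      · have h1 : planeMap G a b (u - u₀) ∈ K⁻¹ * K := by
          refine ⟨(p * planeMap G a b u₀)⁻¹, inv_mem_inv.2 hu₀, _, hu, ?_⟩
          rw [sub_eq_add_neg, add_comm, planeMap_add h.bracket_eq_zero, planeMap_neg h.bracket_eq_zero]
          show (p * planeMap G a b u₀)⁻¹ * (p * planeMap G a b u) = _
          group
        exact mem_planeDisc_planeRadius hc hK h1
    · push Not at hemp
      exact ⟨(1, 0), 0, le_rfl, by norm_num, fun u hu => absurd hu (hemp u)⟩
  have key := plane_support_theorem (h := fun z => f (p * planeMap G a b z)) (hf.comp hcp.continuous)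
    (hfc.comp_isClosedEmbedding hcp) (u₀ := u₀) hr (fun u w hw hline => ?_) (u := 0)
    (by simpa using hu₀)
  · simpa [planeMap_zero] using key
  · refine hX _ (h.isEscapingGeodesic hinv hm p u w hw) ?_
    rintro _ ⟨t, rfl⟩
    refine ⟨mem_univ _, fun hK => ?_⟩
    have h1 := hKr _ hK
    have h2 := hline t
    simp only [Prod.fst_add, Prod.snd_add, Prod.smul_fst, Prod.smul_snd, smul_eq_mul] at h1
    linarith

variable [IsContMDiffRiemannianBundle 𝓘(ℝ, E) ∞ E (fun p : G => TangentSpace 𝓘(ℝ, E) p)]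

/-- If compact sets shrink to a point, so do their hulls. -/
lemma tendsto_riemannianDiam_planeHull (hc : IsClosedEmbedding (planeMap G a b)) {K : ℕ → Set G}
    (hK : ∀ n, IsCompact (K n)) (hmono : ∀ n, K (n + 1) ⊆ K n)
    (hdiam : Tendsto (fun n => riemannianDiam E (K n)) atTop (𝓝 0)) :
    Tendsto (fun n => riemannianDiam E (planeHull a b (K n))) atTop (𝓝 0) := by
  have := topologicalGroup_of_lieGroup 𝓘(ℝ, E) ∞ (G := G)
  have : IsManifold 𝓘(ℝ, E) 1 G := .of_le (n := ∞) (by simp)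
  have : IsContinuousRiemannianBundle E (fun p : G => TangentSpace 𝓘(ℝ, E) p) := by
    obtain ⟨g, hg, hg'⟩ := IsContMDiffRiemannianBundle.exists_contMDiff (IB := 𝓘(ℝ, E)) (n := ∞)
      (F := E) (E := fun p : G => TangentSpace 𝓘(ℝ, E) p)
    exact ⟨g, hg.continuous, hg'⟩
  have hanti : Antitone K := antitone_nat_of_succ_le hmono
  by_cases hemp : ∃ n, K n = ∅
  · obtain ⟨N, hN⟩ := hemp
    refine tendsto_const_nhds.congr' ?_
    filter_upwards [eventually_ge_atTop N] with n hn
    have : K n = ∅ := subset_empty_iff.1 (hN ▸ hanti hn)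
    simp [this, planeHull, riemannianDiam]
  obtain ⟨p, hp⟩ := IsCompact.nonempty_iInter_of_sequence_nonempty_isCompact_isClosed K hmono
    (fun n => nonempty_iff_ne_empty.2 fun h => hemp ⟨n, h⟩) (hK 0) (fun n => (hK n).isClosed)
  have hp' : ∀ n, p ∈ K n := mem_iInter.1 hp
  have hsmall : ∀ U ∈ 𝓝 p, ∀ᶠ n in atTop, K n ⊆ U := by
    intro U hU
    obtain ⟨c, hc, hcU⟩ := setOfPred_riemannianEDist_lt_subset_nhds' 𝓘(ℝ, E) hU
    filter_upwards [hdiam.eventually_lt_const hc] with n hn q hq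
    refine hcU (lt_of_le_of_lt ?_ hn)
    exact (le_iSup₂ (f := fun y (_ : y ∈ K n) => Manifold.riemannianEDist 𝓘(ℝ, E) p y) q hq).trans
      (le_iSup₂ (f := fun x (_ : x ∈ K n) => ⨆ y ∈ K n, Manifold.riemannianEDist 𝓘(ℝ, E) x y) p (hp' n))
  have hrad : ∀ ε > 0, ∀ᶠ n in atTop, planeRadius a b (K n) ≤ ε := by
    intro ε hε
    have h1 : {v : ℝ × ℝ | √(v.1 ^ 2 + v.2 ^ 2) < ε} ∈ 𝓝 (0 : ℝ × ℝ) :=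
      (isOpen_lt (by fun_prop) continuous_const).mem_nhds (by simpa using hε)
    rw [hc.isInducing.nhds_eq_comap, planeMap_zero] at h1
    obtain ⟨V, hV, hVs⟩ := mem_comap.1 h1
    have h2 : ContinuousAt (fun q : G × G => q.1⁻¹ * q.2) (p, p) := by fun_prop
    have h3 : (fun q : G × G => q.1⁻¹ * q.2) ⁻¹' V ∈ 𝓝 (p, p) := h2 (by simpa using hV)
    obtain ⟨U, hU, U', hU', hUU⟩ := mem_nhds_prod_iff.1 h3
    filter_upwards [hsmall _ (inter_mem hU hU')] with n hn
    refine Real.sSup_le ?_ hε.le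
    rintro _ ⟨v, hv, rfl⟩
    obtain ⟨q, hq, q', hq', hqq⟩ := hv
    refine le_of_lt (hVs (?_ : planeMap G a b v ∈ V))
    rw [← hqq]
    have := hUU (mk_mem_prod (hn (mem_inv.1 hq)).1 (hn hq').2)
    simpa using this
  have hhull : ∀ U ∈ 𝓝 p, ∀ᶠ n in atTop, planeHull a b (K n) ⊆ U := by
    intro U hU
    have h2 : ContinuousAt (fun q : G × (ℝ × ℝ) => q.1 * planeMap G a b q.2) (p, 0) :=
      (continuous_fst.mul (hc.continuous.comp continuous_snd)).continuousAt
    have h3 : (fun q : G × (ℝ × ℝ) => q.1 * planeMap G a b q.2) ⁻¹' U ∈ 𝓝 (p, (0 : ℝ × ℝ)) :=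
      h2 (by simpa [planeMap_zero] using hU)
    obtain ⟨U₁, hU₁, W, hW, hUW⟩ := mem_nhds_prod_iff.1 h3
    obtain ⟨ε, hε, hεW⟩ := Metric.nhds_basis_closedBall.mem_iff.1 hW
    filter_upwards [hsmall _ hU₁, hrad ε hε] with n hn hr
    rintro _ ⟨k, hk, _, ⟨v, hv, rfl⟩, rfl⟩
    refine hUW (mk_mem_prod (hn hk) (hεW ?_))
    have hv' : v.1 ^ 2 + v.2 ^ 2 ≤ planeRadius a b (K n) ^ 2 := hv
    have hr2 : planeRadius a b (K n) ^ 2 ≤ ε ^ 2 := pow_le_pow_left₀ (planeRadius_nonneg _) hr 2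
    rw [mem_closedBall_zero_iff, Prod.norm_def, max_le_iff]
    exact ⟨abs_le_of_sq_le_sq (by nlinarith [sq_nonneg v.2]) hε.le,
      abs_le_of_sq_le_sq (by nlinarith [sq_nonneg v.1]) hε.le⟩
  rw [ENNReal.tendsto_nhds_zero]
  intro ε hε
  have hε2 : 0 < ε / 2 := ENNReal.half_pos hε.ne'
  filter_upwards [hhull _ (eventually_riemannianEDist_lt 𝓘(ℝ, E) p hε2)] with n hn
  refine (riemannianDiam_le_of_forall (p := p) fun q hq => (hn hq).le).trans ?_
  rw [ENNReal.mul_div_cancel two_ne_zero ENNReal.ofNat_ne_top]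

lemma IsFlatPair.hasSupportTheorem [SimplyConnectedSpace G] (h : IsFlatPair G a b)
    (hinv : IsLeftInvariantMetric E G) {m : ℕ} (hm : ∀ g : G, (adj (E := E) g - 1) ^ m = 0) :
    HasSupportTheorem E G :=
  ⟨planeHull a b, fun _ hK => ⟨isCompact_planeHull hK, fun _ hf hfc hX =>
    h.tsupport_subset hinv hm hK hf hfc hX⟩, fun _ hK hmono hdiam =>
    tendsto_riemannianDiam_planeHull
      (isClosedEmbedding_planeMap h.bracket_eq_zero h.linearIndependent hm) hK hmono hdiam⟩

end Metric

end SupportTheorem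

/-! ### Flat pairs in nilpotent Lie algebras -/

lemma finrank_le_finrank_ker_add {V W : Type*} [AddCommGroup V] [Module ℝ V] [FiniteDimensional ℝ V]
    [AddCommGroup W] [Module ℝ W] [FiniteDimensional ℝ W] (f : V →ₗ[ℝ] W) :
    Module.finrank ℝ V ≤ Module.finrank ℝ (LinearMap.ker f) + Module.finrank ℝ W := by
  rw [← f.finrank_range_add_finrank_ker, add_comm]
  exact Nat.add_le_add_left (Submodule.finrank_le _) _

section FlatPair

variable {E : Type*} [NormedAddCommGroup E] [NormedSpace ℝ E] [FiniteDimensional ℝ E] [CompleteSpace E]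
  {G : Type*} [TopologicalSpace G] [T2Space G] [ChartedSpace E G] [Group G] [LieGroup 𝓘(ℝ, E) ∞ G]
  [RiemannianBundle (fun p : G => TangentSpace 𝓘(ℝ, E) p)]

/-- Commuting independent vectors can be orthonormalized within their span. -/
lemma exists_isFlatPair_of_mem {P : Submodule ℝ E}
    (hP : ∀ v ∈ P, ∀ w, innerOne G v (leftBracket G v w) = 0) {x y : E} (hx : x ∈ P) (hy : y ∈ P)
    (hxy : LinearIndependent ℝ ![x, y]) (hbr : leftBracket G x y = 0) :
    ∃ a b : E, IsFlatPair G a b := by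
  have hnorm : ∀ v : E, v ≠ 0 → ∃ r : ℝ, r ≠ 0 ∧ innerOne G (r • v) (r • v) = 1 := by
    intro v hv
    have h1 : 0 < innerOne G v v :=
      lt_of_le_of_ne (innerOne_self_nonneg v) fun h => hv (innerOne_self_eq_zero.1 h.symm)
    have h2 : √(innerOne G v v) ≠ 0 := (Real.sqrt_pos.2 h1).ne'
    refine ⟨(√(innerOne G v v))⁻¹, inv_ne_zero h2, ?_⟩
    simp only [map_smul, LinearMap.smul_apply, smul_eq_mul]
    field_simp
    exact (Real.sq_sqrt h1.le).symm
  have hind := LinearIndependent.pair_iff.1 hxy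
  obtain ⟨r, hr, hr1⟩ := hnorm x fun h => one_ne_zero (hind 1 0 (by simp [h])).1
  obtain ⟨a, ha⟩ : ∃ a, a = r • x := ⟨_, rfl⟩
  rw [← ha] at hr1
  obtain ⟨s, hs, hs1⟩ := hnorm (y - innerOne G a y • a) fun h => by
    refine one_ne_zero (hind (-(innerOne G a y * r)) 1 ?_).2
    rw [← h, ha]
    module
  have haP : a ∈ P := ha ▸ P.smul_mem r hx
  have hbP : s • (y - innerOne G a y • a) ∈ P := P.smul_mem s (P.sub_mem hy (P.smul_mem _ haP))
  refine ⟨a, s • (y - innerOne G a y • a), ?_, hr1, hs1, ?_, fun v w => hP _ ?_ w⟩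
  · have h1 : leftBracket G a y = 0 := by rw [ha, map_smul, smul_apply, hbr, smul_zero]
    rw [map_smul, map_sub, map_smul, h1, leftBracket_self, smul_zero, sub_zero, smul_zero]
  · rw [map_smul, map_sub, map_smul, hr1]
    simp
  · rw [planeVec_apply]
    exact P.add_mem (P.smul_mem _ haP) (P.smul_mem _ hbP)

/-- The orthogonal complement of `𝔤_i` in `𝔤_{i+1}` has dimension at least `2 + dim 𝔤_i`, so that the
centralizer in it of each of its elements has dimension at least `2`. -/
lemma exists_isFlatPair {i : ℕ} (h : 1 + 2 * Module.finrank ℝ (modelUcs E G i)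
      < Module.finrank ℝ (modelUcs E G (i + 1))) :
    ∃ a b : E, IsFlatPair G a b := by
  set W := modelUcs E G i with hW
  set U := modelUcs E G (i + 1) with hU
  -- the orthogonal complement of `W`, and its intersection with `U`
  let L : E →ₗ[ℝ] (W →ₗ[ℝ] ℝ) := (LinearMap.lcomp ℝ ℝ W.subtype).comp (innerOne G)
  let P : Submodule ℝ E := U ⊓ LinearMap.ker L
  have hPW : ∀ v ∈ P, ∀ w ∈ W, innerOne G v w = 0 := fun v hv w hw =>
    LinearMap.congr_fun (LinearMap.mem_ker.1 hv.2) (⟨w, hw⟩ : W)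
  have hbr : ∀ v ∈ P, ∀ w, leftBracket G v w ∈ W := fun v hv w => by
    rw [leftBracket_skew]
    exact W.neg_mem (mem_modelUcs_succ.1 hv.1 w)
  have hdimP : 1 + Module.finrank ℝ W < Module.finrank ℝ P := by
    have h1 := finrank_le_finrank_ker_add (L.comp U.subtype)
    have h2 : Module.finrank ℝ (W →ₗ[ℝ] ℝ) = Module.finrank ℝ W := Subspace.dual_finrank_eq
    have h3 : Module.finrank ℝ (LinearMap.ker (L.comp U.subtype)) ≤ Module.finrank ℝ P := by
      rw [← Submodule.finrank_map_subtype_eq]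
      refine Submodule.finrank_mono ?_
      rintro _ ⟨v, hv, rfl⟩
      exact ⟨v.2, hv⟩
    omega
  obtain ⟨x, hx⟩ : ∃ x : P, x ≠ 0 := by
    have : Nontrivial P := Module.nontrivial_of_finrank_pos (R := ℝ) (by omega)
    exact exists_ne 0
  -- the centralizer of `x` in `P`
  let A : P →ₗ[ℝ] W := ((leftBracket G (x : E)).toLinearMap.comp P.subtype).codRestrict W
    fun v => hbr x x.2 v
  have hdimA := finrank_le_finrank_ker_add A
  obtain ⟨y, hyA, hy⟩ : ∃ y ∈ LinearMap.ker A, y ∉ Submodule.span ℝ {x} := by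
    by_contra! hcon
    have h1 := Submodule.finrank_mono (show LinearMap.ker A ≤ Submodule.span ℝ {x} from hcon)
    have h2 := finrank_span_singleton (K := ℝ) hx
    omega
  refine exists_isFlatPair_of_mem (P := P) (fun v hv w => hPW v hv _ (hbr v hv w)) x.2 y.2
    (LinearIndependent.pair_iff.2 fun s t hst => ?_) ?_
  · have hst' : s • x + t • y = 0 := Subtype.ext hst
    have ht : t = 0 := by
      by_contra ht
      refine hy (Submodule.mem_span_singleton.2 ⟨-(t⁻¹ * s), ?_⟩)
      have h1 : t • y = -(s • x) := by rw [eq_neg_iff_add_eq_zero, add_comm]; exact hst'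
      rw [neg_smul, mul_smul, ← smul_neg, ← h1, smul_smul, inv_mul_cancel₀ ht, one_smul]
    rw [ht, zero_smul, add_zero, smul_eq_zero] at hst'
    exact ⟨hst'.resolve_right hx, ht⟩
  · exact congrArg Subtype.val (LinearMap.mem_ker.1 hyA)

end FlatPair

section Dimension

variable {E : Type*} [NormedAddCommGroup E] [NormedSpace ℝ E] [FiniteDimensional ℝ E] [CompleteSpace E]
  {G : Type*} [TopologicalSpace G] [ChartedSpace E G] [Group G] [LieGroup 𝓘(ℝ, E) ∞ G]

lemma exists_lt_finrank_modelUcs {i : ℕ} (h : 2 ^ i ≤ Module.finrank ℝ (modelUcs E G i)) :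
    ∃ j, 1 + 2 * Module.finrank ℝ (modelUcs E G j) < Module.finrank ℝ (modelUcs E G (j + 1)) := by
  by_contra! hcon
  have key : ∀ n, Module.finrank ℝ (modelUcs E G n) < 2 ^ n := by
    intro n
    induction n with
    | zero => rw [modelUcs_zero, finrank_bot]; norm_num
    | succ n ih =>
      have := hcon n
      rw [pow_succ]
      omega
  exact absurd h (not_le.2 (key i))

lemma finrank_upperCentral_quotient_add (i : ℕ) :
    Module.finrank ℝ (upperCentral E G (i + 1) ⧸
      (upperCentral E G i).submoduleOf (upperCentral E G (i + 1)))
      + Module.finrank ℝ (modelUcs E G i) = Module.finrank ℝ (modelUcs E G (i + 1)) := by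
  have h1 : Module.finrank ℝ ((modelUcs E G i).submoduleOf (modelUcs E G (i + 1)))
      = Module.finrank ℝ (modelUcs E G i) :=
    (Submodule.submoduleOfEquivOfLe (modelUcs_le_succ i)).finrank_eq
  have h2 := Submodule.finrank_quotient_add_finrank ((modelUcs E G i).submoduleOf (modelUcs E G (i + 1)))
  rw [h1] at h2
  exact h2

lemma modelUcs_nilpotencyLength_eq_top (hnil : LieRing.IsNilpotent (GroupLieAlgebra 𝓘(ℝ, E) G)) :
    modelUcs E G (LieModule.nilpotencyLength (GroupLieAlgebra 𝓘(ℝ, E) G) (GroupLieAlgebra 𝓘(ℝ, E) G))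
      = ⊤ := by
  set k := LieModule.nilpotencyLength (GroupLieAlgebra 𝓘(ℝ, E) G) (GroupLieAlgebra 𝓘(ℝ, E) G) with hk
  have h1 : LieModule.lowerCentralSeries ℤ (GroupLieAlgebra 𝓘(ℝ, E) G) (GroupLieAlgebra 𝓘(ℝ, E) G) k
      = ⊥ := Nat.sInf_mem (LieModule.IsNilpotent.nilpotent ℤ _ _)
  have h2 : LieModule.lowerCentralSeries ℝ (GroupLieAlgebra 𝓘(ℝ, E) G) (GroupLieAlgebra 𝓘(ℝ, E) G) k
      = ⊥ := by
    rw [SetLike.ext'_iff, LieModule.coe_lowerCentralSeries_eq_int, h1]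
    rfl
  have h3 := (LieSubmodule.ucs_eq_top_iff (R := ℝ) (L := GroupLieAlgebra 𝓘(ℝ, E) G) (N := ⊥) k).2 h2.le
  exact congrArg LieSubmodule.toSubmodule h3

lemma finrank_modelUcs_one : Module.finrank ℝ (modelUcs E G 1)
    = Module.finrank ℝ (LieAlgebra.center ℝ (GroupLieAlgebra 𝓘(ℝ, E) G)) := by
  have h := LieSubmodule.ucs_bot_one (R := ℝ) (L := GroupLieAlgebra 𝓘(ℝ, E) G)
    (M := GroupLieAlgebra 𝓘(ℝ, E) G)
  show Module.finrank ℝ ((⊥ : LieSubmodule ℝ (GroupLieAlgebra 𝓘(ℝ, E) G)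
    (GroupLieAlgebra 𝓘(ℝ, E) G)).ucs 1) = _
  rw [h]

end Dimension

theorem mainTheorem3
    {E : Type*} [NormedAddCommGroup E] [NormedSpace ℝ E] [FiniteDimensional ℝ E] [CompleteSpace E]
    {G : Type*} [TopologicalSpace G] [T2Space G] [ChartedSpace E G] [Group G]
    [LieGroup 𝓘(ℝ, E) ∞ G] [SimplyConnectedSpace G]
    [RiemannianBundle (fun p : G => TangentSpace 𝓘(ℝ, E) p)]
    [IsContMDiffRiemannianBundle 𝓘(ℝ, E) ∞ E (fun p : G => TangentSpace 𝓘(ℝ, E) p)]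
    (hinv : IsLeftInvariantMetric E G)
    (k : ℕ) (hnil : LieRing.IsNilpotent (GroupLieAlgebra 𝓘(ℝ, E) G))
    (hk : LieModule.nilpotencyLength (GroupLieAlgebra 𝓘(ℝ, E) G) (GroupLieAlgebra 𝓘(ℝ, E) G) = k) :
    ((∃ i ∈ Icc 1 k,
        Module.finrank ℝ (upperCentral E G i ⧸
          (upperCentral E G (i - 1)).submoduleOf (upperCentral E G i))
          > 1 + Module.finrank ℝ (upperCentral E G (i - 1))) →
      HasTranslatedEuclideanPlaneCover E G ∧ HasSupportTheorem E G) ∧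
    ((∃ i ∈ Icc 1 k, 2 ^ i ≤ Module.finrank ℝ (upperCentral E G i)) →
      HasTranslatedEuclideanPlaneCover E G ∧ HasSupportTheorem E G) ∧
    (2 ^ k ≤ Module.finrank ℝ (GroupLieAlgebra 𝓘(ℝ, E) G) →
      HasTranslatedEuclideanPlaneCover E G ∧ HasSupportTheorem E G) ∧
    (2 ≤ Module.finrank ℝ (LieAlgebra.center ℝ (GroupLieAlgebra 𝓘(ℝ, E) G)) →
      HasTranslatedEuclideanPlaneCover E G ∧ HasSupportTheorem E G) := by
  have hm : ∀ g : G, (adj (E := E) g - 1) ^ k = 0 :=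
    adj_sub_one_pow_eq_zero (hk ▸ modelUcs_nilpotencyLength_eq_top hnil)
  have main : (∃ j, 1 + 2 * Module.finrank ℝ (modelUcs E G j)
      < Module.finrank ℝ (modelUcs E G (j + 1))) →
      HasTranslatedEuclideanPlaneCover E G ∧ HasSupportTheorem E G := by
    rintro ⟨j, hj⟩
    obtain ⟨a, b, h⟩ := exists_isFlatPair (G := G) hj
    exact ⟨IsFlatPair.hasTranslatedEuclideanPlaneCover (x := a) (y := b) h hinv hm,
      h.hasSupportTheorem hinv hm⟩
  refine ⟨?_, ?_, ?_, ?_⟩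
  · rintro ⟨i, hi, h⟩
    obtain ⟨j, rfl⟩ : ∃ j, i = j + 1 := ⟨i - 1, by have := hi.1; omega⟩
    refine main ⟨j, ?_⟩
    have h1 := finrank_upperCentral_quotient_add (E := E) (G := G) j
    have h2 : _ > 1 + Module.finrank ℝ (modelUcs E G j) := h
    rw [Nat.add_sub_cancel] at h2
    omega
  · rintro ⟨i, -, h⟩
    exact main (exists_lt_finrank_modelUcs h)
  · intro h
    refine main (exists_lt_finrank_modelUcs (i := k) ?_)
    rw [← hk, modelUcs_nilpotencyLength_eq_top hnil, finrank_top, hk]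
    exact h
  · intro h
    refine main (exists_lt_finrank_modelUcs (i := 1) ?_)
    rw [finrank_modelUcs_one]
    exact h
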